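/- **Setting.** Let $\lambda$ be the security parameter. Public parameters are the dimensions $m,n,d$, the bit length $L$ and a number $t$. Party $\mathcal P_0$ holds a matrix $A\in\mathbb M_{m,n}(\mathbb Z_{2^L})$ with exactly $t$ non-zero entries; party $\mathcal P_1$ holds $X\in\mathbb M_{n,d}(\mathbb Z_{2^L})$. The ideal functionality $\mathcal F_{(SM)^2}$ outputs uniformly random additive shares $\langle AX\rangle_0$ (to $\mathcal P_0$) and $\langle AX\rangle_1$ (to $\mathcal P_1$), $\langle AX\rangle_0+\langle AX\rangle_1=AX$. **Decomposition.** A *decomposition* of $A$ is $A=\sigma_5\,\delta_m^{\top}\,\Gamma_{out}\,\sigma_4\,\Sigma^{\top}\,\Lambda\,\sigma_3\,\Sigma\,\sigma_2\,\Gamma_{in}\,\delta_n\,\sigma_1$ with permutations $\sigma_1\in\mathbb S_n$, $\sigma_2,\sigma_3,\sigma_4\in\mathbb S_t$, $\sigma_5\in\mathbb S_m$ (as permutation matrices), a diagonal $t\times t$ matrix $\Lambda$, the $t\times t$ summation matrix $\Sigma[i,j]=1$ for $i\ge j$ and $0$ otherwise, the difference matrices $\delta_k$ ($1$ on the diagonal,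 $-1$ just below it, $0$ elsewhere), and the $t\times n$ and $m\times t$ matrices $\Gamma_{in},\Gamma_{out}$ whose only non-zero entries are ones in the first $n_{col}$, respectively $n_{row}$, diagonal positions, where $n_{col}$ and $n_{row}$ are the numbers of non-zero columns and rows of $A$. **Protocol.** Let $\mathsf{PRF}$ be a polynomial-time computable function keyed by $\lambda$-bit strings, whose value at a counter is a tuple of the requested format (a permutation, bits, elements of $\mathbb Z_{2^L}$). An offline dealer, which receives no input, shares a uniformly random key $\mathsf{key}_i$ with $\mathcal P_i$ for $i\in\{0,1\}$. Every instance below uses its own counter. Values with index $0$, and $\pi,b,a_0$, come from $\mathsf{PRF}(\mathsf{key}_0,\cdot)$; $U$ and the values $u_1,a_1,b_1$ come from $\mathsf{PRF}(\mathsf{key}_1,\cdot)$; the dealer sends the value marked (T) to $\mathcal P_1$. * $\Pi_{OP}$: $\mathcal P_0$ holds $\sigma\in\mathbb S_k$ and $x\in\mathbb Z_{2^L}^k$ is shared as $x_0+x_1$ (or is held by $\mathcal P_1$: $x_1=x$, $x_0=0$). Randomness $\pi\in\mathbb S_k$, $p_0,U\in\mathbb Z_{2^L}^k$; (T) $p_1=\pi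 U-p_0$. $\mathcal P_0$ sends $\delta_\sigma=\sigma\pi^{-1}$, $\mathcal P_1$ sends $\delta=x_1-U$. Output shares of $\sigma x$: $\sigma\delta+\delta_\sigma p_0+\sigma x_0$ and $\delta_\sigma p_1$. * $\Pi_{OSM}$: $\mathcal P_0$ holds a bit $s$ and $x=x_0+x_1\in\mathbb Z_{2^L}$ is shared. Randomness: a bit $b$, and $u_0,v_0,u_1\in\mathbb Z_{2^L}$; (T) $v_1=b(u_0+u_1)-v_0$. $\mathcal P_0$ sends $\delta_s=s-b\bmod 2$, $\mathcal P_1$ sends $x_1-u_1$. Output shares of $sx$: $s(x_0-u_0+x_1-u_1)+\delta_su_0+(-1)^{\delta_s}v_0$ and $\delta_su_1+(-1)^{\delta_s}v_1$. * $\Pi_{Mult}$: standard Beaver multiplication of shared $x=x_0+x_1$, $y=y_0+y_1$ with randomness $a_0,b_0,c_0$ and $a_1,b_1$; (T) $c_1=(a_0+a_1)(b_0+b_1)-c_0$. Each $\mathcal P_i$ sends $e_i=x_i-a_i$ and $f_i=y_i-b_i$; with $e=e_0+e_1$, $f=f_0+f_1$ the output shares of $xy$ are $eb_0+fa_0+c_0$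 and $ef+eb_1+fa_1+c_1$. In $\Pi_{(SM)^2}$, $\mathcal P_0$ decomposes $A$ with a deterministic polynomial-time algorithm, and the parties apply the factors of the decomposition to $X$ from right to left: each $\sigma_i$ by $\Pi_{OP}$ on the $d$ columns in parallel (for $\sigma_1$ with $X$ held by $\mathcal P_1$), $\Gamma_{in}$ and $\Gamma_{out}$ by $\Pi_{OSM}$ on the entries of a matrix with $n$, respectively $m$, rows (zero rows being padded or rows cut off locally), $\Lambda$ by $\Pi_{Mult}$ on the entries, with $\Lambda$ shared as $\Lambda+0$, and the public matrices $\delta_n,\Sigma,\Sigma^{\top},\delta_m^{\top}$ locally on the shares. Each party outputs its share of the final matrix. **Security notion.** The view of a party consists of the public parameters, its input, its key and all messages it receives. A protocol $\Pi$ *securely realizes* $\mathcal F$ against static semi-honest adversaries if there are probabilistic polynomial-time simulators $\mathcal S_0,\mathcal S_1$ such that, for $i\in\{0,1\}$, the ensembles $\{\mathcal S_i(1^\lambda,\text{public parameters},x_i,y_i),(y_0,y_1)\}$ with $(y_0,y_1)\leftarrow\mathcal F(x_0,x_1)$, and $\{\mathsf{view}_i^{\Pi},\mathsf{output}^{\Pi}\}$,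 where $\mathsf{output}^\Pi$ is the pair of outputs of both parties, are computationally indistinguishable: for every non-uniform probabilistic polynomial-time distinguisher and every polynomial $q$ there is a negligible function that bounds its advantage for all $\lambda$ and all public parameters and inputs of total length at most $q(\lambda)$ (dimensions and bit length being counted in unary). $\mathsf{PRF}$ is *secure* if no non-uniform probabilistic polynomial-time oracle algorithm distinguishes it, under a uniformly random $\lambda$-bit key, from a uniformly random function with more than negligible advantage. **Theorem (Security of $\Pi_{(SM)^2}$).** Assume that $\mathsf{PRF}$ is secure. Then a deterministic polynomial-time algorithm that decomposes every $A$ exists, and for every such algorithm the protocol $\Pi_{(SM)^2}$ securely realizes $\mathcal F_{(SM)^2}$ against static semi-honest adversaries. -/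

import Mathlib

open scoped Matrix

namespace SMM

noncomputable section

/- ======================= Machine model ======================= -/

/-- Data handled by algorithms: binary trees with natural numbers (written in binary) at the
leaves. -/
inductive Data : Type
  | nat (n : ℕ)
  | pair (a b : Data)

namespace Data

/-- The bit size of a datum. -/
def size : Data → ℕ
  | nat n => Nat.size n + 1
  | pair a b => a.size + b.size + 1

/-- The number stored in a leaf. -/
def toNat : Data → ℕ
  | nat n => n
  | pair _ _ => 0

/-- The length of a datum, read as a list. -/
def length : Data → ℕ
  | nat _ => 0
  | pair _ b => b.length + 1

def fst : Data → Data
  | nat _ => nat 0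
  | pair a _ => a

def snd : Data → Data
  | nat _ => nat 0
  | pair _ b => b

def isPair : Data → ℕ
  | nat _ => 0
  | pair _ _ => 1

/-- A list of data as one datum. -/
def list : List Data → Data
  | [] => nat 0
  | a :: l => pair a (list l)

/-- The number `n` written in unary (the string `1^n`). -/
def unary (n : ℕ) : Data := list (List.replicate n (nat 0))

/-- A bit string. -/
def bits {l : ℕ} (r : Fin l → Bool) : Data :=
  list (List.ofFn fun i => nat (if r i then 1 else 0))

end Data

/-- Arithmetic instructions. -/
inductive Op : Type
  | add | sub | mul | div | mod | lt

def Op.apply : Op → ℕ → ℕ → ℕ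
  | .add, a, b => a + b
  | .sub, a, b => a - b
  | .mul, a, b => a * b
  | .div, a, b => a / b
  | .mod, a, b => a % b
  | .lt, a, b => if a < b then 1 else 0

/-- Programs: each maps one datum to one datum. `query` calls an oracle. -/
inductive Prog : Type
  | id
  | const (c : ℕ)
  | fst
  | snd
  | isPair
  | length
  | op (o : Op)
  | query
  | pair (p q : Prog)
  | seq (p q : Prog)
  | ite (c p q : Prog)
  | loop (c b : Prog)

namespace Prog

/-- The value computed by a program on `x`, with oracle `O`. `seq p q` runs `p` and then `q`;
`ite c p q` runs `q` if `c` returns the number `0` and `p` otherwise; `loop c b` iterates `b`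
as often as the number returned by `c` says. -/
def eval (O : Data → Data) : Prog → Data → Data
  | .id, x => x
  | .const c, _ => .nat c
  | .fst, x => x.fst
  | .snd, x => x.snd
  | .isPair, x => .nat x.isPair
  | .length, x => .nat x.length
  | .op o, x => .nat (o.apply x.fst.toNat x.snd.toNat)
  | .query, x => O x
  | .pair p q, x => .pair (p.eval O x) (q.eval O x)
  | .seq p q, x => q.eval O (p.eval O x)
  | .ite c p q, x =>
      match c.eval O x with
      | .nat 0 => q.eval O x
      | _ => p.eval O x
  | .loop c b, x => (b.eval O)^[(c.eval O x).toNat] x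

/-- The running time of a program on `x`: every elementary instruction costs the bit sizes of
what it reads and of what it writes, and every executed instruction is counted. -/
def cost (O : Data → Data) : Prog → Data → ℕ
  | .pair p q, x => p.cost O x + q.cost O x + 1
  | .seq p q, x => p.cost O x + q.cost O (p.eval O x) + 1
  | .ite c p q, x =>
      c.cost O x + 1 +
        match c.eval O x with
        | .nat 0 => q.cost O x
        | _ => p.cost O x
  | .loop c b, x =>
      c.cost O x + x.size + 1 +
        ∑ i ∈ Finset.range (c.eval O x).toNat, (b.cost O ((b.eval O)^[i] x) + 1)
  | p, x => x.size + (p.eval O x).size + 1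

/-- The trivial oracle. -/
def noOracle : Data → Data := fun _ => .nat 0

/-- Running a program without an oracle. -/
def run (p : Prog) (x : Data) : Data := p.eval noOracle x

/-- The program runs in polynomial time (without an oracle). -/
def PolyTime (p : Prog) : Prop :=
  ∃ P : Polynomial ℕ, ∀ x, p.cost noOracle x ≤ P.eval x.size

end Prog

/- ======================= Probability and indistinguishability ======================= -/

/-- The uniform distribution on bit strings of length `l`. -/
def coins (l : ℕ) : PMF (Fin l → Bool) := PMF.uniformOfFintype _

/-- The probability that the output is the number `1`. -/
def accept (μ : PMF Data) : ℝ := (μ (.nat 1)).toReal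

/-- Negligible functions of the security parameter. -/
def Negligible (μ : ℕ → ℝ) : Prop :=
  Asymptotics.SuperpolynomialDecay Filter.atTop (fun n : ℕ => (n : ℝ)) μ

/-- A (uniform) probabilistic polynomial-time algorithm: a polynomial-time program that is given,
besides its input, a uniformly random tape of polynomial length. -/
structure PPT where
  prog : Prog
  poly : prog.PolyTime
  tape : Polynomial ℕ

/-- The output distribution of a PPT algorithm. -/
def PPT.run (S : PPT) (x : Data) : PMF Data :=
  (coins (S.tape.eval x.size)).map fun r => S.prog.run (.pair x (.bits r))

/-- A non-uniform probabilistic polynomial-time distinguisher: it is given the security parameter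
in unary, an advice string of polynomial length that depends only on the security parameter,
a random tape of polynomial length, and a sample. -/
structure Distinguisher where
  prog : Prog
  poly : prog.PolyTime
  advice : ℕ → Data
  advice_poly : ∃ P : Polynomial ℕ, ∀ lam, (advice lam).size ≤ P.eval lam
  tape : Polynomial ℕ

def Distinguisher.run (D : Distinguisher) (lam : ℕ) (sample : Data) : PMF Data :=
  (coins (D.tape.eval lam)).map fun r =>
    D.prog.run (.list [.unary lam, D.advice lam, .bits r, sample])

/-- Computational indistinguishability of two ensembles indexed by the security parameter and an
input `a`, where the length of the input is polynomially bounded in the security parameter. -/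
def Indist {ι : Type} (len : ι → ℕ) (X Y : ℕ → ι → PMF Data) : Prop :=
  ∀ (D : Distinguisher) (q : Polynomial ℕ), ∃ μ : ℕ → ℝ, Negligible μ ∧
    ∀ (lam : ℕ) (a : ι), len a ≤ q.eval lam →
      |accept ((X lam a).bind (D.run lam)) - accept ((Y lam a).bind (D.run lam))| ≤ μ lam

/- ======================= Two-party computation ======================= -/

/-- The public parameters and the private inputs of a two-party task, with their encodings. -/
structure Task where
  Param : Type
  In₀ : Param → Type
  In₁ : Param → Type
  encParam : Param → Data
  enc₀ : ∀ p, In₀ p → Data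
  enc₁ : ∀ p, In₁ p → Data

namespace Task

/-- The joint inputs: public parameters and the two private inputs. -/
def Input (T : Task) : Type := Σ p : T.Param, T.In₀ p × T.In₁ p

def Input.len {T : Task} (a : T.Input) : ℕ :=
  (T.encParam a.1).size + (T.enc₀ a.1 a.2.1).size + (T.enc₁ a.1 a.2.2).size

/-- An ideal functionality: the joint distribution of the two parties' outputs. -/
def Functionality (T : Task) : Type := T.Input → PMF (Data × Data)

/-- What an execution of a protocol produces. -/
structure Execution where
  view₀ : Data
  view₁ : Data
  out₀ : Data
  out₁ : Data

/-- A two-party protocol: the joint distribution, for each security parameter and input, of the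
parties' views and outputs. -/
def Protocol (T : Task) : Type := ℕ → T.Input → PMF Execution

/-- `{view₀, output}`. -/
def real₀ {T : Task} (Pi : T.Protocol) (lam : ℕ) (a : T.Input) : PMF Data :=
  (Pi lam a).map fun e => .list [e.view₀, e.out₀, e.out₁]

/-- `{view₁, output}`. -/
def real₁ {T : Task} (Pi : T.Protocol) (lam : ℕ) (a : T.Input) : PMF Data :=
  (Pi lam a).map fun e => .list [e.view₁, e.out₀, e.out₁]

/-- `{S₀(1^lam, x₀, F₀), F(x)}`: the simulator also knows the public parameters. -/
def ideal₀ {T : Task} (F : T.Functionality) (S : PPT) (lam : ℕ) (a : T.Input) : PMF Data :=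
  (F a).bind fun y =>
    (S.run (.list [.unary lam, T.encParam a.1, T.enc₀ a.1 a.2.1, y.1])).map fun v =>
      .list [v, y.1, y.2]

/-- `{S₁(1^lam, x₁, F₁), F(x)}`: the simulator also knows the public parameters. -/
def ideal₁ {T : Task} (F : T.Functionality) (S : PPT) (lam : ℕ) (a : T.Input) : PMF Data :=
  (F a).bind fun y =>
    (S.run (.list [.unary lam, T.encParam a.1, T.enc₁ a.1 a.2.2, y.2])).map fun v =>
      .list [v, y.1, y.2]

/-- The protocol securely realizes the functionality against static semi-honest adversaries. -/
def SecurelyRealizes {T : Task} (Pi : T.Protocol) (F : T.Functionality) : Prop :=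
  ∃ S₀ S₁ : PPT,
    Indist Input.len (ideal₀ F S₀) (real₀ Pi) ∧ Indist Input.len (ideal₁ F S₁) (real₁ Pi)

end Task

/- ======================= Encodings of algebraic objects ======================= -/

def encVec {k N : ℕ} (x : Fin k → ZMod N) : Data := .list (List.ofFn fun i => .nat (x i).val)

def encMat {k d N : ℕ} (M : Matrix (Fin k) (Fin d) (ZMod N)) : Data :=
  .list (List.ofFn fun i => encVec (M i))

def encPerm {k : ℕ} (s : Equiv.Perm (Fin k)) : Data :=
  .list (List.ofFn fun i => .nat (s i).val)

/- ======================= Pseudorandom functions ======================= -/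

/-- A query to the pseudorandom function: a counter and the format of the requested value,
which consists of a permutation of `k` elements, `b` bits and `l` elements of `ℤ/2^L`. -/
structure Query where
  ctr : ℕ
  k : ℕ
  b : ℕ
  l : ℕ
  L : ℕ

namespace Query

/-- The values in the requested format. -/
abbrev Range (q : Query) : Type :=
  Equiv.Perm (Fin q.k) × (Fin q.b → ZMod 2) × (Fin q.l → ZMod (2 ^ q.L))

/-- The counter is written in binary, the format in unary. -/
def enc (q : Query) : Data :=
  .list [.nat q.ctr, .unary q.k, .unary q.b, .unary q.l, .unary q.L]

def encValue {q : Query} (v : q.Range) : Data :=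
  .list [encPerm v.1, encVec v.2.1, encVec v.2.2]

end Query

/-- A keyed function with keys of `lam` bits, computable in polynomial time. -/
structure KeyedFunction where
  fn : (lam : ℕ) → (Fin lam → Bool) → (q : Query) → q.Range
  prog : Prog
  poly : prog.PolyTime
  computes : ∀ lam key q,
    prog.run (.list [.unary lam, .bits key, q.enc]) = Query.encValue (fn lam key q)

/-- The queries with a counter of at most `s` bits and a format of size at most `s`. -/
abbrev Dom (s : ℕ) : Type := Fin (2 ^ s) × Fin (s + 1) × Fin (s + 1) × Fin (s + 1) × Fin (s + 1)

def Dom.query {s : ℕ} (x : Dom s) : Query := ⟨x.1, x.2.1, x.2.2.1, x.2.2.2.1, x.2.2.2.2⟩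

/-- The functions that map each such query to a value in the requested format. -/
abbrev FinFun (s : ℕ) : Type := (x : Dom s) → (Dom.query x).Range

open Classical in
/-- Oracle access to a function; ill-formed or too large queries are answered by `0`. -/
def FinFun.oracle {s : ℕ} (g : FinFun s) : Data → Data := fun z =>
  if h : ∃ x : Dom s, (Dom.query x).enc = z then Query.encValue (g h.choose) else .nat 0

/-- A non-uniform PPT adversary against a pseudorandom function. All its queries are
confined to counters and formats of size at most the polynomial `bound`, which the adversary
chooses, and it runs in time polynomial in `lam`, whatever function it is given access to. -/
structure PRFAdversary where
  prog : Prog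
  advice : ℕ → Data
  advice_poly : ∃ P : Polynomial ℕ, ∀ lam, (advice lam).size ≤ P.eval lam
  tape : Polynomial ℕ
  bound : Polynomial ℕ
  poly : ∃ P : Polynomial ℕ, ∀ (lam : ℕ) (r : Fin (tape.eval lam) → Bool)
    (g : FinFun (bound.eval lam)),
    prog.cost g.oracle (.list [.unary lam, advice lam, .bits r]) ≤ P.eval lam

def PRFAdversary.run (B : PRFAdversary) (lam : ℕ) (g : FinFun (B.bound.eval lam)) : PMF Data :=
  (coins (B.tape.eval lam)).map fun r =>
    B.prog.eval g.oracle (.list [.unary lam, B.advice lam, .bits r])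

/-- The keyed function is a secure pseudorandom function: oracle access to it under a uniformly
random key is indistinguishable from oracle access to a uniformly random function. -/
def KeyedFunction.IsSecurePRF (F : KeyedFunction) : Prop :=
  ∀ B : PRFAdversary, Negligible fun lam =>
    |accept ((coins lam).bind fun key => B.run lam fun x => F.fn lam key (Dom.query x)) -
      accept ((PMF.uniformOfFintype (FinFun (B.bound.eval lam))).bind fun g => B.run lam g)|

/- ======================= Sparse matrix decomposition ======================= -/

/-- The public parameters: `A` is `m × n` with `t` non-zero entries, `X` is `n × d`, and all
entries lie in `ℤ/2^L`. -/
structure Params where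
  m : ℕ
  n : ℕ
  d : ℕ
  t : ℕ
  L : ℕ

/-- The ring `ℤ/2^L`. -/
abbrev Params.R (p : Params) : Type := ZMod (2 ^ p.L)

def Params.enc (p : Params) : Data :=
  .list [.unary p.m, .unary p.n, .unary p.d, .unary p.t, .unary p.L]

/-- The matrix of a permutation: `permMat R s *ᵥ x` has `x j` in position `s j`. -/
def permMat (R : Type) [CommRing R] {k : ℕ} (s : Equiv.Perm (Fin k)) : Matrix (Fin k) (Fin k) R :=
  Matrix.of fun i j => if i = s j then 1 else 0

/-- The summation matrix. -/
def sumMat (R : Type) [CommRing R] (k : ℕ) : Matrix (Fin k) (Fin k) R :=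
  Matrix.of fun i j => if j ≤ i then 1 else 0

/-- The difference matrix. -/
def diffMat (R : Type) [CommRing R] (k : ℕ) : Matrix (Fin k) (Fin k) R :=
  Matrix.of fun i j => if i = j then 1 else if j.val + 1 = i.val then -1 else 0

/-- The rectangular matrix whose first `r` diagonal entries are `1`, all others being `0`. -/
def gammaMat (R : Type) [CommRing R] (k l r : ℕ) : Matrix (Fin k) (Fin l) R :=
  Matrix.of fun i j => if i.val = j.val ∧ i.val < r then 1 else 0

section Counting

variable {m n N : ℕ}

/-- The number of non-zero entries. -/
def nnz (A : Matrix (Fin m) (Fin n) (ZMod N)) : ℕ :=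
  (Finset.univ.filter fun e : Fin m × Fin n => A e.1 e.2 ≠ 0).card

/-- The number of non-zero rows. -/
def nzRows (A : Matrix (Fin m) (Fin n) (ZMod N)) : ℕ :=
  {i : Fin m | ∃ j, A i j ≠ 0}.ncard

/-- The number of non-zero columns. -/
def nzCols (A : Matrix (Fin m) (Fin n) (ZMod N)) : ℕ :=
  {j : Fin n | ∃ i, A i j ≠ 0}.ncard

end Counting

/-- The data of a decomposition of an `m × n` matrix with `t` non-zero entries. -/
structure Decomp (p : Params) where
  s1 : Equiv.Perm (Fin p.n)
  s2 : Equiv.Perm (Fin p.t)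
  s3 : Equiv.Perm (Fin p.t)
  s4 : Equiv.Perm (Fin p.t)
  s5 : Equiv.Perm (Fin p.m)
  weights : Fin p.t → p.R
  nrow : ℕ
  ncol : ℕ

namespace Decomp

variable {p : Params}

def enc (D : Decomp p) : Data :=
  .list [encPerm D.s1, encPerm D.s2, encPerm D.s3, encPerm D.s4, encPerm D.s5,
    encVec D.weights, .nat D.nrow, .nat D.ncol]

/-- `σ₅ δₘᵀ Γ_out σ₄ Σᵀ Λ σ₃ Σ σ₂ Γ_in δₙ σ₁`. -/
def product (D : Decomp p) : Matrix (Fin p.m) (Fin p.n) p.R :=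
  permMat p.R D.s5 * (diffMat p.R p.m)ᵀ * gammaMat p.R p.m p.t D.nrow * permMat p.R D.s4 * (sumMat p.R p.t)ᵀ *
    Matrix.diagonal D.weights * permMat p.R D.s3 * sumMat p.R p.t * permMat p.R D.s2 *
    gammaMat p.R p.t p.n D.ncol * diffMat p.R p.n * permMat p.R D.s1

/-- `D` is a decomposition of `A`. -/
structure IsFor (D : Decomp p) (A : Matrix (Fin p.m) (Fin p.n) p.R) : Prop where
  eq : A = D.product
  nrow : D.nrow = nzRows A
  ncol : D.ncol = nzCols A

end Decomp

/-- The private inputs of the owner of the sparse matrix: the `m × n` matrices with exactly `t`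
non-zero entries. -/
abbrev SparseMat (p : Params) : Type := {A : Matrix (Fin p.m) (Fin p.n) p.R // nnz A = p.t}

/-- A polynomial-time algorithm that decomposes every sparse matrix. -/
structure DecompAlg where
  dec : (p : Params) → SparseMat p → Decomp p
  isFor : ∀ p A, (dec p A).IsFor A.1
  prog : Prog
  poly : prog.PolyTime
  computes : ∀ p A, prog.run (.list [p.enc, encMat A.1]) = (dec p A).enc

/- ======================= The protocols ======================= -/

/-- The values of the pseudorandom function under a party's key. -/
abbrev Rand : Type := (q : Query) → q.Range

/-- The result of a protocol run: each party's share of the output, and the messages that each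
party receives from the dealer and from the other party. -/
structure Run (α : Type) where
  share₀ : α
  share₁ : α
  recv₀ : List Data
  recv₁ : List Data

/-- The action of a permutation on vectors: `x j` is moved to position `s j`. -/
def act {k : ℕ} {R : Type} (s : Equiv.Perm (Fin k)) (x : Fin k → R) : Fin k → R :=
  fun i => x (s⁻¹ i)

/-- Oblivious permutation of one vector. `P₀` holds `s` and `P₁` holds `x₁`. In type `plain`, `x₁`
is the whole vector and `x₀` is `none`; in type `shared`, `x₀` is the share of `P₀`.
`G₀` and `G₁` are the pseudorandom functions under the keys that the dealer shares
with `P₀` and `P₁`. -/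
def op (G₀ G₁ : Rand) (ctr : ℕ) {k L : ℕ} (s : Equiv.Perm (Fin k))
    (x₀ : Option (Fin k → ZMod (2 ^ L))) (x₁ : Fin k → ZMod (2 ^ L)) :
    Run (Fin k → ZMod (2 ^ L)) :=
  -- known to the dealer and to `P₀`
  let perm : Equiv.Perm (Fin k) := (G₀ ⟨ctr, k, 0, k, L⟩).1
  let pu₀ : Fin k → ZMod (2 ^ L) := (G₀ ⟨ctr, k, 0, k, L⟩).2.2
  -- known to the dealer and to `P₁`
  let u : Fin k → ZMod (2 ^ L) := (G₁ ⟨ctr, 0, 0, k, L⟩).2.2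
  -- sent by the dealer to `P₁`
  let pu₁ := act perm u - pu₀
  -- sent by `P₀` to `P₁`
  let ds := s * perm⁻¹
  -- sent by `P₁` to `P₀`
  let dx := x₁ - u
  { share₀ := act s dx + act ds pu₀ + x₀.elim 0 (act s)
    share₁ := act ds pu₁
    recv₀ := [encVec dx]
    recv₁ := [encVec pu₁, encPerm ds] }

/-- Multiplication of a ring element by a bit. -/
def bitMul {R : Type} [CommRing R] (s : ZMod 2) (x : R) : R := if s = 1 then x else 0

/-- Multiplication of a ring element by `(-1)^s` for a bit `s`. -/
def bitSign {R : Type} [CommRing R] (s : ZMod 2) (x : R) : R := if s = 1 then -x else x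

/-- Oblivious selection-multiplication of one shared number by the selector `s` of `P₀`. -/
def osm (G₀ G₁ : Rand) (ctr : ℕ) {L : ℕ} (s : ZMod 2) (x₀ x₁ : ZMod (2 ^ L)) :
    Run (ZMod (2 ^ L)) :=
  -- known to the dealer and to `P₀`
  let b : ZMod 2 := (G₀ ⟨ctr, 0, 1, 2, L⟩).2.1 0
  let u₀ : ZMod (2 ^ L) := (G₀ ⟨ctr, 0, 1, 2, L⟩).2.2 0
  let bu₀ : ZMod (2 ^ L) := (G₀ ⟨ctr, 0, 1, 2, L⟩).2.2 1
  -- known to the dealer and to `P₁`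
  let u₁ : ZMod (2 ^ L) := (G₁ ⟨ctr, 0, 0, 1, L⟩).2.2 0
  -- sent by the dealer to `P₁`
  let bu₁ := bitMul b (u₀ + u₁) - bu₀
  -- sent by `P₀` to `P₁`
  let ds := s - b
  -- sent by `P₁` to `P₀`
  let dx₁ := x₁ - u₁
  let dx := x₀ - u₀ + dx₁
  { share₀ := bitMul s dx + bitMul ds u₀ + bitSign ds bu₀
    share₁ := bitMul ds u₁ + bitSign ds bu₁
    recv₀ := [.nat dx₁.val]
    recv₁ := [.nat bu₁.val, .nat ds.val] }

/-- Beaver multiplication of two shared numbers, with a triple `(a, b, a * b)` whose last share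
the dealer sends to `P₁`. The parties open `x - a` and `y - b`. -/
def beaver (G₀ G₁ : Rand) (ctr : ℕ) {L : ℕ} (x₀ y₀ x₁ y₁ : ZMod (2 ^ L)) :
    Run (ZMod (2 ^ L)) :=
  -- known to the dealer and to `P₀`
  let a₀ : ZMod (2 ^ L) := (G₀ ⟨ctr, 0, 0, 3, L⟩).2.2 0
  let b₀ : ZMod (2 ^ L) := (G₀ ⟨ctr, 0, 0, 3, L⟩).2.2 1
  let c₀ : ZMod (2 ^ L) := (G₀ ⟨ctr, 0, 0, 3, L⟩).2.2 2
  -- known to the dealer and to `P₁`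
  let a₁ : ZMod (2 ^ L) := (G₁ ⟨ctr, 0, 0, 2, L⟩).2.2 0
  let b₁ : ZMod (2 ^ L) := (G₁ ⟨ctr, 0, 0, 2, L⟩).2.2 1
  -- sent by the dealer to `P₁`
  let c₁ := (a₀ + a₁) * (b₀ + b₁) - c₀
  -- sent by `P₀` to `P₁`
  let e₀ := x₀ - a₀
  let f₀ := y₀ - b₀
  -- sent by `P₁` to `P₀`
  let e₁ := x₁ - a₁
  let f₁ := y₁ - b₁
  let e := e₀ + e₁
  let f := f₀ + f₁
  { share₀ := e * b₀ + f * a₀ + c₀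
    share₁ := e * f + e * b₁ + f * a₁ + c₁
    recv₀ := [.nat e₁.val, .nat f₁.val]
    recv₁ := [.nat c₁.val, .nat e₀.val, .nat f₀.val] }

section MatrixLevel

variable {k d L : ℕ}

/-- Oblivious permutation of the rows of a matrix: parallel instances on the `d` columns. -/
def opMat (G₀ G₁ : Rand) (ctr : ℕ) (s : Equiv.Perm (Fin k))
    (Y₀ : Option (Matrix (Fin k) (Fin d) (ZMod (2 ^ L))))
    (Y₁ : Matrix (Fin k) (Fin d) (ZMod (2 ^ L))) :
    Run (Matrix (Fin k) (Fin d) (ZMod (2 ^ L))) :=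
  let r := fun j : Fin d =>
    op G₀ G₁ (ctr + j) s (Y₀.map fun Y i => Y i j) (fun i => Y₁ i j)
  { share₀ := Matrix.of fun i j => (r j).share₀ i
    share₁ := Matrix.of fun i j => (r j).share₁ i
    recv₀ := (List.ofFn fun j => (r j).recv₀).flatten
    recv₁ := (List.ofFn fun j => (r j).recv₁).flatten }

/-- Parallel instances of a protocol on the entries of a matrix. -/
def entrywise (r : Fin k → Fin d → Run (ZMod (2 ^ L))) :
    Run (Matrix (Fin k) (Fin d) (ZMod (2 ^ L))) :=
  { share₀ := Matrix.of fun i j => (r i j).share₀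
    share₁ := Matrix.of fun i j => (r i j).share₁
    recv₀ := (List.ofFn fun i => (List.ofFn fun j => (r i j).recv₀).flatten).flatten
    recv₁ := (List.ofFn fun i => (List.ofFn fun j => (r i j).recv₁).flatten).flatten }

/-- Oblivious selection-multiplication of row `i` of a shared matrix by the selector `s i`. -/
def osmMat (G₀ G₁ : Rand) (ctr : ℕ) (s : Fin k → ZMod 2)
    (Y₀ Y₁ : Matrix (Fin k) (Fin d) (ZMod (2 ^ L))) :
    Run (Matrix (Fin k) (Fin d) (ZMod (2 ^ L))) :=
  entrywise fun i j => osm G₀ G₁ (ctr + (i * d + j)) (s i) (Y₀ i j) (Y₁ i j)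

/-- Beaver multiplication of row `i` of a shared matrix by the number `w i`, which `P₀` holds and
which is shared as `w i + 0`. -/
def beaverMat (G₀ G₁ : Rand) (ctr : ℕ) (w : Fin k → ZMod (2 ^ L))
    (Y₀ Y₁ : Matrix (Fin k) (Fin d) (ZMod (2 ^ L))) :
    Run (Matrix (Fin k) (Fin d) (ZMod (2 ^ L))) :=
  entrywise fun i j => beaver G₀ G₁ (ctr + (i * d + j)) (w i) (Y₀ i j) 0 (Y₁ i j)

/-- Padding with zero rows, or cutting off rows, to obtain a matrix with `l` rows. -/
def resize (l : ℕ) (Y : Matrix (Fin k) (Fin d) (ZMod (2 ^ L))) :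
    Matrix (Fin l) (Fin d) (ZMod (2 ^ L)) :=
  Matrix.of fun i j => if h : i.val < k then Y ⟨i.val, h⟩ j else 0

/-- The selectors that keep the first `r` rows. -/
def selectors (k r : ℕ) : Fin k → ZMod 2 := fun i => if i.val < r then 1 else 0

end MatrixLevel

/-- The secure sparse matrix multiplication protocol, once `P₀` has decomposed `A`. -/
def smmRun (G₀ G₁ : Rand) {p : Params} (D : Decomp p) (X : Matrix (Fin p.n) (Fin p.d) p.R) :
    Run (Matrix (Fin p.m) (Fin p.d) p.R) :=
  let c1 := 0
  let r1 := opMat G₀ G₁ c1 D.s1 none X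
  let c2 := c1 + p.d
  let r2 := osmMat G₀ G₁ c2 (selectors p.n D.ncol)
    (diffMat p.R p.n * r1.share₀) (diffMat p.R p.n * r1.share₁)
  let c3 := c2 + p.n * p.d
  let r3 := opMat G₀ G₁ c3 D.s2 (some (resize p.t r2.share₀)) (resize p.t r2.share₁)
  let c4 := c3 + p.d
  let r4 := opMat G₀ G₁ c4 D.s3 (some (sumMat p.R p.t * r3.share₀)) (sumMat p.R p.t * r3.share₁)
  let c5 := c4 + p.d
  let r5 := beaverMat G₀ G₁ c5 D.weights r4.share₀ r4.share₁
  let c6 := c5 + p.t * p.d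
  let r6 := opMat G₀ G₁ c6 D.s4
    (some ((sumMat p.R p.t)ᵀ * r5.share₀)) ((sumMat p.R p.t)ᵀ * r5.share₁)
  let c7 := c6 + p.d
  let r7 := osmMat G₀ G₁ c7 (selectors p.m D.nrow)
    (resize p.m r6.share₀) (resize p.m r6.share₁)
  let c8 := c7 + p.m * p.d
  let r8 := opMat G₀ G₁ c8 D.s5
    (some ((diffMat p.R p.m)ᵀ * r7.share₀)) ((diffMat p.R p.m)ᵀ * r7.share₁)
  { share₀ := r8.share₀
    share₁ := r8.share₁
    recv₀ := r1.recv₀ ++ r2.recv₀ ++ r3.recv₀ ++ r4.recv₀ ++ r5.recv₀ ++ r6.recv₀ ++ r7.recv₀ ++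
      r8.recv₀
    recv₁ := r1.recv₁ ++ r2.recv₁ ++ r3.recv₁ ++ r4.recv₁ ++ r5.recv₁ ++ r6.recv₁ ++ r7.recv₁ ++
      r8.recv₁ }

/-- Sparse matrix multiplication: `P₀` holds `A`, `P₁` holds `X`; the dimensions of `A` and `X`,
the number of non-zero entries of `A` and the bit length are public. -/
def smmTask : Task where
  Param := Params
  In₀ := SparseMat
  In₁ p := Matrix (Fin p.n) (Fin p.d) p.R
  encParam := Params.enc
  enc₀ _ A := encMat A.1
  enc₁ _ X := encMat X

/-- The ideal functionality: uniformly random additive shares of `A * X`. -/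
def smmFunctionality : smmTask.Functionality :=
  fun (⟨p, A, X⟩ : Σ p : Params, SparseMat p × Matrix (Fin p.n) (Fin p.d) p.R) =>
  (PMF.uniformOfFintype (Fin p.m → Fin p.d → p.R)).map fun Y =>
    (encMat (Matrix.of Y), encMat (A.1 * X - Matrix.of Y))

/-- The protocol. The view of a party consists of the public parameters, its input, the key that
it shares with the dealer, and all messages that it receives. -/
def smmProtocol (F : KeyedFunction) (alg : DecompAlg) : smmTask.Protocol := fun lam
  (⟨p, A, X⟩ : Σ p : Params, SparseMat p × Matrix (Fin p.n) (Fin p.d) p.R) =>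
  (coins lam).bind fun key₀ => (coins lam).map fun key₁ =>
    let r := smmRun (F.fn lam key₀) (F.fn lam key₁) (alg.dec p A) X
    { view₀ := .list [p.enc, encMat A.1, .bits key₀, .list r.recv₀]
      view₁ := .list [p.enc, encMat X, .bits key₁, .list r.recv₁]
      out₀ := encMat r.share₀
      out₁ := encMat r.share₁ }

end

end SMM

/-!
Both halves of the theorem are proved by explicit constructions of programs. To keep these readable,
`Algo` bundles a program with a polynomial bound on its running time, relative to an oracle with
bounded answers; it comes with loops whose state grows slowly (`Algo.iter`, `Algo.tab`, `Algo.sum`,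
`Algo.flat`), and each algorithm has a lemma `ev_…` that says what it computes.

*Decomposition.* List the non-zero entries of `A` row by row. With the selection matrices of their
rows and of their columns, `A` is the transpose of the first, times the diagonal matrix of the
values, times the second (`eq_selMat_mul`). A selection matrix factors through a summation matrix
and a difference matrix (`selMat_eq`): if the occurring labels are put first and the positions are
sorted by label, then the selected coordinate is a telescoping sum of differences of consecutive
occurring coordinates, each of which enters at the first position of its label. All permutations in
this factorization sort by explicit keys, hence are ranks that can be counted in polynomial time.

*Security.* All that a party learns about the other party is contained in a family of values `w`,
one for each query that the other party makes to the pseudorandom function. For `P₀` these are the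
shared values minus the masks of `P₁` (`masked₀`), for `P₁` they are the openings and the
corrections by the dealer (`received₁`); in the last step the output share of the party takes the
place of the value that it determines. The view and both outputs are functions of `w` and of the own
key (`share₀_eq`, `recv₀_eq`, `share₁_eq`, `recv₁_eq`), and for fixed inputs and own key, `w` is a
bijective function of the answers to the queries of the other party (`masked₀_bijective`,
`received₁_bijective`). The simulator computes the view from the pseudorandom answers under a fresh
key, in which the last step is overwritten by the given output share.

If the answers are replaced by uniformly random ones, both experiments become the same one, with
uniformly random `w`. Each replacement changes the acceptance probability of a distinguisher by a
negligible amount (`QueryFamily.negligible_advantage`): all queries have distinct counters, so that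
a random function answers them by independent uniform values, and the public parameters, the inputs,
the own key and the random tape of the distinguisher can be fixed to a nearly worst choice, which is
the advice of a single adversary against the pseudorandom function.
-/

namespace SMM

noncomputable section

/-! ### Polynomial bounds -/

theorem natPoly_eval_mono (P : Polynomial ℕ) {a b : ℕ} (h : a ≤ b) : P.eval a ≤ P.eval b := by
  rw [Polynomial.eval_eq_sum_range, Polynomial.eval_eq_sum_range]
  exact Finset.sum_le_sum fun i _ => Nat.mul_le_mul_left _ (Nat.pow_le_pow_left h i)

theorem natSize_add_le (a b : ℕ) : Nat.size (a + b) ≤ Nat.size a + Nat.size b := by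
  rw [Nat.size_le, pow_add]
  have ha := Nat.lt_size_self a
  have hb := Nat.lt_size_self b
  nlinarith

theorem natSize_mul_le (a b : ℕ) : Nat.size (a * b) ≤ Nat.size a + Nat.size b := by
  rw [Nat.size_le, pow_add]
  exact Nat.mul_lt_mul'' (Nat.lt_size_self a) (Nat.lt_size_self b)

theorem natSize_le_self (a : ℕ) : Nat.size a ≤ a := Nat.size_le.2 a.lt_two_pow_self

namespace Data

theorem fst_size_le (x : Data) : x.fst.size ≤ x.size := by
  cases x <;> simp [size, fst]; omega

theorem snd_size_le (x : Data) : x.snd.size ≤ x.size := by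
  cases x <;> simp [size, snd]; omega

theorem length_le_size (x : Data) : x.length ≤ x.size := by
  induction x with
  | nat n => simp [length]
  | pair a b _ ih => simp only [length, size]; omega

theorem toNat_size_le (x : Data) : Nat.size x.toNat + 1 ≤ x.size := by
  cases x <;> simp [toNat, size]

theorem length_snd (x : Data) : x.snd.length = x.length - 1 := by
  cases x <;> simp [length, snd]

/-- The `i`-th element of a datum, read as a list; it is `0` beyond the end of the list. -/
def nth (x : Data) (i : ℕ) : Data := (snd^[i] x).fst

/-- The list of the values `f 0, …, f (n - 1)`. -/
def tab (n : ℕ) (f : ℕ → Data) : Data := list ((List.range n).map f)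

/-- Concatenation of data, read as lists. -/
def app : Data → Data → Data
  | nat _, b => b
  | pair u v, b => pair u (app v b)

/-- The concatenation of the lists `f 0, …, f (n - 1)`. -/
def flat (n : ℕ) (f : ℕ → Data) : Data := (List.range n).foldr (fun i acc => app (f i) acc) (nat 0)

@[simp] theorem toNat_nat (n : ℕ) : (nat n).toNat = n := rfl
@[simp] theorem fst_pair (a b : Data) : (pair a b).fst = a := rfl
@[simp] theorem snd_pair (a b : Data) : (pair a b).snd = b := rfl
@[simp] theorem nth_list_zero (a : Data) (l : List Data) : (list (a :: l)).nth 0 = a := rfl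
@[simp] theorem nth_list_succ (a : Data) (l : List Data) (i : ℕ) :
    (list (a :: l)).nth (i + 1) = (list l).nth i := rfl

theorem snd_iterate_nat_zero (i : ℕ) : snd^[i] (nat 0) = nat 0 := by
  induction i with
  | zero => rfl
  | succ i ih => rw [Function.iterate_succ_apply]; exact ih

theorem nth_list (l : List Data) (i : ℕ) : (list l).nth i = l.getD i (nat 0) := by
  induction l generalizing i with
  | nil => simp [list, nth, snd_iterate_nat_zero, fst]
  | cons a l ih => cases i <;> simp [ih]

theorem nth_of_length_le (x : Data) (i : ℕ) (h : x.length ≤ i) : x.nth i = nat 0 := by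
  induction x generalizing i with
  | nat n =>
    cases i with
    | zero => rfl
    | succ i =>
      rw [nth, Function.iterate_succ_apply]
      simp [snd, snd_iterate_nat_zero, fst]
  | pair a b _ ih =>
    cases i with
    | zero => simp [length] at h
    | succ i => exact ih i (by simpa [length] using h)

@[simp] theorem length_list (l : List Data) : (list l).length = l.length := by
  induction l with
  | nil => rfl
  | cons a l ih => simp [list, length, ih]

@[simp] theorem length_unary (n : ℕ) : (unary n).length = n := by simp [unary]

theorem list_ofFn_eq_tab {n : ℕ} {f : Fin n → Data} {g : ℕ → Data} (h : ∀ i : Fin n, g i = f i) :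
    list (List.ofFn f) = tab n g := by
  unfold tab
  congr 1
  apply List.ext_getElem <;> simp
  intro i hi
  exact (h ⟨i, hi⟩).symm

theorem nth_list_ofFn {n : ℕ} (f : Fin n → Data) (i : Fin n) :
    (list (List.ofFn f)).nth i = f i := by
  simp [nth_list]

theorem app_list (l l' : List Data) : app (list l) (list l') = list (l ++ l') := by
  induction l with
  | nil => rfl
  | cons a l ih => simp [list, app, ih]

theorem app_size_le (a b : Data) : (app a b).size ≤ a.size + b.size := by
  induction a with
  | nat n => simp [app]
  | pair u v _ ih => simp only [app, size]; omega

theorem flat_eq_list {n : ℕ} {f : ℕ → Data} {g : Fin n → List Data}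
    (h : ∀ i : Fin n, f i = list (g i)) : flat n f = list (List.ofFn g).flatten := by
  unfold flat
  induction n generalizing f with
  | zero => rfl
  | succ n ih =>
    rw [List.range_succ_eq_map, List.foldr_cons, List.foldr_map, List.ofFn_succ,
      List.flatten_cons, ← app_list, ← ih (f := fun i => f (i + 1)) (fun i => h i.succ)]
    rw [show f 0 = list (g 0) from h 0]

theorem foldr_range_eq_app (x b : Data) :
    (List.range x.length).foldr (fun i acc => pair (x.nth i) acc) b = app x b := by
  induction x with
  | nat n => rfl
  | pair u v _ ih =>
    rw [length, List.range_succ_eq_map, List.foldr_cons, List.foldr_map, app, ← ih]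
    rfl

end Data

/-! ### Algorithms with a polynomial bound on their running time -/

namespace Prog

theorem size_eval_le_cost (O : Data → Data) (p : Prog) (x : Data) :
    (p.eval O x).size ≤ p.cost O x := by
  induction p generalizing x with
  | pair p q ihp ihq =>
    simp only [eval, cost, Data.size]
    have := ihp x; have := ihq x; omega
  | seq p q ihp ihq =>
    simp only [eval, cost]
    have := ihq (p.eval O x); omega
  | ite c p q _ ihp ihq =>
    simp only [eval, cost]
    have := ihp x; have := ihq x
    split <;> omega
  | loop c b _ ihb =>
    simp only [eval, cost]
    rcases Nat.eq_zero_or_pos (c.eval O x).toNat with h | h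
    · rw [h]; simp; omega
    · obtain ⟨k, hk⟩ := Nat.exists_eq_succ_of_ne_zero h.ne'
      rw [hk, Finset.sum_range_succ, Function.iterate_succ_apply']
      have := ihb ((b.eval O)^[k] x)
      omega
  | _ => simp only [cost]; omega

/-- A program with its oracle calls replaced by the answers of the trivial oracle. -/
def strip : Prog → Prog
  | .query => .const 0
  | .pair p q => .pair p.strip q.strip
  | .seq p q => .seq p.strip q.strip
  | .ite c p q => .ite c.strip p.strip q.strip
  | .loop c b => .loop c.strip b.strip
  | p => p

theorem eval_strip (O : Data → Data) (p : Prog) : p.strip.eval O = p.run := by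
  funext x
  unfold run
  induction p generalizing x with
  | pair p q ihp ihq => simp only [strip, eval, ihp, ihq]
  | seq p q ihp ihq => simp only [strip, eval, ihp, ihq]
  | ite c p q ihc ihp ihq => simp only [strip, eval, ihc, ihp, ihq]
  | loop c b ihc ihb => simp only [strip, eval, ihc, funext ihb]
  | _ => rfl

theorem cost_strip (O : Data → Data) (p : Prog) (x : Data) :
    p.strip.cost O x = p.cost noOracle x := by
  have he := fun p : Prog => eval_strip O p
  unfold run at he
  induction p generalizing x with
  | pair p q ihp ihq => simp only [strip, cost, ihp, ihq]
  | seq p q ihp ihq => simp only [strip, cost, ihp, ihq, he]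
  | ite c p q ihc ihp ihq => simp only [strip, cost, ihc, ihp, ihq, he]
  | loop c b ihc ihb => simp only [strip, cost, ihc, ihb, he]
  | _ => rfl

end Prog

/-- The answers of the oracle `O` have size at most `B`. -/
def OracleBound (O : Data → Data) (B : ℕ) : Prop := ∀ z, (O z).size ≤ B

/-- A program whose running time is bounded by a polynomial in the size of its input and the size of
the answers of its oracle. -/
structure Algo where
  prog : Prog
  bound : ∃ P : Polynomial ℕ, ∀ O B, OracleBound O B → ∀ x, prog.cost O x ≤ P.eval (x.size + B)

namespace Algo

/-- The value computed by an algorithm. -/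
def ev (a : Algo) (O : Data → Data) (x : Data) : Data := a.prog.eval O x

theorem polyTime (a : Algo) : a.prog.PolyTime := by
  obtain ⟨P, hP⟩ := a.bound
  refine ⟨P.comp (Polynomial.X + 1), fun x => ?_⟩
  simpa using hP Prog.noOracle 1 (fun _ => by simp [Prog.noOracle, Data.size]) x

theorem exists_size_bound (a : Algo) : ∃ P : Polynomial ℕ, ∀ O B, OracleBound O B →
    ∀ x, (a.ev O x).size ≤ P.eval (x.size + B) := by
  obtain ⟨P, hP⟩ := a.bound
  exact ⟨P, fun O B h x => (Prog.size_eval_le_cost O a.prog x).trans (hP O B h x)⟩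

/-- A polynomial-time program. Its oracle calls are removed, because nothing is known about its
running time with other oracles than the trivial one. -/
def ofProg (p : Prog) (h : p.PolyTime) : Algo where
  prog := p.strip
  bound := by
    obtain ⟨P, hP⟩ := h
    refine ⟨P, fun O B _ x => ?_⟩
    rw [Prog.cost_strip]
    exact (hP x).trans (natPoly_eval_mono P (by omega))

/-- Returns the input. -/
def id : Algo where
  prog := .id
  bound := ⟨2 * Polynomial.X + 1, fun O B _ x => by
    simp only [Prog.cost, Prog.eval, Polynomial.eval_add, Polynomial.eval_mul,
      Polynomial.eval_ofNat, Polynomial.eval_X, Polynomial.eval_one]; omega⟩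

/-- Returns a number that does not depend on the input. -/
def const (c : ℕ) : Algo where
  prog := .const c
  bound := ⟨Polynomial.X + Polynomial.C ((Data.nat c).size + 1), fun O B _ x => by
    simp only [Prog.cost, Prog.eval, Polynomial.eval_add, Polynomial.eval_X,
      Polynomial.eval_C]; omega⟩

def fst : Algo where
  prog := .fst
  bound := ⟨2 * Polynomial.X + 1, fun O B _ x => by
    have := x.fst_size_le
    simp only [Prog.cost, Prog.eval, Polynomial.eval_add, Polynomial.eval_mul,
      Polynomial.eval_ofNat, Polynomial.eval_X, Polynomial.eval_one]; omega⟩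

def snd : Algo where
  prog := .snd
  bound := ⟨2 * Polynomial.X + 1, fun O B _ x => by
    have := x.snd_size_le
    simp only [Prog.cost, Prog.eval, Polynomial.eval_add, Polynomial.eval_mul,
      Polynomial.eval_ofNat, Polynomial.eval_X, Polynomial.eval_one]; omega⟩

/-- The length of the input, read as a list. -/
def len : Algo where
  prog := .length
  bound := ⟨2 * Polynomial.X + 2, fun O B _ x => by
    have := x.length_le_size
    have := natSize_le_self x.length
    simp only [Prog.cost, Prog.eval, Data.size, Polynomial.eval_add, Polynomial.eval_mul,
      Polynomial.eval_ofNat, Polynomial.eval_X]; omega⟩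

theorem size_op_le (o : Op) (a b : ℕ) :
    Nat.size (o.apply a b) ≤ Nat.size a + Nat.size b + 1 := by
  cases o with
  | add => exact (natSize_add_le a b).trans (by omega)
  | sub => exact (Nat.size_le_size (Nat.sub_le a b)).trans (by omega)
  | mul => exact (natSize_mul_le a b).trans (by omega)
  | div => exact (Nat.size_le_size (Nat.div_le_self a b)).trans (by omega)
  | mod => exact (Nat.size_le_size (Nat.mod_le a b)).trans (by omega)
  | lt =>
    simp only [Op.apply]
    split <;> simp

/-- Applies an arithmetic instruction to the two components of the input. -/
def op (o : Op) : Algo where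
  prog := .op o
  bound := ⟨2 * Polynomial.X + 4, fun O B _ x => by
    have h : x.fst.size + x.snd.size ≤ x.size + 1 := by
      cases x with
      | nat n => simp [Data.fst, Data.snd, Data.size]
      | pair a b => simp only [Data.fst, Data.snd, Data.size]; omega
    have := size_op_le o x.fst.toNat x.snd.toNat
    have := x.fst.toNat_size_le
    have := x.snd.toNat_size_le
    simp only [Prog.cost, Prog.eval, Data.size, Polynomial.eval_add, Polynomial.eval_mul,
      Polynomial.eval_ofNat, Polynomial.eval_X]; omega⟩

/-- A call of the oracle. -/
def query : Algo where
  prog := .query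
  bound := ⟨2 * Polynomial.X + 1, fun O B h x => by
    have := h x
    simp only [Prog.cost, Prog.eval, Polynomial.eval_add, Polynomial.eval_mul,
      Polynomial.eval_ofNat, Polynomial.eval_X, Polynomial.eval_one]; omega⟩

def pair (a b : Algo) : Algo where
  prog := .pair a.prog b.prog
  bound := by
    obtain ⟨P, hP⟩ := a.bound
    obtain ⟨Q, hQ⟩ := b.bound
    refine ⟨P + Q + 1, fun O B h x => ?_⟩
    have := hP O B h x
    have := hQ O B h x
    simp only [Prog.cost, Polynomial.eval_add, Polynomial.eval_one]; omega

/-- `a.andThen b` runs `a` and then `b`. -/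
def andThen (a b : Algo) : Algo where
  prog := .seq a.prog b.prog
  bound := by
    obtain ⟨P, hP⟩ := a.bound
    obtain ⟨Q, hQ⟩ := b.bound
    refine ⟨P + Q.comp (P + Polynomial.X) + 1, fun O B h x => ?_⟩
    have h1 := hP O B h x
    have h2 := hQ O B h (a.prog.eval O x)
    have h3 := Prog.size_eval_le_cost O a.prog x
    have h4 := natPoly_eval_mono Q
      (show (a.prog.eval O x).size + B ≤ P.eval (x.size + B) + (x.size + B) by omega)
    simp only [Prog.cost, Polynomial.eval_add, Polynomial.eval_one, Polynomial.eval_comp,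
      Polynomial.eval_X]; omega

/-- Runs `b` if `c` returns the number `0`, and `a` otherwise. -/
def ite (c a b : Algo) : Algo where
  prog := .ite c.prog a.prog b.prog
  bound := by
    obtain ⟨R, hR⟩ := c.bound
    obtain ⟨P, hP⟩ := a.bound
    obtain ⟨Q, hQ⟩ := b.bound
    refine ⟨R + P + Q + 1, fun O B h x => ?_⟩
    have := hR O B h x
    have := hP O B h x
    have := hQ O B h x
    simp only [Prog.cost, Polynomial.eval_add, Polynomial.eval_one]
    split <;> omega

/-- A loop that starts from the state computed by `a` runs in polynomial time if its number of
rounds and all its states are polynomially bounded. -/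
theorem exists_bound_loop (a c b : Algo) (N M : Polynomial ℕ)
    (hN : ∀ O B, OracleBound O B → ∀ x, (c.ev O (a.ev O x)).toNat ≤ N.eval (x.size + B))
    (hM : ∀ O B, OracleBound O B → ∀ x, ∀ i ≤ (c.ev O (a.ev O x)).toNat,
      ((b.ev O)^[i] (a.ev O x)).size ≤ M.eval (x.size + B)) :
    ∃ P : Polynomial ℕ, ∀ O B, OracleBound O B →
      ∀ x, (Prog.seq a.prog (.loop c.prog b.prog)).cost O x ≤ P.eval (x.size + B) := by
  obtain ⟨T, hT⟩ := a.bound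
  obtain ⟨R, hR⟩ := c.bound
  obtain ⟨P, hP⟩ := b.bound
  refine ⟨T + R.comp (M + Polynomial.X) + M + 2 + N * (P.comp (M + Polynomial.X) + 1),
    fun O B h x => ?_⟩
  simp only [Prog.cost, Polynomial.eval_add, Polynomial.eval_one, Polynomial.eval_mul,
    Polynomial.eval_X, Polynomial.eval_comp, Polynomial.eval_ofNat]
  set y := a.prog.eval O x with hy
  have h0 := hT O B h x
  have hM' : ∀ i ≤ (c.prog.eval O y).toNat,
      ((b.prog.eval O)^[i] y).size ≤ M.eval (x.size + B) := hM O B h x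
  have hN' : (c.prog.eval O y).toNat ≤ N.eval (x.size + B) := hN O B h x
  have hy' : y.size ≤ M.eval (x.size + B) := hM' 0 (Nat.zero_le _)
  have h1 := hR O B h y
  have h1' := natPoly_eval_mono R
    (show y.size + B ≤ M.eval (x.size + B) + (x.size + B) by omega)
  have h2 : ∑ i ∈ Finset.range (c.prog.eval O y).toNat,
      (b.prog.cost O ((b.prog.eval O)^[i] y) + 1) ≤
      (c.prog.eval O y).toNat * (P.eval (M.eval (x.size + B) + (x.size + B)) + 1) := by
    have := Finset.sum_le_card_nsmul (Finset.range (c.prog.eval O y).toNat)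
      (fun i => b.prog.cost O ((b.prog.eval O)^[i] y) + 1)
      (P.eval (M.eval (x.size + B) + (x.size + B)) + 1) fun i hi => by
        have h3 := hP O B h ((b.prog.eval O)^[i] y)
        have h4 := hM' i (Finset.mem_range.1 hi).le
        have h5 := natPoly_eval_mono P
          (show ((b.prog.eval O)^[i] y).size + B ≤ M.eval (x.size + B) + (x.size + B) by omega)
        omega
    simpa using this
  have h6 := Nat.mul_le_mul_right (P.eval (M.eval (x.size + B) + (x.size + B)) + 1) hN'
  omega

@[simp] theorem ev_id (O x) : id.ev O x = x := rfl
@[simp] theorem ev_fst (O x) : fst.ev O x = x.fst := rfl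
@[simp] theorem ev_snd (O x) : snd.ev O x = x.snd := rfl
@[simp] theorem ev_len (O x) : len.ev O x = .nat x.length := rfl
@[simp] theorem ev_query (O x) : query.ev O x = O x := rfl
@[simp] theorem ev_pair (a b : Algo) (O x) : (a.pair b).ev O x = .pair (a.ev O x) (b.ev O x) := rfl
@[simp] theorem ev_andThen (a b : Algo) (O x) : (a.andThen b).ev O x = b.ev O (a.ev O x) := rfl
@[simp] theorem ev_ofProg (p : Prog) (h : p.PolyTime) (O x) : (ofProg p h).ev O x = p.run x :=
  congrFun (Prog.eval_strip O p) x

theorem ev_ite (c a b : Algo) (O x) (h : c.ev O x = .nat n) :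
    (ite c a b).ev O x = if n = 0 then b.ev O x else a.ev O x := by
  have h' : c.prog.eval O x = .nat n := h
  simp only [ev, ite, Prog.eval, h']
  cases n <;> rfl

/-- The combination of two numbers by an arithmetic instruction. -/
def bin (o : Op) (a b : Algo) : Algo := (a.pair b).andThen (op o)

instance : Add Algo := ⟨bin .add⟩
instance : Mul Algo := ⟨bin .mul⟩
instance : Sub Algo := ⟨bin .sub⟩
instance : Mod Algo := ⟨bin .mod⟩
instance (n : ℕ) : OfNat Algo n := ⟨const n⟩

/-- The indicator of `a < b`. -/
def lt (a b : Algo) : Algo := bin .lt a b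

/-- The indicator of `a = b`. -/
def eq (a b : Algo) : Algo := 1 - (lt a b + lt b a)

@[simp] theorem ev_add (a b : Algo) (O x) :
    (a + b).ev O x = .nat ((a.ev O x).toNat + (b.ev O x).toNat) := rfl
@[simp] theorem ev_mul (a b : Algo) (O x) :
    (a * b).ev O x = .nat ((a.ev O x).toNat * (b.ev O x).toNat) := rfl
@[simp] theorem ev_sub (a b : Algo) (O x) :
    (a - b).ev O x = .nat ((a.ev O x).toNat - (b.ev O x).toNat) := rfl
@[simp] theorem ev_mod (a b : Algo) (O x) :
    (a % b).ev O x = .nat ((a.ev O x).toNat % (b.ev O x).toNat) := rfl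
@[simp] theorem ev_ofNat (n : ℕ) (O x) : (no_index (OfNat.ofNat n) : Algo).ev O x = .nat n := rfl
@[simp] theorem ev_lt (a b : Algo) (O x) :
    (lt a b).ev O x = .nat (if (a.ev O x).toNat < (b.ev O x).toNat then 1 else 0) := rfl
@[simp] theorem ev_eq (a b : Algo) (O x) :
    (eq a b).ev O x = .nat (if (a.ev O x).toNat = (b.ev O x).toNat then 1 else 0) := by
  simp only [eq, ev_sub, ev_add, ev_lt, ev_ofNat, Data.toNat_nat]
  congr 1
  rcases lt_trichotomy (a.ev O x).toNat (b.ev O x).toNat with h | h | h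
  · simp [h, h.ne, h.not_gt]
  · simp [h]
  · simp [h, h.ne', h.not_gt]

/-- A list of fixed length. -/
def lst : List Algo → Algo
  | [] => const 0
  | a :: l => a.pair (lst l)

@[simp] theorem ev_lst (l : List Algo) (O x) :
    (lst l).ev O x = .list (l.map fun a => a.ev O x) := by
  induction l with
  | nil => rfl
  | cons a l ih => simp only [lst, ev_pair, ih]; rfl

/-- The input without its first `n` elements. The input of an algorithm is read as the list of the
values of its variables, and the bodies of loops find their index in front of it. -/
def up : ℕ → Algo
  | 0 => id
  | n + 1 => snd.andThen (up n)

/-- The element with the index `n` of the input. -/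
def var (n : ℕ) : Algo := (up n).andThen fst

/-- The element with the fixed index `i` of a list. -/
def elt (a : Algo) (i : ℕ) : Algo := a.andThen (var i)

@[simp] theorem ev_up_zero (O x) : (up 0).ev O x = x := rfl
@[simp] theorem ev_up_succ (n O x) : (up (n + 1)).ev O x = (up n).ev O x.snd := rfl
theorem ev_up (n O x) : (up n).ev O x = Data.snd^[n] x := by
  induction n generalizing x with
  | zero => rfl
  | succ n ih => rw [ev_up_succ, ih, Function.iterate_succ_apply]
@[simp] theorem ev_var (n O x) : (var n).ev O x = x.nth n := by
  rw [var, ev_andThen, ev_up]; rfl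
@[simp] theorem ev_elt (a : Algo) (i O x) : (a.elt i).ev O x = (a.ev O x).nth i := by
  rw [Algo.elt, ev_andThen, ev_var]
@[simp] theorem nth_pair_zero (a b : Data) : (Data.pair a b).nth 0 = a := rfl
@[simp] theorem nth_pair_succ (a b : Data) (i : ℕ) : (Data.pair a b).nth (i + 1) = b.nth i := rfl

end Algo

end

end SMM
namespace SMM

noncomputable section

namespace Algo

/-! ### Bounded iteration -/

/-- One round of a bounded iteration. The state consists of the list of the remaining rounds, the
environment, and the accumulator; `step` is given the number of rounds that remain afterwards, the
environment and the accumulator. -/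
def iterBody (step : Algo) : Algo :=
  (fst.andThen snd).pair ((var 1).pair ((((fst.andThen snd).andThen len).pair snd).andThen step))

theorem iterBody_iterate (step : Algo) (O : Data → Data) (r x a : Data) (i : ℕ)
    (hi : i ≤ r.length) :
    ((iterBody step).ev O)^[i] (.pair r (.pair x a)) =
      .pair (Data.snd^[i] r) (.pair x
        ((List.range' (r.length - i) i).foldr (fun j acc => step.ev O (.pair (.nat j) (.pair x
            acc)))
          a)) := by
  induction i with
  | zero => simp
  | succ i ih =>
    rw [Function.iterate_succ_apply', ih (by omega)]
    have hlen : ∀ i, (Data.snd^[i] r).length = r.length - i := fun i => by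
      induction i with
      | zero => rfl
      | succ i ih => rw [Function.iterate_succ_apply', Data.length_snd, ih]; omega
    have h1 : List.range' (r.length - (i + 1)) (i + 1) =
        (r.length - (i + 1)) :: List.range' (r.length - i) i := by
      rw [List.range'_succ]
      congr 2
      omega
    rw [h1, List.foldr_cons]
    simp only [iterBody, ev_pair, ev_andThen, ev_fst, ev_snd, ev_len, Data.fst_pair, Data.snd_pair,
      ← Function.iterate_succ_apply' Data.snd, hlen, ev_var, nth_pair_succ, nth_pair_zero]

/-- The size of the accumulator grows in each round by at most a polynomial in the sizes of the
round number, of the environment and of the oracle answers. -/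
def Grows (step : Algo) : Prop :=
  ∃ Q : Polynomial ℕ, ∀ O B, OracleBound O B → ∀ i x acc,
    (step.ev O (.pair (.nat i) (.pair x acc))).size ≤ acc.size + Q.eval (i + x.size + B)

theorem size_snd_iterate_le (r : Data) (i : ℕ) : (Data.snd^[i] r).size ≤ r.size := by
  induction i with
  | zero => exact le_rfl
  | succ i ih => rw [Function.iterate_succ_apply']; exact (Data.snd_size_le _).trans ih

/-- `iter k a₀ step` iterates `step`, downwards from round `n - 1` to round `0`, on an accumulator
that starts as `a₀`, where `n` is the length of the list `k`. -/
def iter (k a₀ step : Algo) (h : step.Grows) : Algo where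
  prog := .seq (.seq (k.pair (id.pair a₀)).prog (.loop (fst.andThen len).prog (iterBody step).prog))
    (snd.andThen snd).prog
  bound := by
    obtain ⟨Q, hQ⟩ := h
    obtain ⟨K, hK⟩ := k.exists_size_bound
    obtain ⟨A, hA⟩ := a₀.exists_size_bound
    have key := exists_bound_loop (k.pair (id.pair a₀)) (fst.andThen len) (iterBody step) K
      (K + Polynomial.X + A + K * Q.comp (K + Polynomial.X) + 2) ?_ ?_
    · exact (Algo.andThen ⟨_, key⟩ (snd.andThen snd)).bound
    · intro O B hO x
      simp only [ev_andThen, ev_len, ev_fst, Data.toNat_nat, ev_pair, Data.fst_pair]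
      exact (Data.length_le_size _).trans (hK O B hO x)
    · intro O B hO x i hi
      simp only [ev_andThen, ev_len, ev_fst, Data.toNat_nat, ev_pair, Data.fst_pair, ev_id] at hi ⊢
      rw [iterBody_iterate _ _ _ _ _ _ hi]
      have hk := hK O B hO x
      have ha := hA O B hO x
      set r := k.ev O x
      have hl : r.length ≤ K.eval (x.size + B) := r.length_le_size.trans hk
      have hfold : ∀ l : List ℕ, (∀ j ∈ l, j ≤ r.length) →
          (l.foldr (fun j acc => step.ev O (.pair (.nat j) (.pair x acc))) (a₀.ev O x)).size ≤
            (a₀.ev O x).size + l.length * Q.eval (K.eval (x.size + B) + (x.size + B)) := by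
        intro l hl'
        induction l with
        | nil => simp
        | cons j l ih =>
          have h1 := ih fun j hj => hl' j (List.mem_cons_of_mem _ hj)
          have h2 := hQ O B hO j x
            (l.foldr (fun j acc => step.ev O (.pair (.nat j) (.pair x acc))) (a₀.ev O x))
          have h3 := hl' j List.mem_cons_self
          have h4 := natPoly_eval_mono Q
            (show j + x.size + B ≤ K.eval (x.size + B) + (x.size + B) by omega)
          rw [List.foldr_cons, List.length_cons, Nat.add_mul]
          omega
      have h5 := hfold (List.range' (r.length - i) i) fun j hj => by
        rw [List.mem_range'_1] at hj; omega
      rw [List.length_range'] at h5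
      have h6 := size_snd_iterate_le r i
      have h7 := Nat.mul_le_mul_right (Q.eval (K.eval (x.size + B) + (x.size + B))) (hi.trans hl)
      simp only [Data.size, Polynomial.eval_add, Polynomial.eval_mul, Polynomial.eval_comp,
        Polynomial.eval_X, Polynomial.eval_ofNat]
      omega

theorem ev_iter (k a₀ step : Algo) (h : step.Grows) (O x) :
    (iter k a₀ step h).ev O x =
      (List.range (k.ev O x).length).foldr
        (fun j acc => step.ev O (.pair (.nat j) (.pair x acc))) (a₀.ev O x) := by
  have h1 : (iter k a₀ step h).ev O x =
      (((iterBody step).ev O)^[(k.ev O x).length] (.pair (k.ev O x) (.pair x (a₀.ev O x)))).snd.snd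
          :=
    rfl
  rw [h1, iterBody_iterate _ _ _ _ _ _ le_rfl, Nat.sub_self, ← List.range_eq_range']
  rfl

theorem exists_size_bound_body (f : Algo) : ∃ Q : Polynomial ℕ, ∀ O B, OracleBound O B →
    ∀ i x, (f.ev O (.pair (.nat i) x)).size ≤ Q.eval (i + x.size + B) := by
  obtain ⟨Q, hQ⟩ := f.exists_size_bound
  refine ⟨Q.comp (Polynomial.X + 2), fun O B hO i x => ?_⟩
  have h1 := hQ O B hO (.pair (.nat i) x)
  refine h1.trans ?_
  rw [Polynomial.eval_comp]
  apply natPoly_eval_mono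
  have := natSize_le_self i
  simp only [Data.size, Polynomial.eval_add, Polynomial.eval_X, Polynomial.eval_ofNat]
  omega

/-- The body `f` of a loop, whose input is the index and the environment, in the input format of the
rounds of an iteration. -/
def onIndex (f : Algo) : Algo := ((var 0).pair (var 1)).andThen f

theorem ev_onIndex (f : Algo) (O) (i x acc : Data) :
    (onIndex f).ev O (.pair i (.pair x acc)) = f.ev O (.pair i x) := by
  simp [onIndex]

/-- The list `f 0, …, f (n - 1)`, where `n` is the length of the list `k`. The input of `f` is the
index and the input of `tab k f`. -/
def tab (k f : Algo) : Algo :=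
  iter k 0 ((onIndex f).pair (snd.andThen snd)) <| by
    obtain ⟨Q, hQ⟩ := f.exists_size_bound_body
    refine ⟨Q + 1, fun O B hO i x acc => ?_⟩
    have := hQ O B hO i x
    simp only [ev_pair, ev_onIndex, ev_andThen, ev_snd, Data.snd_pair, Data.size,
      Polynomial.eval_add, Polynomial.eval_one]
    omega

@[simp] theorem ev_tab (k f : Algo) (O x) :
    (tab k f).ev O x = .tab (k.ev O x).length fun i => f.ev O (.pair (.nat i) x) := by
  rw [tab, ev_iter]
  generalize (k.ev O x).length = n
  simp only [ev_pair, ev_onIndex, ev_andThen, ev_snd, Data.snd_pair, ev_ofNat]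
  unfold Data.tab
  induction List.range n with
  | nil => rfl
  | cons a l ih => rw [List.foldr_cons, ih]; rfl

/-- The sum of the numbers `f 0, …, f (n - 1)`, where `n` is the length of the list `k`. -/
def sum (k f : Algo) : Algo :=
  iter k 0 (onIndex f + (snd.andThen snd)) <| by
    obtain ⟨Q, hQ⟩ := f.exists_size_bound_body
    refine ⟨Q, fun O B hO i x acc => ?_⟩
    have h1 := hQ O B hO i x
    have h2 := (f.ev O (.pair (.nat i) x)).toNat_size_le
    have h3 := acc.toNat_size_le
    have h4 := natSize_add_le (f.ev O (.pair (.nat i) x)).toNat acc.toNat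
    simp only [ev_add, ev_onIndex, ev_andThen, ev_snd, Data.snd_pair, Data.size]
    omega

@[simp] theorem ev_sum (k f : Algo) (O x) :
    (sum k f).ev O x =
      .nat (∑ i ∈ Finset.range (k.ev O x).length, (f.ev O (.pair (.nat i) x)).toNat) := by
  rw [sum, ev_iter]
  generalize (k.ev O x).length = n
  rw [Finset.sum_range, ← List.sum_ofFn]
  simp only [ev_add, ev_onIndex, ev_andThen, ev_snd, Data.snd_pair, ev_ofNat]
  have : List.ofFn (fun i : Fin n => (f.ev O (.pair (.nat i) x)).toNat) =
      (List.range n).map fun i => (f.ev O (.pair (.nat i) x)).toNat := by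
    apply List.ext_getElem <;> simp
  rw [this]
  induction List.range n with
  | nil => rfl
  | cons a l ih => rw [List.foldr_cons, ih]; rfl

theorem grows_double : Grows (2 * (snd.andThen snd)) := by
  refine ⟨2, fun O B hO i x acc => ?_⟩
  have h3 := acc.toNat_size_le
  have h4 := natSize_mul_le 2 acc.toNat
  simp only [show Nat.size 2 = 2 from by decide] at h4
  simp only [ev_mul, ev_ofNat, ev_andThen, ev_snd, Data.snd_pair, Data.size, Data.toNat_nat,
    Polynomial.eval_ofNat]
  omega

/-- The power `2 ^ n`, where `n` is the length of the list `k`. -/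
def pow2 (k : Algo) : Algo := iter k 1 (2 * (snd.andThen snd)) grows_double

@[simp] theorem ev_pow2 (k : Algo) (O x) : (pow2 k).ev O x = .nat (2 ^ (k.ev O x).length) := by
  rw [pow2, ev_iter]
  generalize (k.ev O x).length = n
  simp only [ev_mul, ev_ofNat, ev_andThen, ev_snd, Data.snd_pair]
  have (l : List ℕ) : l.foldr (fun _ acc => Data.nat ((Data.nat 2).toNat * acc.toNat)) (.nat 1) =
      .nat (2 ^ l.length) := by
    induction l with
    | nil => rfl
    | cons a l ih => rw [List.foldr_cons, ih, List.length_cons, pow_succ']; rfl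
  simpa using this (List.range n)

theorem toNat_ev_min (O) (i y : Data) :
    ((ite (fst.lt (snd.andThen len)) fst (snd.andThen len)).ev O (.pair i y)).toNat =
      min i.toNat y.length := by
  rw [ev_ite _ _ _ _ _ (ev_lt _ _ _ _)]
  simp only [ev_fst, ev_andThen, ev_snd, ev_len, Data.fst_pair, Data.snd_pair, Data.toNat_nat]
  by_cases h : i.toNat < y.length
  · simp [h, h.le]
  · simp [h, not_lt.1 h]

theorem iterate_snd_body (O) (x y : Data) (n : ℕ) :
    ((fst.pair (snd.andThen snd)).ev O)^[n] (.pair x y) = .pair x (Data.snd^[n] y) := by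
  induction n generalizing y with
  | zero => rfl
  | succ n ih => rw [Function.iterate_succ_apply, Function.iterate_succ_apply, ← ih]; rfl

/-- The element of the list `a` whose index is the number `i`. The number of rounds of the loop is
cut off at the length of the list, because a number may be exponential in its size. -/
def nth (a i : Algo) : Algo where
  prog := .seq (.seq (i.pair a).prog (.loop (ite (fst.lt (snd.andThen len)) fst (snd.andThen
      len)).prog
    (fst.pair (snd.andThen snd)).prog)) (snd.andThen fst).prog
  bound := by
    obtain ⟨I, hI⟩ := i.exists_size_bound
    obtain ⟨A, hA⟩ := a.exists_size_bound
    have key := exists_bound_loop (i.pair a) (ite (fst.lt (snd.andThen len)) fst (snd.andThen len))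
      (fst.pair (snd.andThen snd)) A (I + A + 1) ?_ ?_
    · exact (Algo.andThen ⟨_, key⟩ (snd.andThen fst)).bound
    · intro O B hO x
      rw [ev_pair, toNat_ev_min]
      exact (min_le_right _ _).trans ((a.ev O x).length_le_size.trans (hA O B hO x))
    · intro O B hO x n _
      have := hI O B hO x
      have := hA O B hO x
      have := size_snd_iterate_le (a.ev O x) n
      rw [ev_pair, iterate_snd_body]
      simp only [Data.size, Polynomial.eval_add, Polynomial.eval_one]
      omega

@[simp] theorem ev_nth (a i : Algo) (O x) :
    (nth a i).ev O x = (a.ev O x).nth (i.ev O x).toNat := by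
  have h1 : (nth a i).ev O x = (((fst.pair (snd.andThen snd)).ev O)^[
      ((ite (fst.lt (snd.andThen len)) fst (snd.andThen len)).ev O (.pair (i.ev O x) (a.ev O
          x))).toNat]
      (.pair (i.ev O x) (a.ev O x))).snd.fst := rfl
  rw [h1, toNat_ev_min, iterate_snd_body, Data.snd_pair]
  rcases lt_or_ge (i.ev O x).toNat (a.ev O x).length with h | h
  · rw [min_eq_left h.le]; rfl
  · rw [min_eq_right h, Data.nth_of_length_le _ _ h]
    exact Data.nth_of_length_le _ _ le_rfl

theorem grows_cons_nth : Grows ((((var 1).elt 0).nth (var 0)).pair (snd.andThen snd)) := by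
  refine ⟨Polynomial.X + 1, fun O B hO i x acc => ?_⟩
  have h1 : ((x.nth 0).nth i).size ≤ x.size :=
    (Data.fst_size_le _).trans ((size_snd_iterate_le _ _).trans
      ((Data.fst_size_le _).trans (size_snd_iterate_le x 0)))
  simp only [ev_pair, ev_nth, ev_elt, ev_var, nth_pair_zero, nth_pair_succ, Data.toNat_nat,
      ev_andThen,
    ev_snd, Data.snd_pair, Data.size, Polynomial.eval_add, Polynomial.eval_X, Polynomial.eval_one]
  omega

/-- Concatenation of lists. -/
def app (a b : Algo) : Algo :=
  (a.pair b).andThen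
    (iter fst snd ((((var 1).elt 0).nth (var 0)).pair (snd.andThen snd)) grows_cons_nth)

@[simp] theorem ev_app (a b : Algo) (O x) : (app a b).ev O x = .app (a.ev O x) (b.ev O x) := by
  rw [app, ev_andThen, ev_iter, ← Data.foldr_range_eq_app]
  simp

/-- The concatenation of the lists `f 0, …, f (n - 1)`, where `n` is the length of the list `k`. -/
def flat (k f : Algo) : Algo :=
  iter k 0 (app (onIndex f) (snd.andThen snd)) <| by
    obtain ⟨Q, hQ⟩ := f.exists_size_bound_body
    refine ⟨Q, fun O B hO i x acc => ?_⟩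
    have h1 := hQ O B hO i x
    have h2 := Data.app_size_le (f.ev O (.pair (.nat i) x)) acc
    simp only [ev_app, ev_onIndex, ev_andThen, ev_snd, Data.snd_pair]
    omega

@[simp] theorem ev_flat (k f : Algo) (O x) :
    (flat k f).ev O x = .flat (k.ev O x).length fun i => f.ev O (.pair (.nat i) x) := by
  rw [flat, ev_iter]
  simp only [ev_app, ev_onIndex, ev_andThen, ev_snd, Data.snd_pair, ev_ofNat]
  rfl

end Algo

end

end SMM
namespace SMM

noncomputable section

/-! ### Ranking permutations -/

section Rank

variable {k : ℕ}

/-- The number of indices with a smaller key. -/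
def rank (κ : Fin k → ℕ) (i : Fin k) : ℕ := (Finset.univ.filter fun j => κ j < κ i).card

theorem rank_lt (κ : Fin k → ℕ) (i : Fin k) : rank κ i < k := by
  have : (Finset.univ.filter fun j => κ j < κ i).card < (Finset.univ : Finset (Fin k)).card :=
    Finset.card_lt_card (Finset.filter_ssubset.2 ⟨i, Finset.mem_univ i, lt_irrefl _⟩)
  rwa [Finset.card_univ, Fintype.card_fin] at this

theorem rank_lt_rank (κ : Fin k → ℕ) {i j : Fin k} (h : κ i < κ j) : rank κ i < rank κ j := by
  refine Finset.card_lt_card (Finset.ssubset_iff_subset_ne.2 ⟨?_, fun he => ?_⟩)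
  · exact Finset.monotone_filter_right _ fun l _ hl => lt_trans hl h
  · have : i ∈ Finset.univ.filter fun l => κ l < κ i := by rw [he]; simp [h]
    simp at this

/-- The permutation that sorts the indices by their keys. -/
def rankPerm (κ : Fin k → ℕ) (h : Function.Injective κ) : Equiv.Perm (Fin k) :=
  Equiv.ofBijective (fun i => ⟨rank κ i, rank_lt κ i⟩) <| Finite.injective_iff_bijective.1 <| by
    intro i j hij
    have hij : rank κ i = rank κ j := congrArg Fin.val hij
    rcases lt_trichotomy (κ i) (κ j) with h1 | h1 | h1
    · exact absurd hij (rank_lt_rank κ h1).ne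
    · exact h h1
    · exact absurd hij (rank_lt_rank κ h1).ne'

@[simp] theorem rankPerm_val (κ : Fin k → ℕ) (h : Function.Injective κ) (i : Fin k) :
    (rankPerm κ h i).val = rank κ i := rfl

theorem rankPerm_lt_iff (κ : Fin k → ℕ) (h : Function.Injective κ) (i j : Fin k) :
    rankPerm κ h i < rankPerm κ h j ↔ κ i < κ j := by
  rw [Fin.lt_def, rankPerm_val, rankPerm_val]
  refine ⟨fun hij => ?_, rank_lt_rank κ⟩
  by_contra hc
  rcases (not_lt.1 hc).lt_or_eq with h1 | h1
  · exact absurd hij (rank_lt_rank κ h1).not_gt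
  · rw [h h1] at hij; exact lt_irrefl _ hij

theorem rankPerm_le_iff (κ : Fin k → ℕ) (h : Function.Injective κ) (i j : Fin k) :
    rankPerm κ h i ≤ rankPerm κ h j ↔ κ i ≤ κ j := by
  rw [← not_lt, rankPerm_lt_iff, not_lt]

end Rank

/-! ### Factorization of selection matrices -/

section Labels

variable {t n : ℕ} (f : Fin t → Fin n)

/-- The key that orders positions by label, and positions with the same label by themselves. -/
def posKey (r : Fin t) : ℕ := f r * t + r

theorem posKey_injective : Function.Injective (posKey f) := by
  intro r s h
  have h' : (f r * t + r.val) % t = (f s * t + s.val) % t := congrArg (· % t) h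
  rw [Nat.mul_add_mod_self_right, Nat.mul_add_mod_self_right, Nat.mod_eq_of_lt r.2,
    Nat.mod_eq_of_lt s.2] at h'
  exact Fin.ext h'

/-- The order of the positions by label. -/
def posPerm : Equiv.Perm (Fin t) := rankPerm (posKey f) (posKey_injective f)

/-- The label `c` occurs. -/
def Used (c : Fin n) : Prop := ∃ r, f r = c

/-- The position `r` is the first one with its label. -/
def IsStart (r : Fin t) : Prop := ∀ s < r, f s ≠ f r

open Classical in
/-- The key that orders the occurring labels before the others. -/
def labelKey (c : Fin n) : ℕ := (if Used f c then 0 else n) + c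

theorem labelKey_injective : Function.Injective (labelKey f) := by
  intro c d h
  unfold labelKey at h
  split_ifs at h <;> apply Fin.ext <;> omega

/-- The order of the labels that puts the occurring ones first. -/
def labelPerm : Equiv.Perm (Fin n) := rankPerm (labelKey f) (labelKey_injective f)

open Classical in
/-- The key that orders the first positions of labels before the others. -/
def startKey (r : Fin t) : ℕ := (if IsStart f r then 0 else t) + posPerm f r

theorem startKey_injective : Function.Injective (startKey f) := by
  intro r s h
  unfold startKey at h
  apply (posPerm f).injective
  split_ifs at h <;> apply Fin.ext <;> omega

/-- The order of the positions that puts the first positions of labels first. -/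
def startPerm : Equiv.Perm (Fin t) := rankPerm (startKey f) (startKey_injective f)

open Classical in
/-- The number of labels that occur. -/
def numUsed : ℕ := (Finset.univ.filter (Used f)).card

variable {f}

theorem posPerm_lt_of_lt {r s : Fin t} (h : f r < f s) : posPerm f r < posPerm f s := by
  rw [posPerm, rankPerm_lt_iff, posKey, posKey]
  have h1 := r.2
  have h2 : ((f r).val + 1) * t ≤ f s * t := Nat.mul_le_mul_right t h
  rw [Nat.add_mul] at h2
  omega

theorem posPerm_le_iff {r s : Fin t} (hr : IsStart f r) :
    posPerm f r ≤ posPerm f s ↔ f r ≤ f s := by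
  refine ⟨fun h => not_lt.1 fun h' => absurd h (posPerm_lt_of_lt h').not_ge, fun h => ?_⟩
  rcases h.lt_or_eq with h | h
  · exact (posPerm_lt_of_lt h).le
  · rw [posPerm, rankPerm_le_iff, posKey, posKey, h]
    have : r ≤ s := not_lt.1 fun hs => hr s hs h.symm
    rw [Fin.le_def] at this
    omega

theorem IsStart.eq {r s : Fin t} (hr : IsStart f r) (hs : IsStart f s) (h : f r = f s) : r = s := by
  rcases lt_trichotomy r s with h1 | h1 | h1
  · exact absurd h (hs r h1)
  · exact h1
  · exact absurd h.symm (hr s h1)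

theorem Used.exists_isStart {c : Fin n} (h : Used f c) : ∃ r, IsStart f r ∧ f r = c := by
  classical
  have hne : (Finset.univ.filter fun r => f r = c).Nonempty := by
    obtain ⟨r, hr⟩ := h
    exact ⟨r, by simpa using hr⟩
  have hmem := Finset.min'_mem _ hne
  set r := (Finset.univ.filter fun r => f r = c).min' hne
  have hr : f r = c := by simpa using hmem
  refine ⟨r, fun s hs he => ?_, hr⟩
  exact absurd hs (Finset.min'_le _ s (by simp [he, hr])).not_gt

theorem labelKey_lt_iff {c d : Fin n} (hd : Used f d) :
    labelKey f c < labelKey f d ↔ Used f c ∧ c < d := by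
  unfold labelKey
  rw [Fin.lt_def]
  have := d.2
  split_ifs with h <;> simp [h]
  omega

theorem startKey_lt_iff {r s : Fin t} (hs : IsStart f s) :
    startKey f r < startKey f s ↔ IsStart f r ∧ posPerm f r < posPerm f s := by
  unfold startKey
  rw [Fin.lt_def]
  have := (posPerm f s).2
  split_ifs with h <;> simp [h]
  omega

/-- The first position of a label has the same rank among the first positions as the label among the
occurring labels. -/
theorem startPerm_eq_labelPerm {r : Fin t} (hr : IsStart f r) :
    (startPerm f r).val = (labelPerm f (f r)).val := by
  classical
  rw [startPerm, labelPerm, rankPerm_val, rankPerm_val, rank, rank]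
  have hu : Used f (f r) := ⟨r, rfl⟩
  refine Finset.card_bij (fun s _ => f s) ?_ ?_ ?_
  · intro s hs
    simp only [Finset.mem_filter, Finset.mem_univ, true_and, startKey_lt_iff hr,
      labelKey_lt_iff hu] at hs ⊢
    exact ⟨⟨s, rfl⟩, not_le.1 fun h => hs.2.not_ge ((posPerm_le_iff hr).2 h)⟩
  · intro s hs s' hs' h
    simp only [Finset.mem_filter, Finset.mem_univ, true_and, startKey_lt_iff hr] at hs hs'
    exact hs.1.eq hs'.1 h
  · intro c hc
    simp only [Finset.mem_filter, Finset.mem_univ, true_and, labelKey_lt_iff hu] at hc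
    obtain ⟨s, hs, rfl⟩ := hc.1.exists_isStart
    refine ⟨s, ?_, rfl⟩
    simp only [Finset.mem_filter, Finset.mem_univ, true_and, startKey_lt_iff hr]
    exact ⟨hs, posPerm_lt_of_lt hc.2⟩

open Classical in
theorem numUsed_eq_card_starts : numUsed f = (Finset.univ.filter (IsStart f)).card := by
  symm
  refine Finset.card_bij (fun s _ => f s) ?_ ?_ ?_
  · intro s _
    exact Finset.mem_filter.2 ⟨Finset.mem_univ _, s, rfl⟩
  · intro s hs s' hs' h
    simp only [Finset.mem_filter, Finset.mem_univ, true_and] at hs hs'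
    exact hs.eq hs' h
  · intro c hc
    simp only [Finset.mem_filter, Finset.mem_univ, true_and] at hc
    obtain ⟨s, hs, rfl⟩ := hc.exists_isStart
    exact ⟨s, by simpa using hs, rfl⟩

theorem startPerm_lt_numUsed_iff (r : Fin t) : (startPerm f r).val < numUsed f ↔ IsStart f r := by
  classical
  rw [numUsed_eq_card_starts, startPerm, rankPerm_val, rank]
  constructor
  · intro h
    by_contra hr
    refine absurd h (not_lt.2 (Finset.card_le_card fun s hs => ?_))
    simp only [Finset.mem_filter, Finset.mem_univ, true_and] at hs ⊢
    have := (posPerm f s).2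
    simp only [startKey, hs, hr, if_true, if_false]
    omega
  · intro hr
    refine Finset.card_lt_card (Finset.ssubset_iff_subset_ne.2 ⟨fun s hs => ?_, fun he => ?_⟩)
    · simp only [Finset.mem_filter, Finset.mem_univ, true_and, startKey_lt_iff hr] at hs ⊢
      exact hs.1
    · have : r ∈ Finset.univ.filter fun l => startKey f l < startKey f r := by
        rw [he]; simpa using hr
      simp at this

theorem numUsed_le : numUsed f ≤ n := by
  classical
  exact (Finset.card_le_univ _).trans (by simp)

/-- The occurring labels up to `f r`, in their order, are the labels of the first positions that
precede `r` in the order by labels. -/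
theorem sum_starts {R : Type} [CommRing R] (h : ℕ → R) (r : Fin t) :
    (∑ s : Fin t, if posPerm f s ≤ posPerm f r then
      (if (startPerm f s).val < numUsed f then h (startPerm f s) else 0) else 0) =
      ∑ j ∈ Finset.range ((labelPerm f (f r)).val + 1), h j := by
  classical
  have hu : Used f (f r) := ⟨r, rfl⟩
  simp only [startPerm_lt_numUsed_iff]
  have : ∀ s : Fin t, (if posPerm f s ≤ posPerm f r then
      (if IsStart f s then h (startPerm f s) else 0) else 0) =
      if IsStart f s ∧ posPerm f s ≤ posPerm f r then h (labelPerm f (f s)) else 0 := by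
    intro s
    by_cases hs : IsStart f s
    · simp [hs, startPerm_eq_labelPerm hs]
    · simp [hs]
  simp only [this]
  rw [← Finset.sum_filter]
  refine Finset.sum_bij (fun s _ => (labelPerm f (f s)).val) ?_ ?_ ?_ ?_
  · intro s hs
    simp only [Finset.mem_filter, Finset.mem_univ, true_and] at hs
    rw [Finset.mem_range, Nat.lt_succ_iff, ← Fin.le_def, labelPerm, rankPerm_le_iff, ← not_lt,
      labelKey_lt_iff ⟨s, rfl⟩]
    exact fun h => h.2.not_ge ((posPerm_le_iff hs.1).1 hs.2)
  · intro s hs s' hs' he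
    simp only [Finset.mem_filter, Finset.mem_univ, true_and] at hs hs'
    exact hs.1.eq hs'.1 ((labelPerm f).injective (Fin.ext he))
  · intro j hj
    rw [Finset.mem_range, Nat.lt_succ_iff] at hj
    obtain ⟨c, hc⟩ := (labelPerm f).surjective ⟨j, hj.trans_lt (labelPerm f (f r)).2⟩
    have hle : labelKey f c ≤ labelKey f (f r) := by
      rw [← rankPerm_le_iff (labelKey f) (labelKey_injective f)]
      change labelPerm f c ≤ labelPerm f (f r)
      rw [hc]
      exact hj
    have hc' : Used f c ∧ c ≤ f r := by
      rcases hle.lt_or_eq with h1 | h1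
      · exact ⟨((labelKey_lt_iff hu).1 h1).1, ((labelKey_lt_iff hu).1 h1).2.le⟩
      · rw [labelKey_injective f h1]; exact ⟨hu, le_rfl⟩
    obtain ⟨s, hs, rfl⟩ := hc'.1.exists_isStart
    refine ⟨s, ?_, by rw [hc]⟩
    simp only [Finset.mem_filter, Finset.mem_univ, true_and]
    exact ⟨hs, (posPerm_le_iff hs).2 hc'.2⟩
  · intro s _
    rfl

end Labels

section Matrices

variable {R : Type} [CommRing R]

theorem permMat_mul_apply {k l : ℕ} (s : Equiv.Perm (Fin k)) (M : Matrix (Fin k) (Fin l) R)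
    (i : Fin k) (j : Fin l) : (permMat R s * M) i j = M (s⁻¹ i) j := by
  simp only [Matrix.mul_apply, permMat, Matrix.of_apply, ite_mul, one_mul, zero_mul]
  rw [Finset.sum_eq_single (s⁻¹ i)]
  · simp
  · intro b _ hb
    rw [if_neg]
    rintro rfl
    simp at hb
  · simp

theorem mul_permMat_apply {k l : ℕ} (s : Equiv.Perm (Fin k)) (M : Matrix (Fin l) (Fin k) R)
    (i : Fin l) (j : Fin k) : (M * permMat R s) i j = M i (s j) := by
  simp [Matrix.mul_apply, permMat]

theorem permMat_mul {k : ℕ} (s u : Equiv.Perm (Fin k)) :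
    permMat R s * permMat R u = permMat R (s * u) := by
  ext i j
  rw [mul_permMat_apply]
  rfl

theorem permMat_transpose {k : ℕ} (s : Equiv.Perm (Fin k)) :
    (permMat R s)ᵀ = permMat R s⁻¹ := by
  ext i j
  simp only [permMat, Matrix.transpose_apply, Matrix.of_apply, Equiv.Perm.eq_inv_iff_eq]
  simp only [eq_comm]

theorem gammaMat_transpose (k l r : ℕ) : (gammaMat R k l r)ᵀ = gammaMat R l k r := by
  ext i j
  simp only [gammaMat, Matrix.transpose_apply, Matrix.of_apply]
  congr 1
  apply propext
  constructor <;> rintro ⟨h1, h2⟩ <;> exact ⟨h1.symm, by omega⟩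

theorem sumMat_mul_apply {k l : ℕ} (M : Matrix (Fin k) (Fin l) R) (i : Fin k) (j : Fin l) :
    (sumMat R k * M) i j = ∑ e, if e ≤ i then M e j else 0 := by
  simp [Matrix.mul_apply, sumMat]

theorem gammaMat_mul_apply {k l d r : ℕ} (hr : r ≤ l) (M : Matrix (Fin l) (Fin d) R) (i : Fin k)
    (j : Fin d) : (gammaMat R k l r * M) i j =
      if h : i.val < r then M ⟨i, h.trans_le hr⟩ j else 0 := by
  simp only [Matrix.mul_apply, gammaMat, Matrix.of_apply, ite_mul, one_mul, zero_mul]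
  split_ifs with h
  · rw [Finset.sum_eq_single ⟨i, h.trans_le hr⟩]
    · simp [h]
    · intro b _ hb
      rw [if_neg]
      rintro ⟨h1, _⟩
      exact hb (Fin.ext h1.symm)
    · simp
  · exact Finset.sum_eq_zero fun b _ => by simp [h]

/-- The matrix that selects the coordinate `f r` for each position `r`. -/
def selMat (R : Type) [CommRing R] {t n : ℕ} (f : Fin t → Fin n) : Matrix (Fin t) (Fin n) R :=
  Matrix.of fun r c => if f r = c then 1 else 0

theorem telescope_indicator (a J : ℕ) :
    ∑ j ∈ Finset.range (J + 1), ((if j = a then 1 else if a + 1 = j then -1 else 0) : R) =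
      if J = a then 1 else 0 := by
  induction J with
  | zero =>
    simp only [zero_add, Finset.range_one, Finset.sum_singleton]
    simp
  | succ J ih =>
    rw [Finset.sum_range_succ, ih]
    by_cases h1 : J = a
    · subst h1; simp
    · by_cases h2 : J + 1 = a
      · simp [h1, h2]
      · simp [h1, h2, Ne.symm h1]

/-- The selection matrix as a product: the differences of consecutive occurring coordinates are
placed at the first positions of their labels, and summed up in the order by labels. -/
theorem selMat_eq {t n : ℕ} (f : Fin t → Fin n) :
    permMat R (posPerm f)⁻¹ * (sumMat R t * (permMat R (posPerm f * (startPerm f)⁻¹) *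
      (gammaMat R t n (numUsed f) * (diffMat R n * permMat R (labelPerm f))))) = selMat R f := by
  ext r c
  rw [permMat_mul_apply, sumMat_mul_apply, inv_inv,
    ← Equiv.sum_comp (posPerm f)]
  simp only [permMat_mul_apply, gammaMat_mul_apply numUsed_le, mul_permMat_apply, mul_inv_rev,
    inv_inv, Equiv.Perm.coe_mul, Function.comp_apply, Equiv.Perm.coe_inv, Equiv.symm_apply_apply]
  have := sum_starts (f := f)
    (fun j => (if j = (labelPerm f c).val then 1 else if (labelPerm f c).val + 1 = j then -1 else 0
        : R))
    r
  rw [telescope_indicator] at this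
  simp only [selMat, Matrix.of_apply]
  have h2 : (if (labelPerm f (f r)).val = (labelPerm f c).val then 1 else 0 : R) =
      if f r = c then 1 else 0 := by
    congr 1
    rw [← Fin.ext_iff, (labelPerm f).injective.eq_iff]
  rw [h2] at this
  rw [← this]
  refine Finset.sum_congr rfl fun s _ => ?_
  congr 1
  by_cases h1 : (startPerm f s).val < numUsed f
  · simp [h1, diffMat, Fin.ext_iff]
  · simp [h1]

end Matrices

end

end SMM
namespace SMM

noncomputable section

/-! ### The decomposition of a sparse matrix -/

section Entries

variable {m n N : ℕ} (A : Matrix (Fin m) (Fin n) (ZMod N))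

/-- The positions of the non-zero entries, row by row. -/
def entries : List (Fin m × Fin n) :=
  (List.ofFn fun i => (List.ofFn fun j => if A i j = 0 then [] else [(i, j)]).flatten).flatten

theorem sum_map_entries {M : Type*} [AddCommMonoid M] (g : Fin m × Fin n → M) :
    ((entries A).map g).sum = ∑ i, ∑ j, if A i j = 0 then 0 else g (i, j) := by
  simp only [entries, List.map_flatten, List.sum_flatten, List.map_ofFn, List.sum_ofFn,
    Function.comp_apply]
  refine Finset.sum_congr rfl fun i _ => Finset.sum_congr rfl fun j _ => ?_
  split_ifs <;> simp

theorem length_entries : (entries A).length = nnz A := by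
  have h := sum_map_entries A fun _ => 1
  rw [List.map_const', List.sum_replicate, smul_eq_mul, mul_one] at h
  rw [h, nnz, Finset.card_filter, ← Finset.univ_product_univ, Finset.sum_product]
  refine Finset.sum_congr rfl fun i _ => Finset.sum_congr rfl fun j _ => ?_
  simp

theorem mem_entries (e : Fin m × Fin n) : e ∈ entries A ↔ A e.1 e.2 ≠ 0 := by
  simp only [entries, List.mem_flatten, List.mem_ofFn]
  constructor
  · rintro ⟨l, ⟨i, rfl⟩, h⟩
    obtain ⟨l, hl, h⟩ := List.mem_flatten.1 h
    obtain ⟨j, rfl⟩ := List.mem_ofFn.1 hl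
    split_ifs at h with h0
    · simp at h
    · rw [List.mem_singleton] at h; subst h; exact h0
  · intro h
    refine ⟨_, ⟨e.1, rfl⟩, List.mem_flatten.2 ⟨_, List.mem_ofFn.2 ⟨e.2, rfl⟩, ?_⟩⟩
    rw [if_neg h]
    exact List.mem_singleton.2 rfl

end Entries

section Decomposition

variable {p : Params} (A : SparseMat p)

/-- The position of the `r`-th non-zero entry. -/
def entry (r : Fin p.t) : Fin p.m × Fin p.n :=
  (entries A.1)[r.val]'(by rw [length_entries, A.2]; exact r.2)

theorem list_ofFn_entry {α : Type*} (g : Fin p.m × Fin p.n → α) :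
    List.ofFn (fun r => g (entry A r)) = (entries A.1).map g := by
  have h : (entries A.1).length = p.t := by rw [length_entries, A.2]
  apply List.ext_getElem <;> simp [h, entry]

theorem sum_entry {M : Type*} [AddCommMonoid M] (g : Fin p.m × Fin p.n → M) :
    ∑ r, g (entry A r) = ∑ i, ∑ j, if A.1 i j = 0 then 0 else g (i, j) := by
  rw [← List.sum_ofFn, list_ofFn_entry, sum_map_entries]

theorem exists_entry_iff (e : Fin p.m × Fin p.n) : (∃ r, entry A r = e) ↔ A.1 e.1 e.2 ≠ 0 := by
  rw [← mem_entries, ← List.map_id (entries A.1), ← list_ofFn_entry, List.mem_ofFn]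
  rfl

/-- The row of the `r`-th non-zero entry. -/
def rowOf (r : Fin p.t) : Fin p.m := (entry A r).1

/-- The column of the `r`-th non-zero entry. -/
def colOf (r : Fin p.t) : Fin p.n := (entry A r).2

theorem numUsed_eq_ncard {t n : ℕ} (f : Fin t → Fin n) : numUsed f = {c | Used f c}.ncard := by
  classical
  rw [numUsed, ← Set.ncard_coe_finset]
  congr 1
  ext c
  simp

theorem numUsed_rowOf : numUsed (rowOf A) = nzRows A.1 := by
  rw [numUsed_eq_ncard, nzRows]
  congr 1
  ext i
  simp only [Set.mem_ofPred_eq, Used, rowOf]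
  constructor
  · rintro ⟨r, rfl⟩
    exact ⟨_, (exists_entry_iff A (entry A r)).1 ⟨r, rfl⟩⟩
  · rintro ⟨j, h⟩
    obtain ⟨r, hr⟩ := (exists_entry_iff A (i, j)).2 h
    exact ⟨r, by rw [hr]⟩

theorem numUsed_colOf : numUsed (colOf A) = nzCols A.1 := by
  rw [numUsed_eq_ncard, nzCols]
  congr 1
  ext j
  simp only [Set.mem_ofPred_eq, Used, colOf]
  constructor
  · rintro ⟨r, rfl⟩
    exact ⟨_, (exists_entry_iff A (entry A r)).1 ⟨r, rfl⟩⟩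
  · rintro ⟨i, h⟩
    obtain ⟨r, hr⟩ := (exists_entry_iff A (i, j)).2 h
    exact ⟨r, by rw [hr]⟩

/-- The value of the `r`-th non-zero entry. -/
def entryValue (r : Fin p.t) : p.R := A.1 (entry A r).1 (entry A r).2

/-- A matrix is the sum over its non-zero entries, each placed in its row and column by the two
selection matrices. -/
theorem eq_selMat_mul :
    A.1 = (selMat p.R (rowOf A))ᵀ * Matrix.diagonal (entryValue A) * selMat p.R (colOf A) := by
  ext i j
  rw [Matrix.mul_apply]
  simp only [Matrix.mul_diagonal, Matrix.transpose_apply, selMat, Matrix.of_apply]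
  have h1 : ∀ r, (if rowOf A r = i then 1 else 0) * entryValue A r * (if colOf A r = j then 1 else
      0)
      = (fun e : Fin p.m × Fin p.n => if e.1 = i ∧ e.2 = j then A.1 e.1 e.2 else 0) (entry A r) :=
          by
    intro r
    simp only [rowOf, colOf, entryValue]
    by_cases h2 : (entry A r).1 = i <;> by_cases h3 : (entry A r).2 = j <;> simp [h2, h3]
  rw [Finset.sum_congr rfl fun r _ => h1 r]
  refine Eq.trans ?_ (sum_entry A fun e => if e.1 = i ∧ e.2 = j then A.1 e.1 e.2 else 0).symm
  rw [Finset.sum_eq_single i,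
    Finset.sum_eq_single j]
  · simp only [and_self, if_true]
    split_ifs with h
    · exact h
    · rfl
  · intro b _ hb; simp [hb]
  · simp
  · intro b _ hb; simp [hb]
  · simp

/-- The decomposition: the two selection matrices of the rows and of the columns of the non-zero
entries, factored and with the two inner permutations merged. -/
def decompose : Decomp p where
  s1 := labelPerm (colOf A)
  s2 := posPerm (colOf A) * (startPerm (colOf A))⁻¹
  s3 := posPerm (rowOf A) * (posPerm (colOf A))⁻¹
  s4 := startPerm (rowOf A) * (posPerm (rowOf A))⁻¹
  s5 := (labelPerm (rowOf A))⁻¹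
  weights := fun r => entryValue A ((posPerm (rowOf A))⁻¹ r)
  nrow := numUsed (rowOf A)
  ncol := numUsed (colOf A)

theorem permMat_mul_diagonal {R : Type} [CommRing R] {k : ℕ} (s : Equiv.Perm (Fin k))
    (w : Fin k → R) :
    permMat R s * Matrix.diagonal w = Matrix.diagonal (fun i => w (s⁻¹ i)) * permMat R s := by
  ext i j
  rw [permMat_mul_apply, Matrix.diagonal_mul, Matrix.diagonal_apply]
  simp only [permMat, Matrix.of_apply, Equiv.Perm.inv_eq_iff_eq]
  split_ifs <;> simp

theorem decompose_isFor : (decompose A).IsFor A.1 where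
  eq := by
    conv_lhs => rw [eq_selMat_mul, ← selMat_eq (rowOf A), ← selMat_eq (colOf A)]
    simp only [Matrix.transpose_mul, permMat_transpose, gammaMat_transpose, inv_inv, mul_inv_rev]
    simp only [Decomp.product, decompose, Matrix.mul_assoc]
    rw [← permMat_mul (posPerm (rowOf A)) (posPerm (colOf A))⁻¹]
    simp only [Matrix.mul_assoc]
    rw [← Matrix.mul_assoc (permMat p.R (posPerm (rowOf A))) (Matrix.diagonal _),
      permMat_mul_diagonal]
    simp only [Matrix.mul_assoc]
  nrow := numUsed_rowOf A
  ncol := numUsed_colOf A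

end Decomposition

/-! ### Computing the decomposition in polynomial time -/

/-- The encoding of a vector of natural numbers. -/
def encNats {k : ℕ} (x : Fin k → ℕ) : Data := .list (List.ofFn fun i => .nat (x i))

theorem encVec_eq {k N : ℕ} (x : Fin k → ZMod N) : encVec x = encNats fun i => (x i).val := rfl

theorem encPerm_eq {k : ℕ} (s : Equiv.Perm (Fin k)) : encPerm s = encNats fun i => (s i).val := rfl

@[simp] theorem nth_encNats {k : ℕ} (x : Fin k → ℕ) (i : Fin k) :
    (encNats x).nth i = .nat (x i) := Data.nth_list_ofFn _ i

@[simp] theorem length_encNats {k : ℕ} (x : Fin k → ℕ) : (encNats x).length = k := by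
  simp [encNats]

theorem tab_eq_encNats {k : ℕ} {f : ℕ → Data} {x : Fin k → ℕ} (h : ∀ i : Fin k, f i = .nat (x i)) :
    Data.tab k f = encNats x := (Data.list_ofFn_eq_tab h).symm

@[simp] theorem ite_mul_ite_nat (P Q : Prop) [Decidable P] [Decidable Q] :
    (if P then 1 else 0) * (if Q then 1 else 0) = if P ∧ Q then 1 else 0 := by
  split_ifs <;> simp_all

namespace Algo

/-- Computes the permutation that sorts a list of keys. -/
def ranks : Algo := tab id (sum (up 1) (lt ((up 2).nth (var 0)) ((up 2).nth (var 1))))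

theorem ev_ranks (O) {k : ℕ} (κ : Fin k → ℕ) (h : Function.Injective κ) :
    ranks.ev O (encNats κ) = encPerm (rankPerm κ h) := by
  rw [encPerm_eq, ranks, ev_tab, ev_id, length_encNats]
  refine tab_eq_encNats fun i => ?_
  simp only [ev_sum, ev_up_succ, ev_up_zero, Data.snd_pair, ev_lt, ev_nth, ev_var, nth_pair_zero,
    nth_pair_succ, Data.toNat_nat, length_encNats, Finset.sum_range, nth_encNats, rankPerm_val,
        rank,
    Finset.card_filter]

/-- Composes a vector with the inverse of a permutation. -/
def compInv : Algo := tab (var 1) (sum ((up 1).elt 1)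
  (eq (((up 2).elt 1).nth (var 0)) (var 1) * (((up 2).elt 0).nth (var 0))))

theorem ev_compInv (O) {k : ℕ} (x : Fin k → ℕ) (s : Equiv.Perm (Fin k)) :
    compInv.ev O (.list [encNats x, encPerm s]) = encNats fun i => x (s⁻¹ i) := by
  rw [encPerm_eq, compInv, ev_tab]
  simp only [ev_var, Data.nth_list_succ, Data.nth_list_zero, length_encNats]
  refine tab_eq_encNats fun i => ?_
  simp [Finset.sum_range, ← Fin.ext_iff, ← Equiv.Perm.eq_inv_iff_eq]

theorem sum_indicator_pos {t : ℕ} (P : Fin t → Prop) [DecidablePred P] :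
    (0 < ∑ r, if P r then 1 else 0) ↔ ∃ r, P r := by
  simp [Finset.card_pos, Finset.filter_nonempty_iff]

theorem zero_eq_sum_indicator {t : ℕ} (P : Fin t → Prop) [DecidablePred P] :
    (0 = ∑ r, if P r then 1 else 0) ↔ ¬ ∃ r, P r := by
  rw [← sum_indicator_pos]
  omega

/-- Computes the order of the positions from the list of their labels. -/
def posRanks : Algo :=
  (tab id (((up 1).nth (var 0)) * (up 1).andThen len + var 0)).andThen ranks

theorem ev_posRanks (O) {t n : ℕ} (f : Fin t → Fin n) :
    posRanks.ev O (encNats fun r => (f r).val) = encPerm (posPerm f) := by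
  rw [posPerm, ← ev_ranks O, posRanks, ev_andThen]
  congr 1
  simp only [ev_tab, ev_id, length_encNats]
  exact tab_eq_encNats fun i => by simp [posKey]

/-- Computes the order of the first positions from the labels and the order of the positions. -/
def startRanks : Algo :=
  (tab (var 0) (lt 0 (sum ((up 1).elt 0) (lt (var 0) (var 1) *
    eq (((up 2).elt 0).nth (var 0)) (((up 2).elt 0).nth (var 1)))) * ((up 1).elt 0).andThen len +
      ((up 1).elt 1).nth (var 0))).andThen ranks

theorem ev_startRanks (O) {t n : ℕ} (f : Fin t → Fin n) :
    startRanks.ev O (.list [encNats fun r => (f r).val, encPerm (posPerm f)]) =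
      encPerm (startPerm f) := by
  classical
  rw [startPerm, ← ev_ranks O, startRanks, ev_andThen]
  congr 1
  simp only [ev_tab, ev_var, Data.nth_list_zero, length_encNats]
  refine tab_eq_encNats fun i => ?_
  simp only [ev_add, ev_mul, ev_lt, ev_ofNat, ev_sum, ev_elt, ev_up_succ, ev_up_zero, Data.snd_pair,
    Data.nth_list_zero, Data.nth_list_succ, ev_eq, ev_nth, ev_var, nth_pair_zero, nth_pair_succ,
    ev_andThen, ev_len, length_encNats, Data.toNat_nat, Finset.sum_range, nth_encNats,
    ite_mul_ite_nat, sum_indicator_pos, encPerm_eq, startKey]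
  have h : (∃ s : Fin t, s.val < i.val ∧ (f s).val = (f i).val) ↔ ¬ IsStart f i := by
    simp [IsStart, Fin.ext_iff]
  simp only [h, ite_mul, one_mul, zero_mul, ite_not]

/-- Computes the order of the labels from the labels of the positions and the number of all labels
in unary. -/
def labelRanks : Algo :=
  (tab (var 1) (eq 0 (sum ((up 1).elt 0) (eq (((up 2).elt 0).nth (var 0)) (var 1))) *
    ((up 1).elt 1).andThen len + var 0)).andThen ranks

theorem ev_labelRanks (O) {t n : ℕ} (f : Fin t → Fin n) :
    labelRanks.ev O (.list [encNats fun r => (f r).val, .unary n]) = encPerm (labelPerm f) := by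
  classical
  rw [labelPerm, ← ev_ranks O, labelRanks, ev_andThen]
  congr 1
  simp only [ev_tab, ev_var, Data.nth_list_zero, Data.nth_list_succ, Data.length_unary]
  refine tab_eq_encNats fun i => ?_
  simp only [ev_add, ev_mul, ev_ofNat, ev_sum, ev_elt, ev_up_succ, ev_up_zero, Data.snd_pair,
    Data.nth_list_zero, Data.nth_list_succ, ev_eq, ev_nth, ev_var, nth_pair_zero, nth_pair_succ,
    ev_andThen, ev_len, length_encNats, Data.length_unary, Data.toNat_nat, Finset.sum_range,
    nth_encNats, zero_eq_sum_indicator, labelKey, ← Fin.ext_iff]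
  simp only [show (∃ r, f r = i) ↔ Used f i from Iff.rfl, ite_mul, one_mul, zero_mul, ite_not]

/-- Computes the number of occurring labels. -/
def countUsed : Algo :=
  sum (var 1) (lt 0 (sum ((up 1).elt 0) (eq (((up 2).elt 0).nth (var 0)) (var 1))))

theorem ev_countUsed (O) {t n : ℕ} (f : Fin t → Fin n) :
    countUsed.ev O (.list [encNats fun r => (f r).val, .unary n]) = .nat (numUsed f) := by
  classical
  have hu : ∀ c, (∃ r, f r = c) ↔ Used f c := fun _ => Iff.rfl
  simp only [countUsed, ev_ofNat, ev_sum, ev_elt, ev_up_succ, ev_up_zero, Data.snd_pair,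
    Data.nth_list_zero, Data.nth_list_succ, ev_eq, ev_nth, ev_var, nth_pair_zero, nth_pair_succ,
    length_encNats, Data.length_unary, Data.toNat_nat, Finset.sum_range, ev_lt,
    nth_encNats, sum_indicator_pos, ← Fin.ext_iff, numUsed, Finset.card_filter, hu]

/-- Computes, from a list of labels and the number of all labels in unary, the order of the
positions, the order of the first positions, the order of the labels, and the number of occurring
labels. -/
def labelData : Algo :=
  lst [(var 0).andThen posRanks, (lst [var 0, (var 0).andThen posRanks]).andThen startRanks,
      labelRanks,
    countUsed]

theorem ev_labelData (O) {t n : ℕ} (f : Fin t → Fin n) :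
    labelData.ev O (.list [encNats fun r => (f r).val, .unary n]) =
      .list [encPerm (posPerm f), encPerm (startPerm f), encPerm (labelPerm f),
        .nat (numUsed f)] := by
  simp only [labelData, ev_lst, List.map_cons, List.map_nil, ev_andThen, ev_var, Data.nth_list_zero,
    ev_posRanks, ev_startRanks, ev_labelRanks, ev_countUsed]

/-- The list of the non-zero entries, each with its row, its column and its value. -/
def entriesData : Algo :=
  flat ((var 0).elt 0) (flat (((up 1).elt 0).elt 1)
    (ite ((((up 2).elt 1).nth (var 1)).nth (var 0))
      (lst [lst [var 1, var 0, (((up 2).elt 1).nth (var 1)).nth (var 0)]]) 0))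

theorem ev_entriesData (O) {p : Params} (A : Matrix (Fin p.m) (Fin p.n) p.R) :
    entriesData.ev O (.list [p.enc, encMat A]) =
      .list ((entries A).map fun e => .list [.nat e.1, .nat e.2, .nat (A e.1 e.2).val]) := by
  rw [entries, List.map_flatten, List.map_ofFn]
  simp only [entriesData, ev_flat, ev_elt, ev_var, Data.nth_list_zero, Params.enc,
      Data.length_unary]
  refine Data.flat_eq_list fun i => ?_
  rw [Function.comp_apply, List.map_flatten, List.map_ofFn]
  simp only [ev_up_succ, ev_up_zero, Data.snd_pair, Data.nth_list_zero, Data.nth_list_succ,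
    Data.length_unary]
  refine Data.flat_eq_list fun j => ?_
  have h : ((encMat A).nth i).nth j = .nat (A i j).val := by
    rw [encMat, Data.nth_list_ofFn, encVec_eq, nth_encNats]
  rw [ev_ite (n := (A i j).val) _ _ _ _ _ (by simp [h])]
  simp only [ZMod.val_eq_zero, Function.comp_apply]
  split_ifs
  · simp; rfl
  · simp [h]

/-- Computes the decomposition of a sparse matrix. -/
def decomposition : Algo :=
  (lst [entriesData, var 0]).andThen <|
  (lst [(lst [tab (var 0) ((((up 1).elt 0).nth (var 0)).elt 0), (var 1).elt 0]).andThen labelData,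
    (lst [tab (var 0) ((((up 1).elt 0).nth (var 0)).elt 1), (var 1).elt 1]).andThen labelData,
    tab (var 0) ((((up 1).elt 0).nth (var 0)).elt 2)]).andThen <|
  lst [(var 1).elt 2, (lst [(var 1).elt 0, (var 1).elt 1]).andThen compInv,
    (lst [(var 0).elt 0, (var 1).elt 0]).andThen compInv,
    (lst [(var 0).elt 1, (var 0).elt 0]).andThen compInv,
    (lst [tab ((var 0).elt 2) (var 0), (var 0).elt 2]).andThen compInv,
    (lst [var 2, (var 0).elt 0]).andThen compInv, (var 0).elt 3, (var 1).elt 3]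

theorem ev_decomposition (O) {p : Params} (A : SparseMat p) :
    decomposition.ev O (.list [p.enc, encMat A.1]) = (decompose A).enc := by
  have h0 : entriesData.ev O (.list [p.enc, encMat A.1]) = .list (List.ofFn fun r =>
      .list [.nat (rowOf A r), .nat (colOf A r), .nat (entryValue A r).val]) := by
    rw [ev_entriesData, ← list_ofFn_entry]
    rfl
  have h1 (c : ℕ) (g : Fin p.t → ℕ) (y : Data) (h : ∀ r, (Data.list [.nat (rowOf A r),
      .nat (colOf A r), .nat (entryValue A r).val]).nth c = .nat (g r)) :
      (tab (var 0) ((((up 1).elt 0).nth (var 0)).elt c)).ev O (.list [.list (List.ofFn fun r =>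
      .list [.nat (rowOf A r), .nat (colOf A r), .nat (entryValue A r).val]), y]) = encNats g := by
    simp only [ev_tab, ev_var, Data.nth_list_zero, Data.length_list, List.length_ofFn]
    refine tab_eq_encNats fun i => ?_
    simp only [ev_elt, ev_nth, ev_up_succ, ev_up_zero, Data.snd_pair, Data.nth_list_zero, ev_var,
      nth_pair_zero, Data.toNat_nat, Data.nth_list_ofFn, h]
  rw [decomposition, ev_andThen, ev_lst]
  simp only [List.map_cons, List.map_nil, ev_var, Data.nth_list_zero, h0]
  rw [ev_andThen, ev_lst]
  simp only [List.map_cons, List.map_nil, ev_andThen, ev_lst]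
  rw [h1 0 (fun r => (rowOf A r).val) _ (fun r => rfl), h1 1 (fun r => (colOf A r).val) _ (fun r =>
      rfl),
    h1 2 (fun r => (entryValue A r).val) _ (fun r => rfl)]
  simp only [ev_elt, ev_var, Data.nth_list_zero, Data.nth_list_succ, Params.enc, ev_labelData]
  have hid : (tab ((var 0).elt 2) (var 0)).ev O (.list [.list [encPerm (posPerm (rowOf A)),
      encPerm (startPerm (rowOf A)), encPerm (labelPerm (rowOf A)), .nat (numUsed (rowOf A))],
      .list [encPerm (posPerm (colOf A)),
      encPerm (startPerm (colOf A)), encPerm (labelPerm (colOf A)), .nat (numUsed (colOf A))],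
      encNats fun r => (entryValue A r).val]) = encNats fun i : Fin p.m => i.val := by
    simp only [ev_tab, ev_var, ev_elt, Data.nth_list_zero, Data.nth_list_succ, encPerm_eq,
      length_encNats]
    exact tab_eq_encNats fun i => by simp
  have h2 {k : ℕ} (s u : Equiv.Perm (Fin k)) :
      compInv.ev O (.list [encPerm s, encPerm u]) = encPerm (s * u⁻¹) := ev_compInv O _ u
  have h3 {k : ℕ} (u : Equiv.Perm (Fin k)) :
      compInv.ev O (.list [encNats fun i : Fin k => i.val, encPerm u]) = encPerm u⁻¹ :=
    ev_compInv O _ u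
  rw [hid, h2, h2, h2, h3, ev_compInv]
  rfl

end Algo

/-- The polynomial-time algorithm that decomposes every sparse matrix. -/
def decompAlg : DecompAlg where
  dec _ := decompose
  isFor _ := decompose_isFor
  prog := Algo.decomposition.prog
  poly := Algo.decomposition.polyTime
  computes _ := Algo.ev_decomposition _

end

end SMM
namespace SMM

noncomputable section

/-! ### The instances of the subprotocols and their queries -/

namespace Params

/-! The first counters of the second to eighth step of the protocol. -/

def ctr2 (p : Params) : ℕ := 0 + p.d
def ctr3 (p : Params) : ℕ := p.ctr2 + p.n * p.d
def ctr4 (p : Params) : ℕ := p.ctr3 + p.d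
def ctr5 (p : Params) : ℕ := p.ctr4 + p.d
def ctr6 (p : Params) : ℕ := p.ctr5 + p.t * p.d
def ctr7 (p : Params) : ℕ := p.ctr6 + p.d
def ctr8 (p : Params) : ℕ := p.ctr7 + p.m * p.d

end Params

/-- The instances of the subprotocols in one run: the permutation of one column, or the
multiplication of one entry. The eight factors of the decomposition that need communication are
numbered from right to left, here and in the names of the matrices that occur in the protocol. -/
inductive Idx (p : Params) : Type
  | op1 (j : Fin p.d)
  | osm2 (i : Fin p.n) (j : Fin p.d)
  | op3 (j : Fin p.d)
  | op4 (j : Fin p.d)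
  | mul5 (i : Fin p.t) (j : Fin p.d)
  | op6 (j : Fin p.d)
  | osm7 (i : Fin p.m) (j : Fin p.d)
  | op8 (j : Fin p.d)

namespace Idx

variable {p : Params}

/-- The counter of an instance. -/
def ctr : Idx p → ℕ
  | op1 j => 0 + j
  | osm2 i j => p.ctr2 + (i * p.d + j)
  | op3 j => p.ctr3 + j
  | op4 j => p.ctr4 + j
  | mul5 i j => p.ctr5 + (i * p.d + j)
  | op6 j => p.ctr6 + j
  | osm7 i j => p.ctr7 + (i * p.d + j)
  | op8 j => p.ctr8 + j

theorem grid_lt {k d : ℕ} (i : Fin k) (j : Fin d) : i.val * d + j.val < k * d := by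
  have h : (i.val + 1) * d ≤ k * d := Nat.mul_le_mul_right d i.2
  rw [Nat.add_mul] at h
  have := j.2
  omega

theorem grid_injective {k d : ℕ} {i i' : Fin k} {j j' : Fin d}
    (h : i.val * d + j.val = i'.val * d + j'.val) : i = i' ∧ j = j' := by
  have h1 := congrArg (· % d) h
  simp only [Nat.mul_add_mod_self_right, Nat.mod_eq_of_lt j.2, Nat.mod_eq_of_lt j'.2] at h1
  rw [h1, Nat.add_right_cancel_iff, Nat.mul_left_inj (by have := j.2; omega)] at h
  exact ⟨Fin.ext h, Fin.ext h1⟩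

/-- The number of steps before the one that an instance belongs to. -/
def step : Idx p → ℕ
  | op1 _ => 0
  | osm2 _ _ => 1
  | op3 _ => 2
  | op4 _ => 3
  | mul5 _ _ => 4
  | op6 _ => 5
  | osm7 _ _ => 6
  | op8 _ => 7

/-- The first counter of a step. -/
def base (p : Params) : ℕ → ℕ
  | 0 => 0
  | 1 => p.ctr2
  | 2 => p.ctr3
  | 3 => p.ctr4
  | 4 => p.ctr5
  | 5 => p.ctr6
  | 6 => p.ctr7
  | 7 => p.ctr8
  | _ => p.ctr8 + p.d

theorem base_mono : Monotone (base p) :=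
  monotone_nat_of_le_succ fun s => by
    match s with
    | 0 | 1 | 2 | 3 | 4 | 5 | 6 | 7 =>
      simp only [base, Params.ctr2, Params.ctr3, Params.ctr4, Params.ctr5, Params.ctr6, Params.ctr7,
        Params.ctr8]
      omega
    | s + 8 => exact le_rfl

theorem base_le_ctr (i : Idx p) : base p i.step ≤ i.ctr := by
  cases i <;> simp [base, ctr, step]

theorem ctr_lt_base (i : Idx p) : i.ctr < base p (i.step + 1) := by
  cases i with
  | osm2 i j => have := grid_lt i j; simp only [base, ctr, step, Params.ctr3]; omega
  | mul5 i j => have := grid_lt i j; simp only [base, ctr, step, Params.ctr6]; omega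
  | osm7 i j => have := grid_lt i j; simp only [base, ctr, step, Params.ctr8]; omega
  | op1 j | op3 j | op4 j | op6 j | op8 j =>
    have := j.2
    simp only [base, ctr, step, Params.ctr2, Params.ctr4, Params.ctr5, Params.ctr7]
    omega

theorem step_le_of_ctr_eq {a b : Idx p} (h : a.ctr = b.ctr) : a.step ≤ b.step := by
  by_contra hlt
  have h1 := base_mono (p := p) (show b.step + 1 ≤ a.step by omega)
  have h2 := base_le_ctr a
  have h3 := ctr_lt_base b
  omega

theorem ctr_injective : Function.Injective (ctr (p := p)) := by
  intro a b h
  have hs : a.step = b.step := (step_le_of_ctr_eq h).antisymm (step_le_of_ctr_eq h.symm)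
  cases a <;> cases b <;> first | (simp [step] at hs; done) | skip
  case op1.op1 j j' => rw [Fin.ext (Nat.add_left_cancel h)]
  case op3.op3 j j' => rw [Fin.ext (Nat.add_left_cancel h)]
  case op4.op4 j j' => rw [Fin.ext (Nat.add_left_cancel h)]
  case op6.op6 j j' => rw [Fin.ext (Nat.add_left_cancel h)]
  case op8.op8 j j' => rw [Fin.ext (Nat.add_left_cancel h)]
  case osm2.osm2 i j i' j' =>
    obtain ⟨rfl, rfl⟩ := grid_injective (Nat.add_left_cancel h); rfl
  case mul5.mul5 i j i' j' =>
    obtain ⟨rfl, rfl⟩ := grid_injective (Nat.add_left_cancel h); rfl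
  case osm7.osm7 i j i' j' =>
    obtain ⟨rfl, rfl⟩ := grid_injective (Nat.add_left_cancel h); rfl

theorem ctr_lt (i : Idx p) :
    i.ctr < 5 * p.d + p.n * p.d + p.t * p.d + p.m * p.d := by
  have h1 := ctr_lt_base i
  have h2 : i.step + 1 ≤ 8 := by cases i <;> simp [step]
  have h3 := base_mono (p := p) h2
  have h4 : base p 8 = p.ctr8 + p.d := rfl
  simp only [Params.ctr2, Params.ctr3, Params.ctr4, Params.ctr5, Params.ctr6, Params.ctr7,
    Params.ctr8] at h4
  omega

instance : Finite (Idx p) :=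
  Finite.of_injective (fun i => (⟨i.ctr, ctr_lt i⟩ : Fin _))
    fun _ _ h => ctr_injective (congrArg Fin.val h)

instance : Fintype (Idx p) := Fintype.ofFinite _

instance : DecidableEq (Idx p) := Classical.decEq _

/-- The query of an instance under the key of `P₀`. -/
@[reducible] def query₀ (i : Idx p) : Query :=
  match i with
  | op1 j => ⟨0 + j, p.n, 0, p.n, p.L⟩
  | osm2 i j => ⟨p.ctr2 + (i * p.d + j), 0, 1, 2, p.L⟩
  | op3 j => ⟨p.ctr3 + j, p.t, 0, p.t, p.L⟩
  | op4 j => ⟨p.ctr4 + j, p.t, 0, p.t, p.L⟩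
  | mul5 i j => ⟨p.ctr5 + (i * p.d + j), 0, 0, 3, p.L⟩
  | op6 j => ⟨p.ctr6 + j, p.t, 0, p.t, p.L⟩
  | osm7 i j => ⟨p.ctr7 + (i * p.d + j), 0, 1, 2, p.L⟩
  | op8 j => ⟨p.ctr8 + j, p.m, 0, p.m, p.L⟩

/-- The query of an instance under the key of `P₁`. -/
@[reducible] def query₁ (i : Idx p) : Query :=
  match i with
  | op1 j => ⟨0 + j, 0, 0, p.n, p.L⟩
  | osm2 i j => ⟨p.ctr2 + (i * p.d + j), 0, 0, 1, p.L⟩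
  | op3 j => ⟨p.ctr3 + j, 0, 0, p.t, p.L⟩
  | op4 j => ⟨p.ctr4 + j, 0, 0, p.t, p.L⟩
  | mul5 i j => ⟨p.ctr5 + (i * p.d + j), 0, 0, 2, p.L⟩
  | op6 j => ⟨p.ctr6 + j, 0, 0, p.t, p.L⟩
  | osm7 i j => ⟨p.ctr7 + (i * p.d + j), 0, 0, 1, p.L⟩
  | op8 j => ⟨p.ctr8 + j, 0, 0, p.m, p.L⟩

theorem query₀_ctr (i : Idx p) : i.query₀.ctr = i.ctr := by cases i <;> rfl

theorem query₁_ctr (i : Idx p) : i.query₁.ctr = i.ctr := by cases i <;> rfl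

theorem query₀_injective : Function.Injective (query₀ (p := p)) := fun a b h =>
  ctr_injective (by rw [← query₀_ctr, ← query₀_ctr, h])

theorem query₁_injective : Function.Injective (query₁ (p := p)) := fun a b h =>
  ctr_injective (by rw [← query₁_ctr, ← query₁_ctr, h])

end Idx

/-- The query lies in the domain of the oracles of size `s`. -/
structure Query.Fits (q : Query) (s : ℕ) : Prop where
  ctr : q.ctr < 2 ^ s
  k : q.k < s + 1
  b : q.b < s + 1
  l : q.l < s + 1
  L : q.L < s + 1

theorem Data.unary_size (n : ℕ) : (Data.unary n).size = 2 * n + 1 := by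
  unfold Data.unary
  induction n with
  | zero => rfl
  | succ n ih => simp only [List.replicate_succ, Data.list, Data.size] at ih ⊢; simp; omega

theorem Params.enc_size_eq (p : Params) :
    p.enc.size = 2 * (p.m + p.n + p.d + p.t + p.L) + 11 := by
  simp only [Params.enc, Data.list, Data.size, Data.unary_size]
  simp
  omega

theorem Idx.ctr_lt_of_size {p : Params} {N : ℕ} (h : p.enc.size ≤ N) (i : Idx p) :
    i.ctr < N ^ 2 := by
  rw [Params.enc_size_eq] at h
  refine (Idx.ctr_lt i).trans_le ?_
  have : (p.m + p.n + p.d + p.t + 5) ^ 2 ≤ N ^ 2 := Nat.pow_le_pow_left (by omega) 2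
  nlinarith [Nat.zero_le (p.d * p.d)]

theorem Idx.query₀_fits {p : Params} {N : ℕ} (h : p.enc.size ≤ N) (i : Idx p) :
    i.query₀.Fits (N ^ 2) := by
  have h1 := Idx.ctr_lt_of_size h i
  rw [Params.enc_size_eq] at h
  have h2 : N ≤ N ^ 2 := Nat.le_self_pow (by norm_num) N
  constructor
  · rw [query₀_ctr]; exact h1.trans (Nat.lt_two_pow_self)
  all_goals cases i <;> simp only <;> omega

theorem Idx.query₁_fits {p : Params} {N : ℕ} (h : p.enc.size ≤ N) (i : Idx p) :
    i.query₁.Fits (N ^ 2) := by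
  have h1 := Idx.ctr_lt_of_size h i
  rw [Params.enc_size_eq] at h
  have h2 : N ≤ N ^ 2 := Nat.le_self_pow (by norm_num) N
  constructor
  · rw [query₁_ctr]; exact h1.trans (Nat.lt_two_pow_self)
  all_goals cases i <;> simp only <;> omega

/-- A family of data, one for each instance, as one datum. -/
def Idx.table {p : Params} (h : Idx p → Data) : Data :=
  .list [.list (List.ofFn fun j => h (.op1 j)),
    .list (List.ofFn fun i => .list (List.ofFn fun j => h (.osm2 i j))),
    .list (List.ofFn fun j => h (.op3 j)),
    .list (List.ofFn fun j => h (.op4 j)),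
    .list (List.ofFn fun i => .list (List.ofFn fun j => h (.mul5 i j))),
    .list (List.ofFn fun j => h (.op6 j)),
    .list (List.ofFn fun i => .list (List.ofFn fun j => h (.osm7 i j))),
    .list (List.ofFn fun j => h (.op8 j))]

namespace Algo

/-- The answers to the queries of `d` instances with consecutive counters, where the public
parameters are the first component of the input. `ask` maps a query and the input to an answer. -/
def askRow (ask ctr k b l : Algo) : Algo :=
  tab ((var 0).elt 2) (((lst [(up 1).andThen ctr + var 0, (up 1).andThen k, (up 1).andThen b, (up
      1).andThen l,
    ((up 1).elt 0).elt 4]).pair (up 1)).andThen ask)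

/-- The answers to the queries of instances that form a matrix. -/
def askGrid (ask rows ctr b l : Algo) : Algo :=
  tab rows (tab (((up 1).elt 0).elt 2) (((lst [(up 2).andThen ctr +
    (var 1 * (((up 2).elt 0).elt 2).andThen len + var 0), 0, (up 2).andThen b, (up 2).andThen l,
    ((up 2).elt 0).elt 4]).pair (up 2)).andThen ask))

/-- A fixed number in unary. -/
def ones (n : ℕ) : Algo := lst (List.replicate n 0)

@[simp] theorem ev_ones (n O x) : (ones n).ev O x = .unary n := by
  simp [ones, Data.unary]

/-! The numbers of rows and columns and the first counters, computed from the public parameters. -/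

def cntM : Algo := ((var 0).elt 0).andThen len
def cntN : Algo := ((var 0).elt 1).andThen len
def cntD : Algo := ((var 0).elt 2).andThen len
def cntT : Algo := ((var 0).elt 3).andThen len
def ctr2 : Algo := 0 + cntD
def ctr3 : Algo := ctr2 + cntN * cntD
def ctr4 : Algo := ctr3 + cntD
def ctr5 : Algo := ctr4 + cntD
def ctr6 : Algo := ctr5 + cntT * cntD
def ctr7 : Algo := ctr6 + cntD
def ctr8 : Algo := ctr7 + cntM * cntD

/-- The answers to all queries under the key of `P₀`. -/
def answers₀ (ask : Algo) : Algo :=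
  lst [askRow ask 0 ((var 0).elt 1) 0 ((var 0).elt 1),
    askGrid ask ((var 0).elt 1) ctr2 (ones 1) (ones 2),
    askRow ask ctr3 ((var 0).elt 3) 0 ((var 0).elt 3),
    askRow ask ctr4 ((var 0).elt 3) 0 ((var 0).elt 3),
    askGrid ask ((var 0).elt 3) ctr5 0 (ones 3),
    askRow ask ctr6 ((var 0).elt 3) 0 ((var 0).elt 3),
    askGrid ask ((var 0).elt 0) ctr7 (ones 1) (ones 2),
    askRow ask ctr8 ((var 0).elt 0) 0 ((var 0).elt 0)]

/-- The answers to all queries under the key of `P₁`. -/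
def answers₁ (ask : Algo) : Algo :=
  lst [askRow ask 0 0 0 ((var 0).elt 1),
    askGrid ask ((var 0).elt 1) ctr2 0 (ones 1),
    askRow ask ctr3 0 0 ((var 0).elt 3),
    askRow ask ctr4 0 0 ((var 0).elt 3),
    askGrid ask ((var 0).elt 3) ctr5 0 (ones 2),
    askRow ask ctr6 0 0 ((var 0).elt 3),
    askGrid ask ((var 0).elt 0) ctr7 0 (ones 1),
    askRow ask ctr8 0 0 ((var 0).elt 0)]

theorem ev_counters (O) {p : Params} {x : Data} (hx : x.nth 0 = p.enc) :
    ctr2.ev O x = .nat p.ctr2 ∧ ctr3.ev O x = .nat p.ctr3 ∧ ctr4.ev O x = .nat p.ctr4 ∧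
    ctr5.ev O x = .nat p.ctr5 ∧ ctr6.ev O x = .nat p.ctr6 ∧ ctr7.ev O x = .nat p.ctr7 ∧
    ctr8.ev O x = .nat p.ctr8 := by
  have hM : cntM.ev O x = .nat p.m := by simp [cntM, hx, Params.enc]
  have hN : cntN.ev O x = .nat p.n := by simp [cntN, hx, Params.enc]
  have hD : cntD.ev O x = .nat p.d := by simp [cntD, hx, Params.enc]
  have hT : cntT.ev O x = .nat p.t := by simp [cntT, hx, Params.enc]
  simp [ctr2, ctr3, ctr4, ctr5, ctr6, ctr7, ctr8, hM, hN, hD, hT, Params.ctr2, Params.ctr3,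
    Params.ctr4, Params.ctr5, Params.ctr6, Params.ctr7, Params.ctr8]

theorem ev_askRow (ask : Algo) {ctr k b l : Algo} (O) {p : Params} {x : Data}
    (hx : x.nth 0 = p.enc) {c : ℕ} (hc : ctr.ev O x = .nat c) :
    (askRow ask ctr k b l).ev O x = .list (List.ofFn fun j : Fin p.d =>
      ask.ev O (.pair (.list [.nat (c + j), k.ev O x, b.ev O x, l.ev O x, .unary p.L]) x)) := by
  have h2 : (x.nth 0).nth 2 = .unary p.d := by rw [hx]; rfl
  have h4 : (x.nth 0).nth 4 = .unary p.L := by rw [hx]; rfl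
  simp only [askRow, ev_tab, ev_elt, ev_var, h2, Data.length_unary]
  refine (Data.list_ofFn_eq_tab fun j => ?_).symm
  simp [hc, h4]

theorem ev_askGrid (ask : Algo) {rows ctr b l : Algo} (O) {p : Params} {x : Data}
    (hx : x.nth 0 = p.enc) {c k : ℕ} (hc : ctr.ev O x = .nat c) (hk : rows.ev O x = .unary k) :
    (askGrid ask rows ctr b l).ev O x = .list (List.ofFn fun i : Fin k =>
      .list (List.ofFn fun j : Fin p.d => ask.ev O (.pair (.list [.nat (c + (i * p.d + j)), .nat 0,
        b.ev O x, l.ev O x, .unary p.L]) x))) := by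
  have h2 : (x.nth 0).nth 2 = .unary p.d := by rw [hx]; rfl
  have h4 : (x.nth 0).nth 4 = .unary p.L := by rw [hx]; rfl
  simp only [askGrid, ev_tab, hk, Data.length_unary]
  refine (Data.list_ofFn_eq_tab fun i => ?_).symm
  simp only [ev_elt, ev_up_succ, ev_up_zero, Data.snd_pair, h2, Data.length_unary]
  refine (Data.list_ofFn_eq_tab fun j => ?_).symm
  simp [hc, h2, h4]

theorem ev_answers₀ (ask : Algo) (O) {p : Params} {x : Data} (hx : x.nth 0 = p.enc) :
    (answers₀ ask).ev O x =
      Idx.table fun i : Idx p => ask.ev O (.pair i.query₀.enc x) := by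
  obtain ⟨h2, h3, h4, h5, h6, h7, h8⟩ := ev_counters O hx
  have hm : ((var 0).elt 0).ev O x = .unary p.m := by simp [hx, Params.enc]
  have hn : ((var 0).elt 1).ev O x = .unary p.n := by simp [hx, Params.enc]
  have ht : ((var 0).elt 3).ev O x = .unary p.t := by simp [hx, Params.enc]
  rw [answers₀, ev_lst]
  simp only [List.map_cons, List.map_nil, ev_askRow ask O hx (ev_ofNat 0 O x),
    ev_askRow ask O hx h3, ev_askRow ask O hx h4, ev_askRow ask O hx h6, ev_askRow ask O hx h8,
    ev_askGrid ask O hx h2 hn, ev_askGrid ask O hx h5 ht, ev_askGrid ask O hx h7 hm, hm, hn, ht,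
    ev_ones, ev_ofNat]
  rfl

theorem ev_answers₁ (ask : Algo) (O) {p : Params} {x : Data} (hx : x.nth 0 = p.enc) :
    (answers₁ ask).ev O x =
      Idx.table fun i : Idx p => ask.ev O (.pair i.query₁.enc x) := by
  obtain ⟨h2, h3, h4, h5, h6, h7, h8⟩ := ev_counters O hx
  have hm : ((var 0).elt 0).ev O x = .unary p.m := by simp [hx, Params.enc]
  have hn : ((var 0).elt 1).ev O x = .unary p.n := by simp [hx, Params.enc]
  have ht : ((var 0).elt 3).ev O x = .unary p.t := by simp [hx, Params.enc]
  rw [answers₁, ev_lst]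
  simp only [List.map_cons, List.map_nil, ev_askRow ask O hx (ev_ofNat 0 O x),
    ev_askRow ask O hx h3, ev_askRow ask O hx h4, ev_askRow ask O hx h6, ev_askRow ask O hx h8,
    ev_askGrid ask O hx h2 hn, ev_askGrid ask O hx h5 ht, ev_askGrid ask O hx h7 hm, hm, hn, ht,
    ev_ones, ev_ofNat]
  rfl

end Algo

end

end SMM
namespace SMM

noncomputable section

/-! ### Uniform distributions and acceptance probabilities -/

theorem map_uniform_of_bijective {α β : Type} [Fintype α] [Nonempty α] [Fintype β] [Nonempty β]
    {f : α → β} (hf : Function.Bijective f) :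
    (PMF.uniformOfFintype α).map f = PMF.uniformOfFintype β := by
  classical
  ext b
  obtain ⟨a, rfl⟩ := hf.2 b
  rw [PMF.map_apply, tsum_eq_single a]
  · simp [Fintype.card_of_bijective hf]
  · intro a' ha'
    rw [if_neg fun h => ha' (hf.1 h).symm]

theorem uniform_prod {α β : Type} [Fintype α] [Nonempty α] [Fintype β] [Nonempty β] :
    (PMF.uniformOfFintype α).bind (fun a => (PMF.uniformOfFintype β).map fun b => (a, b)) =
      PMF.uniformOfFintype (α × β) := by
  classical
  ext ⟨a, b⟩
  rw [PMF.bind_apply, tsum_eq_single a]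
  · rw [PMF.map_apply, tsum_eq_single b]
    · simp [ENNReal.mul_inv]
    · intro b' hb'
      rw [if_neg fun h => hb' (Prod.ext_iff.1 h).2.symm]
  · intro a' ha'
    rw [PMF.map_apply]
    simp [Ne.symm ha']

/-- A part of a value that can be read and overwritten. -/
structure Lens (α β : Type) where
  get : α → β
  put : β → α → α
  get_put : ∀ b a, get (put b a) = b
  put_get : ∀ a, put (get a) a = a
  put_put : ∀ b b' a, put b (put b' a) = put b a

namespace Lens

theorem swap_bijective {α β : Type} (ℓ : Lens α β) : Function.Bijective fun x : β × α => (ℓ.get x.2,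
    ℓ.put x.1 x.2) :=
  Function.Involutive.bijective fun x => by simp [ℓ.get_put, ℓ.put_put, ℓ.put_get]

variable {α β : Type} [Fintype α] [Nonempty α] [Fintype β] [Nonempty β] (ℓ : Lens α β)

theorem bind_put : ((PMF.uniformOfFintype β).bind fun b =>
    (PMF.uniformOfFintype α).map (ℓ.put b)) = PMF.uniformOfFintype α := by
  have h1 : ((PMF.uniformOfFintype β).bind fun b => (PMF.uniformOfFintype α).map (ℓ.put b)) =
      (PMF.uniformOfFintype (β × α)).map (Prod.snd ∘ fun x => (ℓ.get x.2, ℓ.put x.1 x.2)) := by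
    rw [← uniform_prod, PMF.map_bind]
    simp only [PMF.map_comp]
    rfl
  rw [h1, ← PMF.map_comp, map_uniform_of_bijective ℓ.swap_bijective, ← uniform_prod, PMF.map_bind]
  simp only [PMF.map_comp]
  simp only [Function.comp_def, PMF.bind_const]
  exact PMF.map_id _

theorem map_get : (PMF.uniformOfFintype α).map ℓ.get = PMF.uniformOfFintype β := by
  conv_lhs => rw [← ℓ.bind_put]
  rw [PMF.map_bind]
  have h (b : β) : (PMF.uniformOfFintype α).map (fun _ => b) = PMF.pure b := PMF.map_const _ b
  simp only [PMF.map_comp, Function.comp_def, ℓ.get_put, h]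
  exact PMF.bind_pure _

end Lens

open Classical in
/-- The restriction of a dependent function along an injection. -/
def restrictLens {X I : Type} (R : X → Type) (e : I → X) (he : Function.Injective e) :
    Lens ((x : X) → R x) ((i : I) → R (e i)) where
  get g i := g (e i)
  put b g x := if h : ∃ i, e i = x then h.choose_spec ▸ b h.choose else g x
  get_put b g := by
    funext i
    have h : ∃ j, e j = e i := ⟨i, rfl⟩
    beta_reduce
    rw [dif_pos h]
    have key : ∀ (j : I) (hj : e j = e i), hj ▸ b j = b i := by
      intro j hj
      obtain rfl := he hj
      rfl
    exact key _ _
  put_get g := by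
    funext x
    by_cases h : ∃ i, e i = x
    · rw [dif_pos h]
      have key : ∀ (j : I) (hj : e j = x), hj ▸ g (e j) = g x := by
        rintro j rfl
        rfl
      exact key _ _
    · rw [dif_neg h]
  put_put b b' g := by
    funext x
    by_cases h : ∃ i, e i = x
    · simp only [dif_pos h]
    · simp only [dif_neg h]

theorem bind_pure_comp_eq {α β γ : Type} (μ : PMF α) (f : α → β) (g : β → γ) :
    (μ.bind fun a => PMF.pure (g (f a))) = (μ.map f).map g := by
  rw [PMF.map_comp]
  rfl

theorem accept_nonneg (μ : PMF Data) : 0 ≤ accept μ := ENNReal.toReal_nonneg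

theorem accept_le_one (μ : PMF Data) : accept μ ≤ 1 :=
  ENNReal.toReal_le_of_le_ofReal zero_le_one (by simpa using μ.coe_le_one _)

theorem abs_accept_sub_le_one (μ ν : PMF Data) : |accept μ - accept ν| ≤ 1 := by
  rw [abs_le]
  have := accept_nonneg μ; have := accept_nonneg ν
  have := accept_le_one μ; have := accept_le_one ν
  constructor <;> linarith

theorem accept_bind {Ω : Type} [Fintype Ω] (μ : PMF Ω) (f : Ω → PMF Data) :
    accept (μ.bind f) = ∑ ω, (μ ω).toReal * accept (f ω) := by
  rw [accept, PMF.bind_apply, tsum_fintype, ENNReal.toReal_sum]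
  · simp [accept, ENNReal.toReal_mul]
  · intro ω _
    exact ENNReal.mul_ne_top (μ.apply_ne_top _) ((f ω).apply_ne_top _)

theorem sum_toReal_eq_one {Ω : Type} [Fintype Ω] (μ : PMF Ω) : ∑ ω, (μ ω).toReal = 1 := by
  have h := μ.tsum_coe
  rw [tsum_fintype] at h
  rw [← ENNReal.toReal_sum fun ω _ => μ.apply_ne_top ω, h, ENNReal.toReal_one]

/-- A difference of acceptance probabilities is at most its largest value when a part of the
randomness is fixed. -/
theorem abs_accept_bind_sub_le {Ω : Type} [Fintype Ω] (μ : PMF Ω) (f g : Ω → PMF Data) {ε : ℝ}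
    (h : ∀ ω, |accept (f ω) - accept (g ω)| ≤ ε) :
    |accept (μ.bind f) - accept (μ.bind g)| ≤ ε := by
  rw [accept_bind, accept_bind, ← Finset.sum_sub_distrib]
  calc _ ≤ ∑ ω, |(μ ω).toReal * accept (f ω) - (μ ω).toReal * accept (g ω)| :=
        Finset.abs_sum_le_sum_abs _ _
    _ ≤ ∑ ω, (μ ω).toReal * ε := Finset.sum_le_sum fun ω _ => by
        rw [← mul_sub, abs_mul, abs_of_nonneg ENNReal.toReal_nonneg]
        exact mul_le_mul_of_nonneg_left (h ω) ENNReal.toReal_nonneg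
    _ = ε := by rw [← Finset.sum_mul, sum_toReal_eq_one, one_mul]

/-! ### Oracles for random functions -/

namespace Query

/-- A query as an element of the domain of the oracles of size `s`. -/
def toDom (q : Query) {s : ℕ} (h : q.Fits s) : Dom s :=
  (⟨q.ctr, h.ctr⟩, ⟨q.k, h.k⟩, ⟨q.b, h.b⟩, ⟨q.l, h.l⟩, ⟨q.L, h.L⟩)

theorem enc_injective : Function.Injective Query.enc := by
  intro q q' h
  have h0 := congrArg (fun z => (z.nth 0).toNat) h
  have h1 := congrArg (fun z => (z.nth 1).length) h
  have h2 := congrArg (fun z => (z.nth 2).length) h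
  have h3 := congrArg (fun z => (z.nth 3).length) h
  have h4 := congrArg (fun z => (z.nth 4).length) h
  simp only [enc, Data.nth_list_zero, Data.nth_list_succ, Data.length_unary, Data.toNat_nat] at *
  cases q; cases q'
  simp_all

end Query

theorem Dom.query_injective {s : ℕ} : Function.Injective (Dom.query (s := s)) := by
  rintro ⟨a, b, c, d, e⟩ ⟨a', b', c', d', e'⟩ h
  simp only [Dom.query, Query.mk.injEq] at h
  simp only [Prod.mk.injEq, Fin.ext_iff]
  exact h

theorem FinFun.oracle_query {s : ℕ} (g : FinFun s) (x : Dom s) :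
    g.oracle (Dom.query x).enc = Query.encValue (g x) := by
  have h : ∃ y : Dom s, (Dom.query y).enc = (Dom.query x).enc := ⟨x, rfl⟩
  rw [FinFun.oracle, dif_pos h]
  have key : ∀ y : Dom s, y = x → Query.encValue (g y) = Query.encValue (g x) := by
    rintro y rfl; rfl
  exact key _ (Dom.query_injective (Query.enc_injective h.choose_spec))

theorem Data.size_list_le (l : List Data) (M : ℕ) (h : ∀ a ∈ l, a.size ≤ M) :
    (Data.list l).size ≤ l.length * (M + 1) + 1 := by
  induction l with
  | nil => simp [Data.list, Data.size]
  | cons a l ih =>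
    have h1 := ih fun b hb => h b (List.mem_cons_of_mem _ hb)
    have h2 := h a List.mem_cons_self
    simp only [Data.list, Data.size, List.length_cons, Nat.add_mul]
    omega

theorem Data.size_ofFn_le {k : ℕ} (f : Fin k → Data) (M : ℕ) (h : ∀ i, (f i).size ≤ M) :
    (Data.list (List.ofFn f)).size ≤ k * (M + 1) + 1 := by
  have := Data.size_list_le (List.ofFn f) M fun a ha => by
    obtain ⟨i, rfl⟩ := List.mem_ofFn.1 ha
    exact h i
  simpa using this

theorem encPerm_size_le {k : ℕ} (s : Equiv.Perm (Fin k)) : (encPerm s).size ≤ k * (k + 2) + 1 :=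
  Data.size_ofFn_le _ (k + 1) fun i => by
    have := natSize_le_self (s i).val
    have := (s i).2
    simp only [Data.size]
    omega

theorem encVec_size_le {k L : ℕ} (x : Fin k → ZMod (2 ^ L)) :
    (encVec x).size ≤ k * (L + 2) + 1 :=
  Data.size_ofFn_le _ (L + 1) fun i =>
    Nat.succ_le_succ (Nat.size_le.2 (ZMod.val_lt (x i)))

theorem encMat_size_le {k d L : ℕ} (M : Matrix (Fin k) (Fin d) (ZMod (2 ^ L))) :
    (encMat M).size ≤ k * (d * (L + 2) + 2) + 1 :=
  Data.size_ofFn_le _ (d * (L + 2) + 1) fun _ => encVec_size_le _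

theorem bits_size_le {l : ℕ} (r : Fin l → Bool) : (Data.bits r).size ≤ l * 3 + 1 :=
  Data.size_ofFn_le _ 2 fun _ => by split_ifs <;> simp [Data.size]

theorem encValue_size_le {q : Query} {s : ℕ} (h : q.Fits s) (v : q.Range) :
    (Query.encValue v).size ≤ 3 * (s * (s + 3)) + 10 := by
  have key {a b : ℕ} (ha : a < s + 1) (hb : b ≤ s + 1) : a * (b + 2) + 1 ≤ s * (s + 3) + 1 :=
    Nat.add_le_add_right (Nat.mul_le_mul (by omega) (by omega)) 1
  have hk := h.k
  have hL := h.L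
  have h1 := (encPerm_size_le v.1).trans (key h.k hk.le)
  have h2 := (encVec_size_le (L := 1) v.2.1).trans (key h.b (by omega))
  have h3 := (encVec_size_le v.2.2).trans (key h.l hL.le)
  simp only [Query.encValue, Data.list, Data.size]
  simp
  omega

theorem FinFun.oracle_bound {s : ℕ} (g : FinFun s) :
    OracleBound g.oracle (3 * (s * (s + 3)) + 10) := by
  intro z
  unfold FinFun.oracle
  split_ifs with h
  · exact encValue_size_le ⟨h.choose.1.2, h.choose.2.1.2, h.choose.2.2.1.2, h.choose.2.2.2.1.2,
      h.choose.2.2.2.2.2⟩ _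
  · simp [Data.size]

/-! ### Replacing the pseudorandom function by a random function -/

/-- The queries under one of the two keys, and an algorithm that asks them all. -/
structure QueryFamily where
  query : {p : Params} → Idx p → Query
  injective : ∀ p, Function.Injective (query (p := p))
  fits : ∀ {p : Params} {N : ℕ}, p.enc.size ≤ N → ∀ i : Idx p, (query i).Fits (N ^ 2)
  answers : Algo → Algo
  ev_answers : ∀ (ask : Algo) (O) {p : Params} {x : Data}, x.nth 0 = p.enc →
    (answers ask).ev O x = Idx.table fun i : Idx p => ask.ev O (.pair (query i).enc x)

/-- The queries under the key of `P₀`. -/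
def queries₀ : QueryFamily where
  query := Idx.query₀
  injective _ := Idx.query₀_injective
  fits := Idx.query₀_fits
  answers := Algo.answers₀
  ev_answers ask O _ _ := Algo.ev_answers₀ ask O

/-- The queries under the key of `P₁`. -/
def queries₁ : QueryFamily where
  query := Idx.query₁
  injective _ := Idx.query₁_injective
  fits := Idx.query₁_fits
  answers := Algo.answers₁
  ev_answers ask O _ _ := Algo.ev_answers₁ ask O

namespace QueryFamily

variable (Q : QueryFamily)

/-- The answers to all queries of one run. -/
abbrev Values (p : Params) : Type := (i : Idx p) → (Q.query i).Range

/-- The answers to all queries of one run, encoded as one datum. -/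
def enc {p : Params} (v : Q.Values p) : Data := Idx.table fun i => Query.encValue (v i)

/-- The answers of a keyed function. -/
def ofKey (F : KeyedFunction) (p : Params) (lam : ℕ) (key : Fin lam → Bool) : Q.Values p :=
  fun i => F.fn lam key (Q.query i)

theorem map_uniform_finFun {p : Params} {s : ℕ} (h : ∀ i : Idx p, (Q.query i).Fits s) :
    (PMF.uniformOfFintype (FinFun s)).map
      (fun g => (fun i => g ((Q.query i).toDom (h i)) : Q.Values p)) =
    PMF.uniformOfFintype (Q.Values p) :=
  (restrictLens (fun x : Dom s => (Dom.query x).Range)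
    (fun i : Idx p => (Q.query i).toDom (h i)) fun _ _ hij => Q.injective p <| by
      have := congrArg Dom.query hij
      exact this).map_get

theorem accept_bind_run {p : Params} {s : ℕ} (h : ∀ i : Idx p, (Q.query i).Fits s)
    (T : Q.Values p → Data) (run : FinFun s → PMF Data)
    (hrun : ∀ g, run g = PMF.pure (T fun i => g ((Q.query i).toDom (h i)))) :
    accept ((PMF.uniformOfFintype (FinFun s)).bind run) =
      accept ((PMF.uniformOfFintype (Q.Values p)).map T) := by
  rw [← Q.map_uniform_finFun h, funext hrun]
  exact congrArg accept (bind_pure_comp_eq _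
    (fun g : FinFun s => (fun i => g ((Q.query i).toDom (h i)) : Q.Values p)) T)

/-- Computes the bit that an adversary outputs on the answers to all queries; the input is the
security parameter, a pair of the public parameters and of `z`, and an empty tape. -/
def attack (C : Algo) : Algo :=
  ((Algo.var 1).andThen (Algo.snd.pair (Q.answers (Algo.fst.andThen Algo.query)))).andThen
    (.ofProg C.prog C.polyTime)

theorem ev_attack (C : Algo) {s : ℕ} (g : FinFun s) {p : Params}
    (h : ∀ i : Idx p, (Q.query i).Fits s) (a z r : Data) :
    (Q.attack C).ev g.oracle (.list [a, .pair p.enc z, r]) =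
      C.ev Prog.noOracle (.pair z (Q.enc (p := p) fun i => g ((Q.query i).toDom (h i)))) := by
  rw [attack, Algo.ev_andThen, Algo.ev_ofProg, Algo.ev_andThen, Algo.ev_var, Data.nth_list_succ,
    Data.nth_list_zero, Algo.ev_pair, Q.ev_answers (p := p) _ _ rfl]
  simp only [Algo.ev_andThen, Algo.ev_fst, Algo.ev_query, Algo.ev_snd, Data.fst_pair, Data.snd_pair]
  have h1 : ∀ i : Idx p, g.oracle (Q.query i).enc =
      Query.encValue (q := Q.query i) (g ((Q.query i).toDom (h i))) :=
    fun i => g.oracle_query ((Q.query i).toDom (h i))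
  simp only [h1]
  rfl

/-- The advantage of the test `C` in distinguishing the answers of the keyed function from random
answers. -/
def advantage (F : KeyedFunction) (C : Algo) (lam : ℕ) (p : Params) (z : Data) : ℝ :=
  |accept ((coins lam).map fun key => C.ev Prog.noOracle (.pair z (Q.enc (Q.ofKey F p lam key)))) -
    accept ((PMF.uniformOfFintype (Q.Values p)).map fun v =>
      C.ev Prog.noOracle (.pair z (Q.enc v)))|

/-- The adversary that attacks the pseudorandom function with the test `C`, with a given choice of
the public parameters and of the input for each security parameter. The summand `11` is the size of
the encoding of the trivial parameters, so that such a choice always exists. -/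
def adversary (C : Algo) (q : Polynomial ℕ) (c : ℕ → Params × Data)
    (hc : ∀ lam, (c lam).1.enc.size ≤ q.eval lam + 11 ∧ (c lam).2.size ≤ q.eval lam + 11) :
    PRFAdversary where
  prog := (Q.attack C).prog
  advice lam := .pair (c lam).1.enc (c lam).2
  advice_poly := ⟨2 * q + 23, fun lam => by
    have := hc lam
    simp only [Data.size, Polynomial.eval_add, Polynomial.eval_mul, Polynomial.eval_ofNat]
    omega⟩
  tape := 0
  bound := (q + 11) ^ 2
  poly := by
    obtain ⟨P, hP⟩ := (Q.attack C).bound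
    refine ⟨P.comp (2 * Polynomial.X + 2 * q + 40 + (3 * ((q + 11) ^ 2 * ((q + 11) ^ 2 + 3)) + 10)),
      fun lam r g => (hP _ _ g.oracle_bound _).trans ?_⟩
    rw [Polynomial.eval_comp]
    apply natPoly_eval_mono
    have := hc lam
    have h1 := Data.unary_size lam
    have h2 := bits_size_le r
    simp only [Polynomial.eval_zero, zero_mul] at h2
    simp only [Data.list, Data.size, Polynomial.eval_add, Polynomial.eval_mul, Polynomial.eval_pow,
      Polynomial.eval_ofNat, Polynomial.eval_X, Nat.size_zero]
    omega

/-- If the keyed function is a secure pseudorandom function, then the advantage of a test is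
negligible, uniformly in the public parameters and in the input of the test. -/
theorem negligible_advantage {F : KeyedFunction} (hF : F.IsSecurePRF) (C : Algo)
    (q : Polynomial ℕ) : ∃ μ : ℕ → ℝ, Negligible μ ∧ ∀ lam p z, p.enc.size ≤ q.eval lam →
      z.size ≤ q.eval lam → Q.advantage F C lam p z ≤ μ lam := by
  -- A choice of the parameters that attains at least half of the largest advantage.
  have hex : ∀ lam, ∃ c : Params × Data,
      (c.1.enc.size ≤ q.eval lam + 11 ∧ c.2.size ≤ q.eval lam + 11) ∧
      ∀ p z, p.enc.size ≤ q.eval lam → z.size ≤ q.eval lam →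
        Q.advantage F C lam p z ≤ 2 * Q.advantage F C lam c.1 c.2 := by
    intro lam
    set T : Set ℝ := {r | ∃ p z, p.enc.size ≤ q.eval lam ∧ z.size ≤ q.eval lam ∧
      Q.advantage F C lam p z = r} with hT
    have hbdd : BddAbove T := ⟨1, by rintro _ ⟨p, z, -, -, rfl⟩; exact abs_accept_sub_le_one _ _⟩
    rcases le_or_gt (sSup T) 0 with h0 | h0
    · refine ⟨(⟨0, 0, 0, 0, 0⟩, .nat 0), ⟨?_, ?_⟩, fun p z hp hz => ?_⟩
      · simp [Params.enc_size_eq]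
      · simp [Data.size]
      · refine (le_csSup hbdd ⟨p, z, hp, hz, rfl⟩).trans (h0.trans ?_)
        exact mul_nonneg zero_le_two (abs_nonneg _)
    · have hne : T.Nonempty := by
        by_contra hne
        rw [Set.not_nonempty_iff_eq_empty.1 hne, Real.sSup_empty] at h0
        exact lt_irrefl _ h0
      obtain ⟨_, ⟨p, z, hp, hz, rfl⟩, hlt⟩ := exists_lt_of_lt_csSup hne (half_lt_self h0)
      refine ⟨(p, z), ⟨hp.trans (Nat.le_add_right _ _), hz.trans (Nat.le_add_right _ _)⟩,
        fun p' z' hp' hz' => ?_⟩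
      have := le_csSup hbdd ⟨p', z', hp', hz', rfl⟩
      simp only
      linarith
  choose c hc hmax using hex
  refine ⟨fun lam => 2 * Q.advantage F C lam (c lam).1 (c lam).2, ?_,
    fun lam p z hp hz => hmax lam p z hp hz⟩
  have hB := hF (Q.adversary C q c hc)
  have key : ∀ lam, |accept ((coins lam).bind fun key =>
        (Q.adversary C q c hc).run lam fun x => F.fn lam key (Dom.query x)) -
      accept ((PMF.uniformOfFintype (FinFun ((Q.adversary C q c hc).bound.eval lam))).bind fun g =>
        (Q.adversary C q c hc).run lam g)| = Q.advantage F C lam (c lam).1 (c lam).2 := by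
    intro lam
    have hs : (Q.adversary C q c hc).bound.eval lam = (q.eval lam + 11) ^ 2 := by
      simp [adversary]
    have hfit : ∀ i : Idx (c lam).1, (Q.query i).Fits ((Q.adversary C q c hc).bound.eval lam) := by
      rw [hs]
      exact Q.fits (hc lam).1
    have hrun : ∀ g : FinFun ((Q.adversary C q c hc).bound.eval lam),
        (Q.adversary C q c hc).run lam g = PMF.pure (C.ev Prog.noOracle (.pair (c lam).2
          (Q.enc (p := (c lam).1) fun i => g ((Q.query i).toDom (hfit i))))) := by
      intro g
      have := fun r : Fin ((Q.adversary C q c hc).tape.eval lam) → Bool =>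
        Q.ev_attack C g hfit (.unary lam) (c lam).2 (.bits r)
      rw [PRFAdversary.run]
      refine Eq.trans (congrArg (PMF.map · _) (funext this)) (PMF.map_const _ _)
    have h1 := Q.accept_bind_run hfit
      (fun v => C.ev Prog.noOracle (.pair (c lam).2 (Q.enc v))) _ hrun
    rw [h1]
    simp only [hrun]
    rfl
  have h2 := Asymptotics.SuperpolynomialDecay.const_mul hB 2
  refine h2.congr fun lam => ?_
  rw [key]

end QueryFamily

end

end SMM
namespace SMM

noncomputable section

/-! ### Arithmetic on encoded values -/

section Reading

/-- The encoding of an answer of the pseudorandom function. -/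
def encAns {k b l L : ℕ} (v : Equiv.Perm (Fin k) × (Fin b → ZMod 2) × (Fin l → ZMod (2 ^ L))) :
    Data := .list [encPerm v.1, encVec v.2.1, encVec v.2.2]

variable {k b l d L : ℕ}
  (v : Equiv.Perm (Fin k) × (Fin b → ZMod 2) × (Fin l → ZMod (2 ^ L)))

@[simp] theorem nth_encAns_zero : (encAns v).nth 0 = encPerm v.1 := rfl
@[simp] theorem nth_encAns_one : (encAns v).nth 1 = encVec v.2.1 := rfl
@[simp] theorem nth_encAns_two : (encAns v).nth 2 = encVec v.2.2 := rfl

@[simp] theorem nth_encPerm (s : Equiv.Perm (Fin k)) (i : Fin k) :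
    (encPerm s).nth i = .nat (s i).val := nth_encNats _ i

@[simp] theorem nth_encVec {N : ℕ} (x : Fin k → ZMod N) (i : Fin k) :
    (encVec x).nth i = .nat (x i).val := nth_encNats _ i

@[simp] theorem nth_encVec_zero {N : ℕ} (x : Fin (k + 1) → ZMod N) :
    (encVec x).nth 0 = .nat (x 0).val := nth_encVec x 0

@[simp] theorem nth_encVec_one {N : ℕ} (x : Fin (k + 2) → ZMod N) :
    (encVec x).nth 1 = .nat (x 1).val := nth_encVec x 1

@[simp] theorem nth_encVec_two {N : ℕ} (x : Fin (k + 3) → ZMod N) :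
    (encVec x).nth 2 = .nat (x 2).val := nth_encVec x 2

@[simp] theorem nth_encMat {N : ℕ} (M : Matrix (Fin k) (Fin d) (ZMod N)) (i : Fin k) :
    (encMat M).nth i = encVec (M i) := Data.nth_list_ofFn _ i

@[simp] theorem nth_list_ofFn' (f : Fin k → Data) (i : Fin k) :
    (Data.list (List.ofFn f)).nth i = f i := Data.nth_list_ofFn _ i

theorem mod_eq_val {e : ℕ} {x : ZMod (2 ^ L)} (h : (e : ZMod (2 ^ L)) = x) :
    Data.nat (e % 2 ^ L) = Data.nat x.val := by
  rw [← h, ZMod.val_natCast]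

theorem cast_two_pow_sub_one : ((2 ^ L - 1 : ℕ) : ZMod (2 ^ L)) = -1 := by
  rw [Nat.cast_sub Nat.one_le_two_pow, ZMod.natCast_self]
  simp

theorem tab_eq_encVec {N : ℕ} {f : ℕ → Data} {x : Fin k → ZMod N}
    (h : ∀ i : Fin k, f i = .nat (x i).val) : Data.tab k f = encVec x :=
  (Data.list_ofFn_eq_tab h).symm

theorem tab_eq_encMat {N : ℕ} {f : ℕ → Data} {M : Matrix (Fin k) (Fin d) (ZMod N)}
    (h : ∀ i : Fin k, f i = encVec (M i)) : Data.tab k f = encMat M :=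
  (Data.list_ofFn_eq_tab h).symm

theorem zmod_two_cases (x : ZMod 2) : x = 0 ∨ x = 1 := by
  revert x; decide

end Reading

theorem flatten_ofFn_singleton {α : Type} {k : ℕ} (f : Fin k → α) :
    (List.ofFn fun i => [f i]).flatten = List.ofFn f := by
  induction k with
  | zero => rfl
  | succ k ih => rw [List.ofFn_succ, List.flatten_cons, ih, List.ofFn_succ]; rfl

namespace Algo

/-! ### Linear maps -/

/-- Multiplies a matrix by the matrix whose entries `coef` computes. The input lists the numbers of
rows and of columns of the result, the modulus, the matrix, and its number of rows. -/
def linear (coef : Algo) : Algo :=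
  tab (var 0) (tab ((up 1).elt 1)
    (sum ((up 2).elt 4) (coef * (((up 3).elt 3).nth (var 0)).nth (var 1)) % (up 2).elt 2))

theorem ev_linear (O) {k l d L : ℕ} {coef : Algo} (M : Matrix (Fin k) (Fin l) (ZMod (2 ^ L)))
    (Y : Matrix (Fin l) (Fin d) (ZMod (2 ^ L)))
    (h : ∀ (y z : Data) (i : Fin k) (e : Fin l) (j : ℕ), (((coef.ev O (.pair (.nat e) (.pair (.nat
        j)
      (.pair (.nat i) (.list [y, z, .nat (2 ^ L), encMat Y, .unary l]))))).toNat : ℕ) :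
        ZMod (2 ^ L)) = M i e) :
    (linear coef).ev O (.list [.unary k, .unary d, .nat (2 ^ L), encMat Y, .unary l]) =
      encMat (M * Y) := by
  rw [linear, ev_tab]
  simp only [ev_var, Data.nth_list_zero, Data.length_unary]
  refine tab_eq_encMat fun i => ?_
  rw [ev_tab]
  simp only [ev_elt, ev_up_succ, ev_up_zero, Data.snd_pair, Data.nth_list_succ, Data.nth_list_zero,
    Data.length_unary]
  refine tab_eq_encVec fun j => ?_
  simp only [ev_mod, ev_sum, ev_elt, ev_up_succ, ev_up_zero, Data.snd_pair, Data.nth_list_succ,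
    Data.nth_list_zero, Data.length_unary, Data.toNat_nat]
  apply mod_eq_val
  rw [Finset.sum_range, Matrix.mul_apply, Nat.cast_sum]
  refine Finset.sum_congr rfl fun e _ => ?_
  rw [ev_mul, Data.toNat_nat, Nat.cast_mul, h]
  simp

/-! The entries of the matrices that are applied locally; the indices of the row and of the column
are the third and the first element of the input, and `-1` is the modulus minus `1`. -/

def diffCoef : Algo := eq (var 2) (var 0) + ((up 3).elt 2 - 1) * eq (var 0 + 1) (var 2)
def diffTCoef : Algo := eq (var 0) (var 2) + ((up 3).elt 2 - 1) * eq (var 2 + 1) (var 0)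
def sumCoef : Algo := lt (var 0) (var 2 + 1)
def sumTCoef : Algo := lt (var 2) (var 0 + 1)
def resizeCoef : Algo := eq (var 2) (var 0)

variable (O : Data → Data) {k l d L : ℕ} (Y : Matrix (Fin l) (Fin d) (ZMod (2 ^ L)))

theorem ev_linear_diff :
    (linear diffCoef).ev O (.list [.unary l, .unary d, .nat (2 ^ L), encMat Y, .unary l]) =
      encMat (diffMat (ZMod (2 ^ L)) l * Y) := by
  refine ev_linear O _ Y fun y z i e j => ?_
  simp only [diffCoef, diffMat, ev_add, ev_mul, ev_eq, ev_var, ev_elt, ev_sub, ev_ofNat, ev_up_succ,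
    ev_up_zero, Data.snd_pair, nth_pair_succ, nth_pair_zero, Data.toNat_nat, Data.nth_list_succ,
    Data.nth_list_zero, Nat.cast_add, Nat.cast_mul, Nat.cast_ite, Nat.cast_one, Nat.cast_zero,
    cast_two_pow_sub_one, Matrix.of_apply, ← Fin.ext_iff]
  by_cases h : i = e
  · subst h; simp
  · by_cases h' : e.val + 1 = i.val <;> simp [h, h']

theorem ev_linear_diffT :
    (linear diffTCoef).ev O (.list [.unary l, .unary d, .nat (2 ^ L), encMat Y, .unary l]) =
      encMat ((diffMat (ZMod (2 ^ L)) l)ᵀ * Y) := by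
  refine ev_linear O _ Y fun y z i e j => ?_
  simp only [diffTCoef, diffMat, ev_add, ev_mul, ev_eq, ev_var, ev_elt, ev_sub, ev_ofNat,
      ev_up_succ,
    ev_up_zero, Data.snd_pair, nth_pair_succ, nth_pair_zero, Data.toNat_nat, Data.nth_list_succ,
    Data.nth_list_zero, Nat.cast_add, Nat.cast_mul, Nat.cast_ite, Nat.cast_one, Nat.cast_zero,
    cast_two_pow_sub_one, Matrix.of_apply, Matrix.transpose_apply, ← Fin.ext_iff]
  by_cases h : e = i
  · subst h; simp
  · by_cases h' : i.val + 1 = e.val <;> simp [h, h']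

theorem ev_linear_sum :
    (linear sumCoef).ev O (.list [.unary l, .unary d, .nat (2 ^ L), encMat Y, .unary l]) =
      encMat (sumMat (ZMod (2 ^ L)) l * Y) := by
  refine ev_linear O _ Y fun y z i e j => ?_
  simp only [sumCoef, sumMat, ev_lt, ev_add, ev_var, ev_ofNat, nth_pair_succ, nth_pair_zero,
    Data.toNat_nat, Nat.lt_succ_iff, Nat.cast_ite, Nat.cast_one, Nat.cast_zero, Matrix.of_apply,
    Fin.le_def]

theorem ev_linear_sumT :
    (linear sumTCoef).ev O (.list [.unary l, .unary d, .nat (2 ^ L), encMat Y, .unary l]) =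
      encMat ((sumMat (ZMod (2 ^ L)) l)ᵀ * Y) := by
  refine ev_linear O _ Y fun y z i e j => ?_
  simp only [sumTCoef, sumMat, ev_lt, ev_add, ev_var, ev_ofNat, nth_pair_succ, nth_pair_zero,
    Data.toNat_nat, Nat.lt_succ_iff, Nat.cast_ite, Nat.cast_one, Nat.cast_zero, Matrix.of_apply,
    Matrix.transpose_apply, Fin.le_def]

theorem resize_eq_mul : resize k Y =
    (Matrix.of fun i e => if i.val = e.val then 1 else 0 :
      Matrix (Fin k) (Fin l) (ZMod (2 ^ L))) * Y := by
  ext i j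
  simp only [resize, Matrix.of_apply, Matrix.mul_apply, ite_mul, one_mul, zero_mul]
  split_ifs with h
  · rw [Finset.sum_eq_single ⟨i.val, h⟩]
    · simp
    · intro b _ hb
      rw [if_neg fun h' => hb (Fin.ext h'.symm)]
    · simp
  · rw [Finset.sum_eq_zero fun b _ => ?_]
    rw [if_neg]
    intro h'
    exact h (by rw [h']; exact b.2)

theorem ev_linear_resize :
    (linear resizeCoef).ev O (.list [.unary k, .unary d, .nat (2 ^ L), encMat Y, .unary l]) =
      encMat (resize k Y) := by
  rw [resize_eq_mul]
  refine ev_linear O _ Y fun y z i e j => ?_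
  simp only [resizeCoef, ev_eq, ev_var, nth_pair_succ, nth_pair_zero, Data.toNat_nat,
    Nat.cast_ite, Nat.cast_one, Nat.cast_zero, Matrix.of_apply]

/-! ### Shares of the owner of the sparse matrix -/

end Algo

section Shares₀

variable {k b l L : ℕ}

/-- The share of `P₀` after an oblivious permutation, as a function of its random values `g` and of
the difference `w` of the vector and of the mask of `P₁`. -/
def opShare₀ (s : Equiv.Perm (Fin k))
    (g : Equiv.Perm (Fin k) × (Fin b → ZMod 2) × (Fin k → ZMod (2 ^ L)))
    (w : Fin k → ZMod (2 ^ L)) : Fin k → ZMod (2 ^ L) :=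
  fun i => w (s⁻¹ i) + g.2.2 (g.1 (s⁻¹ i))

/-- The share of `P₀` after an oblivious selection, as a function of its random values `g` and of
the difference `w` of the number and of the mask of `P₁`. -/
def osmShare₀ (s : ZMod 2) (g : Equiv.Perm (Fin k) × (Fin 1 → ZMod 2) × (Fin 2 → ZMod (2 ^ L)))
    (w : ZMod (2 ^ L)) : ZMod (2 ^ L) :=
  bitMul s (w - g.2.2 0) + bitMul (s - g.2.1 0) (g.2.2 0) + bitSign (s - g.2.1 0) (g.2.2 1)

/-- The share of `P₀` after a multiplication, as a function of its random values `g` and of the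
differences `w` of the two factors and of the masks of `P₁`. -/
def mulShare₀ (g : Equiv.Perm (Fin k) × (Fin b → ZMod 2) × (Fin 3 → ZMod (2 ^ L)))
    (w : Fin 2 → ZMod (2 ^ L)) : ZMod (2 ^ L) :=
  (w 0 - g.2.2 0) * g.2.2 1 + (w 1 - g.2.2 1) * g.2.2 0 + g.2.2 2

end Shares₀

namespace Algo

/-- Computes `opShare₀` for all columns. The input lists the numbers of rows and columns, the
modulus, the permutation, the random values, and the masked values. -/
def opShare : Algo :=
  tab (var 0) (tab ((up 1).elt 1) (sum ((up 2).elt 0) (eq (((up 3).elt 3).nth (var 0)) (var 2) *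
    (((((up 3).elt 5).nth (var 1)).elt 2).nth (var 0) + ((((up 3).elt 4).nth (var 1)).elt 2).nth
      (((((up 3).elt 4).nth (var 1)).elt 0).nth (var 0)))) % (up 2).elt 2))

/-- Computes `osmShare₀` for all entries. The input lists the numbers of rows and columns, the
modulus, the number of selected rows, the random values, and the masked values. -/
def osmShare : Algo :=
  tab (var 0) (tab ((up 1).elt 1) ((lst [lt (var 1) ((up 2).elt 3),
    (((((up 2).elt 4).nth (var 1)).nth (var 0)).elt 1).elt 0,
    (((((up 2).elt 4).nth (var 1)).nth (var 0)).elt 2).elt 0,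
    (((((up 2).elt 4).nth (var 1)).nth (var 0)).elt 2).elt 1,
    (((((up 2).elt 5).nth (var 1)).nth (var 0)).elt 2).elt 0, (up 2).elt 2]).andThen
    ((var 0 * (var 4 + (var 5 - 1) * var 2) + ((var 0 + var 1) % 2) * var 2 +
      ((1 - (var 0 + var 1) % 2) * var 3 + ((var 0 + var 1) % 2) * ((var 5 - 1) * var 3))) %
        var 5)))

/-- Computes `mulShare₀` for all entries. The input is as for `opShare`; the fourth element is not
used. -/
def mulShare : Algo :=
  tab (var 0) (tab ((up 1).elt 1) ((lst [
    (((((up 2).elt 4).nth (var 1)).nth (var 0)).elt 2),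
    (((((up 2).elt 5).nth (var 1)).nth (var 0)).elt 2), (up 2).elt 2]).andThen
    ((((var 1).elt 0 + (var 2 - 1) * (var 0).elt 0) * (var 0).elt 1 +
      ((var 1).elt 1 + (var 2 - 1) * (var 0).elt 1) * (var 0).elt 0 + (var 0).elt 2) % var 2)))

variable (O : Data → Data) {k k' k'' b b' d L : ℕ}

theorem ev_opShare (s : Equiv.Perm (Fin k))
    (g : Fin d → Equiv.Perm (Fin k) × (Fin b → ZMod 2) × (Fin k → ZMod (2 ^ L)))
    (w : Fin d → Equiv.Perm (Fin k') × (Fin b' → ZMod 2) × (Fin k → ZMod (2 ^ L))) :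
    opShare.ev O (.list [.unary k, .unary d, .nat (2 ^ L), encPerm s,
      .list (List.ofFn fun j => encAns (g j)), .list (List.ofFn fun j => encAns (w j))]) =
      encMat (Matrix.of fun i j => opShare₀ s (g j) (w j).2.2 i) := by
  rw [opShare, ev_tab]
  simp only [ev_var, Data.nth_list_zero, Data.length_unary]
  refine tab_eq_encMat fun i => ?_
  rw [ev_tab]
  simp only [ev_elt, ev_up_succ, ev_up_zero, Data.snd_pair, Data.nth_list_succ, Data.nth_list_zero,
    Data.length_unary]
  refine tab_eq_encVec fun j => ?_
  simp only [ev_mod, ev_sum, ev_elt, ev_up_succ, ev_up_zero, Data.snd_pair, Data.nth_list_succ,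
    Data.nth_list_zero, Data.length_unary, Data.toNat_nat, ev_mul, ev_eq, ev_nth, ev_var,
    nth_pair_succ, nth_pair_zero, ev_add, Finset.sum_range, nth_encPerm, nth_list_ofFn',
    nth_encAns_two, nth_encAns_zero, nth_encVec, Matrix.of_apply]
  apply mod_eq_val
  rw [Nat.cast_sum, Finset.sum_eq_single (s⁻¹ i)]
  · simp [opShare₀]
  · intro e _ he
    rw [if_neg, zero_mul, Nat.cast_zero]
    intro h
    exact he (Equiv.Perm.eq_inv_iff_eq.2 (Fin.ext h))
  · simp

theorem ev_osmShare {r : ℕ}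
    (g : Fin k → Fin d → Equiv.Perm (Fin k') × (Fin 1 → ZMod 2) × (Fin 2 → ZMod (2 ^ L)))
    (w : Fin k → Fin d → Equiv.Perm (Fin k'') × (Fin b → ZMod 2) × (Fin 1 → ZMod (2 ^ L))) :
    osmShare.ev O (.list [.unary k, .unary d, .nat (2 ^ L), .nat r,
      .list (List.ofFn fun i => .list (List.ofFn fun j => encAns (g i j))),
      .list (List.ofFn fun i => .list (List.ofFn fun j => encAns (w i j)))]) =
      encMat (Matrix.of fun i j => osmShare₀ (selectors k r i) (g i j) ((w i j).2.2 0)) := by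
  rw [osmShare, ev_tab]
  simp only [ev_var, Data.nth_list_zero, Data.length_unary]
  refine tab_eq_encMat fun i => ?_
  rw [ev_tab]
  simp only [ev_elt, ev_up_succ, ev_up_zero, Data.snd_pair, Data.nth_list_succ, Data.nth_list_zero,
    Data.length_unary]
  refine tab_eq_encVec fun j => ?_
  rw [ev_andThen, ev_mod]
  simp only [ev_lst, List.map_cons, List.map_nil, ev_elt, ev_up_succ, ev_up_zero, Data.snd_pair,
    Data.nth_list_succ, Data.nth_list_zero, Data.toNat_nat, ev_mul, ev_nth, ev_var, ev_lt, ev_sub,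
    ev_mod, ev_ofNat, nth_pair_succ, nth_pair_zero, ev_add, nth_list_ofFn',
    nth_encAns_two, nth_encAns_one, nth_encVec_zero, nth_encVec_one, Matrix.of_apply]
  apply mod_eq_val
  simp only [Nat.cast_add, Nat.cast_mul, cast_two_pow_sub_one, ZMod.natCast_zmod_val]
  rcases zmod_two_cases ((g i j).2.1 0) with hb | hb <;> by_cases hr : i.val < r <;>
    simp [hb, hr, osmShare₀, selectors, bitMul, bitSign, ZMod.val_one]
  ring

theorem ev_mulShare (y : Data)
    (g : Fin k → Fin d → Equiv.Perm (Fin k') × (Fin b → ZMod 2) × (Fin 3 → ZMod (2 ^ L)))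
    (w : Fin k → Fin d → Equiv.Perm (Fin k'') × (Fin b' → ZMod 2) × (Fin 2 → ZMod (2 ^ L))) :
    mulShare.ev O (.list [.unary k, .unary d, .nat (2 ^ L), y,
      .list (List.ofFn fun i => .list (List.ofFn fun j => encAns (g i j))),
      .list (List.ofFn fun i => .list (List.ofFn fun j => encAns (w i j)))]) =
      encMat (Matrix.of fun i j => mulShare₀ (g i j) (w i j).2.2) := by
  rw [mulShare, ev_tab]
  simp only [ev_var, Data.nth_list_zero, Data.length_unary]
  refine tab_eq_encMat fun i => ?_
  rw [ev_tab]
  simp only [ev_elt, ev_up_succ, ev_up_zero, Data.snd_pair, Data.nth_list_succ, Data.nth_list_zero,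
    Data.length_unary]
  refine tab_eq_encVec fun j => ?_
  rw [ev_andThen, ev_mod]
  simp only [ev_lst, List.map_cons, List.map_nil, ev_elt, ev_up_succ, ev_up_zero, Data.snd_pair,
    Data.nth_list_succ, Data.nth_list_zero, Data.toNat_nat, ev_mul, ev_nth, ev_var, ev_sub,
    ev_ofNat, nth_pair_succ, nth_pair_zero, ev_add, nth_list_ofFn',
    nth_encAns_two, nth_encVec_zero, nth_encVec_one, nth_encVec_two, Matrix.of_apply]
  apply mod_eq_val
  simp only [Nat.cast_add, Nat.cast_mul, cast_two_pow_sub_one, ZMod.natCast_zmod_val, mulShare₀]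
  ring

/-! ### Messages to the owner of the sparse matrix -/

/-- The messages of `P₁` in the permutation of the columns of a matrix. The input lists the numbers
of rows and columns, the modulus, the masked values, and the share of `P₀`. -/
def opMsg : Algo :=
  tab (var 1) (tab ((up 1).elt 0) ((((((up 2).elt 3).nth (var 1)).elt 2).nth (var 0) +
    ((up 2).elt 2 - 1) * (((up 2).elt 4).nth (var 0)).nth (var 1)) % (up 2).elt 2))

/-- The messages of `P₁` in the selection of the rows of a matrix; the input is as for `opMsg`. -/
def osmMsg : Algo :=
  flat (var 0) (tab ((up 1).elt 1) (((((((up 2).elt 3).nth (var 1)).nth (var 0)).elt 2).elt 0 +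
    ((up 2).elt 2 - 1) * (((up 2).elt 4).nth (var 1)).nth (var 0)) % (up 2).elt 2))

/-- The messages of `P₁` in the multiplication of the rows of a matrix by weights; the input is as
for `opMsg`, with the weights at the end. -/
def mulMsg : Algo :=
  flat (var 0) (flat ((up 1).elt 1) (lst [
    ((((((up 2).elt 3).nth (var 1)).nth (var 0)).elt 2).elt 0 +
      ((up 2).elt 2 - 1) * ((up 2).elt 5).nth (var 1)) % (up 2).elt 2,
    ((((((up 2).elt 3).nth (var 1)).nth (var 0)).elt 2).elt 1 +
      ((up 2).elt 2 - 1) * (((up 2).elt 4).nth (var 1)).nth (var 0)) % (up 2).elt 2]))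

theorem ev_opMsg (w : Fin d → Equiv.Perm (Fin k') × (Fin b → ZMod 2) × (Fin k → ZMod (2 ^ L)))
    (Y : Matrix (Fin k) (Fin d) (ZMod (2 ^ L))) :
    opMsg.ev O (.list [.unary k, .unary d, .nat (2 ^ L),
      .list (List.ofFn fun j => encAns (w j)), encMat Y]) =
      .list (List.ofFn fun j => encVec fun e => (w j).2.2 e - Y e j) := by
  rw [opMsg, ev_tab]
  simp only [ev_var, Data.nth_list_succ, Data.nth_list_zero, Data.length_unary]
  refine (Data.list_ofFn_eq_tab fun j => ?_).symm
  rw [ev_tab]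
  simp only [ev_elt, ev_up_succ, ev_up_zero, Data.snd_pair, Data.nth_list_zero, Data.length_unary]
  refine tab_eq_encVec fun e => ?_
  simp only [ev_mod, ev_add, ev_mul, ev_sub, ev_elt, ev_up_succ, ev_up_zero, Data.snd_pair, ev_nth,
    ev_var, ev_ofNat, nth_pair_succ, nth_pair_zero, Data.nth_list_succ, Data.nth_list_zero,
    Data.toNat_nat, nth_list_ofFn', nth_encAns_two, nth_encVec, nth_encMat]
  apply mod_eq_val
  simp only [Nat.cast_add, Nat.cast_mul, cast_two_pow_sub_one, ZMod.natCast_zmod_val]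
  ring

theorem ev_osmMsg
    (w : Fin k → Fin d → Equiv.Perm (Fin k') × (Fin b → ZMod 2) × (Fin 1 → ZMod (2 ^ L)))
    (Y : Matrix (Fin k) (Fin d) (ZMod (2 ^ L))) :
    osmMsg.ev O (.list [.unary k, .unary d, .nat (2 ^ L),
      .list (List.ofFn fun i => .list (List.ofFn fun j => encAns (w i j))), encMat Y]) =
      .list (List.ofFn fun i => (List.ofFn fun j =>
        [Data.nat ((w i j).2.2 0 - Y i j).val]).flatten).flatten := by
  rw [osmMsg, ev_flat]
  simp only [ev_var, Data.nth_list_zero, Data.length_unary]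
  refine Data.flat_eq_list fun i => ?_
  rw [ev_tab, flatten_ofFn_singleton]
  simp only [ev_elt, ev_up_succ, ev_up_zero, Data.snd_pair, Data.nth_list_succ, Data.nth_list_zero,
    Data.length_unary]
  refine (Data.list_ofFn_eq_tab fun j => ?_).symm
  simp only [ev_mod, ev_add, ev_mul, ev_sub, ev_elt, ev_up_succ, ev_up_zero, Data.snd_pair, ev_nth,
    ev_var, ev_ofNat, nth_pair_succ, nth_pair_zero, Data.nth_list_succ, Data.nth_list_zero,
    Data.toNat_nat, nth_list_ofFn', nth_encAns_two, nth_encVec, nth_encVec_zero, nth_encMat]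
  apply mod_eq_val
  simp only [Nat.cast_add, Nat.cast_mul, cast_two_pow_sub_one, ZMod.natCast_zmod_val]
  ring

theorem ev_mulMsg
    (w : Fin k → Fin d → Equiv.Perm (Fin k') × (Fin b → ZMod 2) × (Fin 2 → ZMod (2 ^ L)))
    (Y : Matrix (Fin k) (Fin d) (ZMod (2 ^ L))) (c : Fin k → ZMod (2 ^ L)) :
    mulMsg.ev O (.list [.unary k, .unary d, .nat (2 ^ L),
      .list (List.ofFn fun i => .list (List.ofFn fun j => encAns (w i j))), encMat Y, encVec c]) =
      .list (List.ofFn fun i => (List.ofFn fun j => [Data.nat ((w i j).2.2 0 - c i).val,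
        .nat ((w i j).2.2 1 - Y i j).val]).flatten).flatten := by
  rw [mulMsg, ev_flat]
  simp only [ev_var, Data.nth_list_zero, Data.length_unary]
  refine Data.flat_eq_list fun i => ?_
  rw [ev_flat]
  simp only [ev_elt, ev_up_succ, ev_up_zero, Data.snd_pair, Data.nth_list_succ, Data.nth_list_zero,
    Data.length_unary]
  refine Data.flat_eq_list fun j => ?_
  simp only [ev_mod, ev_add, ev_mul, ev_sub, ev_elt, ev_up_succ, ev_up_zero, Data.snd_pair, ev_nth,
    ev_var, ev_ofNat, nth_pair_succ, nth_pair_zero, Data.nth_list_succ, Data.nth_list_zero,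
    Data.toNat_nat, nth_list_ofFn', nth_encAns_two, nth_encVec, nth_encVec_zero, nth_encVec_one,
    nth_encMat, ev_lst, List.map_cons, List.map_nil]
  congr 2
  · apply mod_eq_val
    simp only [Nat.cast_add, Nat.cast_mul, cast_two_pow_sub_one, ZMod.natCast_zmod_val]
    ring
  · congr 1
    apply mod_eq_val
    simp only [Nat.cast_add, Nat.cast_mul, cast_two_pow_sub_one, ZMod.natCast_zmod_val]
    ring

end Algo

end

end SMM
namespace SMM

noncomputable section

namespace Algo

/-! ### Masked values seen by the owner of the sparse matrix -/

/-- Subtracts the masks of `P₁` from the columns of a matrix. The input lists the numbers of rows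
and columns, the modulus, the matrix, and the answers that contain the masks. -/
def opMask₀ : Algo :=
  tab (var 1) (lst [(((up 1).elt 4).nth (var 0)).elt 0, (((up 1).elt 4).nth (var 0)).elt 1,
    tab ((up 1).elt 0) (((((up 2).elt 3).nth (var 0)).nth (var 1) +
      ((up 2).elt 2 - 1) * ((((up 2).elt 4).nth (var 1)).elt 2).nth (var 0)) % (up 2).elt 2)])

/-- Subtracts the masks of `P₁` from the entries of a matrix; the input is as for `opMask₀`. -/
def osmMask₀ : Algo :=
  tab (var 0) (tab ((up 1).elt 1) (lst [
    ((((up 2).elt 4).nth (var 1)).nth (var 0)).elt 0,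
    ((((up 2).elt 4).nth (var 1)).nth (var 0)).elt 1,
    lst [((((up 2).elt 3).nth (var 1)).nth (var 0) + ((up 2).elt 2 - 1) *
      (((((up 2).elt 4).nth (var 1)).nth (var 0)).elt 2).elt 0) % (up 2).elt 2]]))

/-- Subtracts the masks of `P₁` from the weights and from the entries of a matrix; the input is as
for `opMask₀`, with the weights at the end. -/
def mulMask₀ : Algo :=
  tab (var 0) (tab ((up 1).elt 1) (lst [
    ((((up 2).elt 4).nth (var 1)).nth (var 0)).elt 0,
    ((((up 2).elt 4).nth (var 1)).nth (var 0)).elt 1,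
    lst [(((up 2).elt 5).nth (var 1) + ((up 2).elt 2 - 1) *
      (((((up 2).elt 4).nth (var 1)).nth (var 0)).elt 2).elt 0) % (up 2).elt 2,
      ((((up 2).elt 3).nth (var 1)).nth (var 0) + ((up 2).elt 2 - 1) *
      (((((up 2).elt 4).nth (var 1)).nth (var 0)).elt 2).elt 1) % (up 2).elt 2]]))

/-- The messages of `P₁` in the last step. The input lists the numbers of rows and columns, the
modulus, the permutation and the random values of `P₀`, the columns of its output, and its share of
the matrix that is permuted. -/
def lastMsg₀ : Algo :=
  tab (var 1) (tab ((up 1).elt 0) ((((((up 2).elt 5).nth (var 1)).elt 2).nth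
      (((up 2).elt 3).nth (var 0)) + ((up 2).elt 2 - 1) *
    (((((up 2).elt 4).nth (var 1)).elt 2).nth ((((up 2).elt 4).nth (var 1)).elt 0 |>.nth (var 0)) +
      (((up 2).elt 6).nth (var 0)).nth (var 1))) % (up 2).elt 2))

variable (O : Data → Data) {k k' k'' b b' d L : ℕ}

theorem ev_opMask₀ (V : Matrix (Fin k) (Fin d) (ZMod (2 ^ L)))
    (w : Fin d → Equiv.Perm (Fin k') × (Fin b → ZMod 2) × (Fin k → ZMod (2 ^ L))) :
    opMask₀.ev O (.list [.unary k, .unary d, .nat (2 ^ L), encMat V,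
      .list (List.ofFn fun j => encAns (w j))]) =
      .list (List.ofFn fun j => encAns ((w j).1, (w j).2.1, fun e => V e j - (w j).2.2 e)) := by
  rw [opMask₀, ev_tab]
  simp only [ev_var, Data.nth_list_succ, Data.nth_list_zero, Data.length_unary]
  refine (Data.list_ofFn_eq_tab fun j => ?_).symm
  simp only [ev_lst, List.map_cons, List.map_nil, ev_tab, ev_elt, ev_up_succ, ev_up_zero,
    Data.snd_pair, Data.nth_list_succ, Data.nth_list_zero, Data.length_unary, ev_nth, ev_var,
    nth_pair_zero, Data.toNat_nat, nth_list_ofFn', nth_encAns_zero, nth_encAns_one]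
  refine congrArg (fun z => Data.list [encPerm (w j).1, encVec (w j).2.1, z])
    (tab_eq_encVec fun e => ?_)
  simp only [ev_mod, ev_add, ev_mul, ev_sub, ev_elt, ev_up_succ, ev_up_zero, Data.snd_pair, ev_nth,
    ev_var, ev_ofNat, nth_pair_succ, nth_pair_zero, Data.nth_list_succ, Data.nth_list_zero,
    Data.toNat_nat, nth_list_ofFn', nth_encAns_two, nth_encVec, nth_encMat]
  apply mod_eq_val
  simp only [Nat.cast_add, Nat.cast_mul, cast_two_pow_sub_one, ZMod.natCast_zmod_val]
  ring

theorem ev_osmMask₀ (V : Matrix (Fin k) (Fin d) (ZMod (2 ^ L)))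
    (w : Fin k → Fin d → Equiv.Perm (Fin k') × (Fin b → ZMod 2) × (Fin 1 → ZMod (2 ^ L))) :
    osmMask₀.ev O (.list [.unary k, .unary d, .nat (2 ^ L), encMat V,
      .list (List.ofFn fun i => .list (List.ofFn fun j => encAns (w i j)))]) =
      .list (List.ofFn fun i => .list (List.ofFn fun j =>
        encAns ((w i j).1, (w i j).2.1, fun _ : Fin 1 => V i j - (w i j).2.2 0))) := by
  rw [osmMask₀, ev_tab]
  simp only [ev_var, Data.nth_list_zero, Data.length_unary]
  refine (Data.list_ofFn_eq_tab fun i => ?_).symm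
  simp only [ev_tab, ev_elt, ev_up_succ, ev_up_zero, Data.snd_pair, Data.nth_list_succ,
    Data.nth_list_zero, Data.length_unary]
  refine (Data.list_ofFn_eq_tab fun j => ?_).symm
  simp only [ev_lst, List.map_cons, List.map_nil, ev_mod, ev_add, ev_mul, ev_sub, ev_elt,
    ev_up_succ, ev_up_zero, Data.snd_pair, ev_nth, ev_var, ev_ofNat, nth_pair_succ, nth_pair_zero,
    Data.nth_list_succ, Data.nth_list_zero, Data.toNat_nat, nth_list_ofFn', nth_encAns_zero,
    nth_encAns_one, nth_encAns_two, nth_encVec, nth_encVec_zero, nth_encMat]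
  rw [mod_eq_val (x := V i j - (w i j).2.2 0)]
  · rfl
  · simp only [Nat.cast_add, Nat.cast_mul, cast_two_pow_sub_one, ZMod.natCast_zmod_val]
    ring

theorem ev_mulMask₀ (V : Matrix (Fin k) (Fin d) (ZMod (2 ^ L)))
    (w : Fin k → Fin d → Equiv.Perm (Fin k') × (Fin b → ZMod 2) × (Fin 2 → ZMod (2 ^ L)))
    (c : Fin k → ZMod (2 ^ L)) :
    mulMask₀.ev O (.list [.unary k, .unary d, .nat (2 ^ L), encMat V,
      .list (List.ofFn fun i => .list (List.ofFn fun j => encAns (w i j))), encVec c]) =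
      .list (List.ofFn fun i => .list (List.ofFn fun j =>
        encAns ((w i j).1, (w i j).2.1, ![c i - (w i j).2.2 0, V i j - (w i j).2.2 1]))) := by
  rw [mulMask₀, ev_tab]
  simp only [ev_var, Data.nth_list_zero, Data.length_unary]
  refine (Data.list_ofFn_eq_tab fun i => ?_).symm
  simp only [ev_tab, ev_elt, ev_up_succ, ev_up_zero, Data.snd_pair, Data.nth_list_succ,
    Data.nth_list_zero, Data.length_unary]
  refine (Data.list_ofFn_eq_tab fun j => ?_).symm
  simp only [ev_lst, List.map_cons, List.map_nil, ev_mod, ev_add, ev_mul, ev_sub, ev_elt,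
    ev_up_succ, ev_up_zero, Data.snd_pair, ev_nth, ev_var, ev_ofNat, nth_pair_succ, nth_pair_zero,
    Data.nth_list_succ, Data.nth_list_zero, Data.toNat_nat, nth_list_ofFn', nth_encAns_zero,
    nth_encAns_one, nth_encAns_two, nth_encVec, nth_encVec_zero, nth_encVec_one, nth_encMat]
  rw [mod_eq_val (x := c i - (w i j).2.2 0), mod_eq_val (x := V i j - (w i j).2.2 1)]
  · rfl
  all_goals
    simp only [Nat.cast_add, Nat.cast_mul, cast_two_pow_sub_one, ZMod.natCast_zmod_val]
    ring

theorem ev_lastMsg₀ (s : Equiv.Perm (Fin k))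
    (g : Fin d → Equiv.Perm (Fin k) × (Fin b → ZMod 2) × (Fin k → ZMod (2 ^ L)))
    (w : Fin d → Equiv.Perm (Fin k') × (Fin b' → ZMod 2) × (Fin k → ZMod (2 ^ L)))
    (Y : Matrix (Fin k) (Fin d) (ZMod (2 ^ L))) :
    lastMsg₀.ev O (.list [.unary k, .unary d, .nat (2 ^ L), encPerm s,
      .list (List.ofFn fun j => encAns (g j)), .list (List.ofFn fun j => encAns (w j)),
      encMat Y]) =
      .list (List.ofFn fun j => encVec fun e =>
        (w j).2.2 (s e) - (g j).2.2 ((g j).1 e) - Y e j) := by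
  rw [lastMsg₀, ev_tab]
  simp only [ev_var, Data.nth_list_succ, Data.nth_list_zero, Data.length_unary]
  refine (Data.list_ofFn_eq_tab fun j => ?_).symm
  rw [ev_tab]
  simp only [ev_elt, ev_up_succ, ev_up_zero, Data.snd_pair, Data.nth_list_zero, Data.length_unary]
  refine tab_eq_encVec fun e => ?_
  simp only [ev_mod, ev_add, ev_mul, ev_sub, ev_elt, ev_up_succ, ev_up_zero, Data.snd_pair, ev_nth,
    ev_var, ev_ofNat, nth_pair_succ, nth_pair_zero, Data.nth_list_succ, Data.nth_list_zero,
    Data.toNat_nat, nth_list_ofFn', nth_encAns_zero, nth_encAns_two, nth_encVec, nth_encPerm,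
    nth_encMat]
  apply mod_eq_val
  simp only [Nat.cast_add, Nat.cast_mul, cast_two_pow_sub_one, ZMod.natCast_zmod_val]
  ring

/-! ### Values received by the owner of the dense matrix -/

/-- Composes the permutation with the inverses of the permutations of `P₀`, and computes the values
that the dealer sends to `P₁`. The input lists the numbers of rows and columns, the modulus, the
permutation, and the random values of `P₀` and of `P₁`. -/
def opMask₁ : Algo :=
  tab (var 1) (lst [
    (lst [(up 1).elt 3, (((up 1).elt 4).nth (var 0)).elt 0]).andThen compInv,
    (((up 1).elt 4).nth (var 0)).elt 1,
    tab ((up 1).elt 0) ((((lst [(((up 2).elt 5).nth (var 1)).elt 2,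
        (((up 2).elt 4).nth (var 1)).elt 0]).andThen compInv).nth (var 0) + ((up 2).elt 2 - 1) *
      ((((up 2).elt 4).nth (var 1)).elt 2).nth (var 0)) % (up 2).elt 2)])

/-- The values that `P₁` receives in the selection of the rows of a matrix, together with the random
value `u₀` of `P₀`. The input is as for `opMask₁`, with the number of selected rows in place of the
permutation. -/
def osmMask₁ : Algo :=
  tab (var 0) (tab ((up 1).elt 1) ((lst [
    (((up 2).elt 4).nth (var 1)).nth (var 0), (((up 2).elt 5).nth (var 1)).nth (var 0),
    lt (var 1) ((up 2).elt 3), (up 2).elt 2]).andThen (lst [(var 0).elt 0,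
      lst [(var 2 + ((var 0).elt 1).elt 0) % 2],
      lst [((var 0).elt 2).elt 0, (((var 0).elt 1).elt 0 * (((var 0).elt 2).elt 0 +
        ((var 1).elt 2).elt 0) + (var 3 - 1) * ((var 0).elt 2).elt 1) % var 3]])))

/-- The values that `P₁` receives in the multiplication of the rows of a matrix by weights. The
input is as for `opMask₁`, with the weights in place of the permutation, and with the matrix and the
share of `P₁` at the end. -/
def mulMask₁ : Algo :=
  tab (var 0) (tab ((up 1).elt 1) ((lst [
    (((up 2).elt 4).nth (var 1)).nth (var 0), (((up 2).elt 5).nth (var 1)).nth (var 0),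
    ((up 2).elt 3).nth (var 1), (((up 2).elt 6).nth (var 1)).nth (var 0),
    (((up 2).elt 7).nth (var 1)).nth (var 0), (up 2).elt 2]).andThen
      (lst [(var 0).elt 0, (var 0).elt 1,
        lst [(var 2 + (var 5 - 1) * ((var 0).elt 2).elt 0) % var 5,
          (var 3 + (var 5 - 1) * (var 4 + ((var 0).elt 2).elt 1)) % var 5,
          ((((var 0).elt 2).elt 0 + ((var 1).elt 2).elt 0) *
            (((var 0).elt 2).elt 1 + ((var 1).elt 2).elt 1) +
              (var 5 - 1) * ((var 0).elt 2).elt 2) % var 5]])))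

/-- The share of `P₁` after the permutation of the columns of a matrix. The input lists the numbers
of rows and columns, and the values received by `P₁`. -/
def opShare₁ : Algo :=
  tab (var 0) (tab ((up 1).elt 1) (((lst [(((up 2).elt 2).nth (var 0)).elt 2,
    (((up 2).elt 2).nth (var 0)).elt 0]).andThen compInv).nth (var 1)))

/-- The messages received by `P₁` in the permutation of the columns of a matrix; the input is as for
`opShare₁`. -/
def opMsg₁ : Algo :=
  flat (var 1) (lst [(((up 1).elt 2).nth (var 0)).elt 2, (((up 1).elt 2).nth (var 0)).elt 0])

/-- The messages received by `P₁` in the selection of the rows of a matrix; the input is as for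
`opShare₁`. -/
def osmMsg₁ : Algo :=
  flat (var 0) (flat ((up 1).elt 1) (lst [
    (((((up 2).elt 2).nth (var 1)).nth (var 0)).elt 2).elt 1,
    (((((up 2).elt 2).nth (var 1)).nth (var 0)).elt 1).elt 0]))

/-- The messages received by `P₁` in the multiplication of the rows of a matrix by weights; the
input is as for `opShare₁`. -/
def mulMsg₁ : Algo :=
  flat (var 0) (flat ((up 1).elt 1) (lst [
    (((((up 2).elt 2).nth (var 1)).nth (var 0)).elt 2).elt 2,
    (((((up 2).elt 2).nth (var 1)).nth (var 0)).elt 2).elt 0,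
    (((((up 2).elt 2).nth (var 1)).nth (var 0)).elt 2).elt 1]))

/-- The messages received by `P₁` in the last step, computed from the columns of its output; the
input is as for `opShare₁`. -/
def lastMsg₁ : Algo :=
  flat (var 1) (lst [tab ((up 1).elt 0) (((((up 2).elt 2).nth (var 1)).elt 2).nth
    (((((up 2).elt 2).nth (var 1)).elt 0).nth (var 0))), (((up 1).elt 2).nth (var 0)).elt 0])

theorem ev_compInv_encPerm (s u : Equiv.Perm (Fin k)) :
    compInv.ev O (.list [encPerm s, encPerm u]) = encPerm (s * u⁻¹) := ev_compInv O _ u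

theorem ev_compInv_encVec (x : Fin k → ZMod (2 ^ L)) (s : Equiv.Perm (Fin k)) :
    compInv.ev O (.list [encVec x, encPerm s]) = encVec (act s x) := ev_compInv O _ s

theorem ev_opMask₁ (s : Equiv.Perm (Fin k))
    (g : Fin d → Equiv.Perm (Fin k) × (Fin b → ZMod 2) × (Fin k → ZMod (2 ^ L)))
    (w : Fin d → Equiv.Perm (Fin k') × (Fin b' → ZMod 2) × (Fin k → ZMod (2 ^ L))) :
    opMask₁.ev O (.list [.unary k, .unary d, .nat (2 ^ L), encPerm s,
      .list (List.ofFn fun j => encAns (g j)), .list (List.ofFn fun j => encAns (w j))]) =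
      .list (List.ofFn fun j => encAns (s * (g j).1⁻¹, (g j).2.1,
        act (g j).1 (w j).2.2 - (g j).2.2)) := by
  rw [opMask₁, ev_tab]
  simp only [ev_var, Data.nth_list_succ, Data.nth_list_zero, Data.length_unary]
  refine (Data.list_ofFn_eq_tab fun j => ?_).symm
  simp only [ev_lst, List.map_cons, List.map_nil, ev_tab, ev_elt, ev_up_succ, ev_up_zero,
    Data.snd_pair, Data.nth_list_succ, Data.nth_list_zero, Data.length_unary, ev_nth, ev_var,
    nth_pair_zero, Data.toNat_nat, nth_list_ofFn', nth_encAns_zero, nth_encAns_one, ev_andThen,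
        ev_compInv_encPerm]
  refine congrArg (fun z => Data.list [encPerm (s * (g j).1⁻¹), encVec (g j).2.1, z])
    (tab_eq_encVec fun e => ?_)
  simp only [ev_mod, ev_add, ev_mul, ev_sub, ev_elt, ev_up_succ, ev_up_zero, Data.snd_pair, ev_nth,
    ev_var, ev_ofNat, nth_pair_succ, nth_pair_zero, Data.nth_list_succ, Data.nth_list_zero,
    Data.toNat_nat, nth_list_ofFn', nth_encAns_two, nth_encAns_zero, nth_encVec, ev_andThen, ev_lst,
    List.map_cons, List.map_nil, ev_compInv_encVec]
  apply mod_eq_val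
  simp only [Nat.cast_add, Nat.cast_mul, cast_two_pow_sub_one, ZMod.natCast_zmod_val, Pi.sub_apply]
  ring

theorem ev_osmMask₁ {r : ℕ}
    (g : Fin k → Fin d → Equiv.Perm (Fin k') × (Fin 1 → ZMod 2) × (Fin 2 → ZMod (2 ^ L)))
    (w : Fin k → Fin d → Equiv.Perm (Fin k'') × (Fin b → ZMod 2) × (Fin 1 → ZMod (2 ^ L))) :
    osmMask₁.ev O (.list [.unary k, .unary d, .nat (2 ^ L), .nat r,
      .list (List.ofFn fun i => .list (List.ofFn fun j => encAns (g i j))),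
      .list (List.ofFn fun i => .list (List.ofFn fun j => encAns (w i j)))]) =
      .list (List.ofFn fun i => .list (List.ofFn fun j => encAns ((g i j).1,
        fun _ : Fin 1 => selectors k r i - (g i j).2.1 0, ![(g i j).2.2 0,
          bitMul ((g i j).2.1 0) ((g i j).2.2 0 + (w i j).2.2 0) - (g i j).2.2 1]))) := by
  rw [osmMask₁, ev_tab]
  simp only [ev_var, Data.nth_list_zero, Data.length_unary]
  refine (Data.list_ofFn_eq_tab fun i => ?_).symm
  simp only [ev_tab, ev_elt, ev_up_succ, ev_up_zero, Data.snd_pair, Data.nth_list_succ,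
    Data.nth_list_zero, Data.length_unary]
  refine (Data.list_ofFn_eq_tab fun j => ?_).symm
  simp only [ev_andThen, ev_lst, List.map_cons, List.map_nil, ev_elt, ev_up_succ, ev_up_zero,
    Data.snd_pair, Data.nth_list_succ, Data.nth_list_zero, Data.toNat_nat, ev_mul, ev_nth, ev_var,
    ev_lt, ev_sub, ev_mod, ev_ofNat, nth_pair_succ, nth_pair_zero, ev_add, nth_list_ofFn',
    nth_encAns_zero, nth_encAns_two, nth_encAns_one, nth_encVec_zero, nth_encVec_one]
  rw [mod_eq_val (x := bitMul ((g i j).2.1 0) ((g i j).2.2 0 + (w i j).2.2 0) - (g i j).2.2 1)]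
  · have h : ((if i.val < r then 1 else 0) + ((g i j).2.1 0).val) % 2 =
        (selectors k r i - (g i j).2.1 0).val := by
      rcases zmod_two_cases ((g i j).2.1 0) with hb | hb <;> by_cases hr : i.val < r <;>
        simp [hb, hr, selectors, ZMod.val_one]
    rw [h]
    rfl
  · simp only [Nat.cast_add, Nat.cast_mul, cast_two_pow_sub_one, ZMod.natCast_zmod_val]
    rcases zmod_two_cases ((g i j).2.1 0) with hb | hb <;>
      simp [hb, bitMul, ZMod.val_one]
    ring

theorem ev_mulMask₁ (c : Fin k → ZMod (2 ^ L))
    (g : Fin k → Fin d → Equiv.Perm (Fin k') × (Fin b → ZMod 2) × (Fin 3 → ZMod (2 ^ L)))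
    (w : Fin k → Fin d → Equiv.Perm (Fin k'') × (Fin b' → ZMod 2) × (Fin 2 → ZMod (2 ^ L)))
    (V Y : Matrix (Fin k) (Fin d) (ZMod (2 ^ L))) :
    mulMask₁.ev O (.list [.unary k, .unary d, .nat (2 ^ L), encVec c,
      .list (List.ofFn fun i => .list (List.ofFn fun j => encAns (g i j))),
      .list (List.ofFn fun i => .list (List.ofFn fun j => encAns (w i j))), encMat V, encMat Y]) =
      .list (List.ofFn fun i => .list (List.ofFn fun j => encAns ((g i j).1, (g i j).2.1,
        ![c i - (g i j).2.2 0, V i j - Y i j - (g i j).2.2 1,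
          ((g i j).2.2 0 + (w i j).2.2 0) * ((g i j).2.2 1 + (w i j).2.2 1) - (g i j).2.2 2]))) :=
              by
  rw [mulMask₁, ev_tab]
  simp only [ev_var, Data.nth_list_zero, Data.length_unary]
  refine (Data.list_ofFn_eq_tab fun i => ?_).symm
  simp only [ev_tab, ev_elt, ev_up_succ, ev_up_zero, Data.snd_pair, Data.nth_list_succ,
    Data.nth_list_zero, Data.length_unary]
  refine (Data.list_ofFn_eq_tab fun j => ?_).symm
  simp only [ev_andThen, ev_lst, List.map_cons, List.map_nil, ev_elt, ev_up_succ, ev_up_zero,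
    Data.snd_pair, Data.nth_list_succ, Data.nth_list_zero, Data.toNat_nat, ev_mul, ev_nth, ev_var,
    ev_sub, ev_mod, ev_ofNat, nth_pair_succ, nth_pair_zero, ev_add, nth_list_ofFn', nth_encMat,
    nth_encVec, nth_encAns_zero, nth_encAns_two, nth_encAns_one, nth_encVec_zero, nth_encVec_one,
    nth_encVec_two]
  rw [mod_eq_val (x := c i - (g i j).2.2 0), mod_eq_val (x := V i j - Y i j - (g i j).2.2 1),
    mod_eq_val (x := ((g i j).2.2 0 + (w i j).2.2 0) * ((g i j).2.2 1 + (w i j).2.2 1) -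
      (g i j).2.2 2)]
  · rfl
  all_goals
    simp only [Nat.cast_add, Nat.cast_mul, cast_two_pow_sub_one, ZMod.natCast_zmod_val]
    ring

theorem ev_opShare₁
    (w : Fin d → Equiv.Perm (Fin k) × (Fin b → ZMod 2) × (Fin k → ZMod (2 ^ L))) :
    opShare₁.ev O (.list [.unary k, .unary d, .list (List.ofFn fun j => encAns (w j))]) =
      encMat (Matrix.of fun i j => act (w j).1 (w j).2.2 i) := by
  rw [opShare₁, ev_tab]
  simp only [ev_var, Data.nth_list_zero, Data.length_unary]
  refine tab_eq_encMat fun i => ?_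
  simp only [ev_tab, ev_elt, ev_up_succ, ev_up_zero, Data.snd_pair, Data.nth_list_succ,
    Data.nth_list_zero, Data.length_unary]
  refine tab_eq_encVec fun j => ?_
  simp only [ev_andThen, ev_lst, List.map_cons, List.map_nil, ev_elt, ev_up_succ, ev_up_zero,
    Data.snd_pair, Data.nth_list_succ, Data.nth_list_zero, Data.toNat_nat, ev_nth, ev_var,
    nth_pair_succ, nth_pair_zero, nth_list_ofFn', nth_encAns_zero, nth_encAns_two,
    ev_compInv_encVec, nth_encVec, Matrix.of_apply]

theorem ev_opMsg₁ (y : Data)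
    (w : Fin d → Equiv.Perm (Fin k) × (Fin b → ZMod 2) × (Fin k' → ZMod (2 ^ L))) :
    opMsg₁.ev O (.list [y, .unary d, .list (List.ofFn fun j => encAns (w j))]) =
      .list (List.ofFn fun j => [encVec (w j).2.2, encPerm (w j).1]).flatten := by
  rw [opMsg₁, ev_flat]
  simp only [ev_var, Data.nth_list_succ, Data.nth_list_zero, Data.length_unary]
  refine Data.flat_eq_list fun j => ?_
  simp

theorem ev_osmMsg₁
    (w : Fin k → Fin d → Equiv.Perm (Fin k') × (Fin 1 → ZMod 2) × (Fin 2 → ZMod (2 ^ L))) :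
    osmMsg₁.ev O (.list [.unary k, .unary d,
      .list (List.ofFn fun i => .list (List.ofFn fun j => encAns (w i j)))]) =
      .list (List.ofFn fun i => (List.ofFn fun j =>
        [Data.nat ((w i j).2.2 1).val, .nat ((w i j).2.1 0).val]).flatten).flatten := by
  rw [osmMsg₁, ev_flat]
  simp only [ev_var, Data.nth_list_zero, Data.length_unary]
  refine Data.flat_eq_list fun i => ?_
  simp only [ev_flat, ev_elt, ev_up_succ, ev_up_zero, Data.snd_pair, Data.nth_list_succ,
    Data.nth_list_zero, Data.length_unary]
  refine Data.flat_eq_list fun j => ?_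
  simp

theorem ev_mulMsg₁
    (w : Fin k → Fin d → Equiv.Perm (Fin k') × (Fin b → ZMod 2) × (Fin 3 → ZMod (2 ^ L))) :
    mulMsg₁.ev O (.list [.unary k, .unary d,
      .list (List.ofFn fun i => .list (List.ofFn fun j => encAns (w i j)))]) =
      .list (List.ofFn fun i => (List.ofFn fun j => [Data.nat ((w i j).2.2 2).val,
        .nat ((w i j).2.2 0).val, .nat ((w i j).2.2 1).val]).flatten).flatten := by
  rw [mulMsg₁, ev_flat]
  simp only [ev_var, Data.nth_list_zero, Data.length_unary]
  refine Data.flat_eq_list fun i => ?_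
  simp only [ev_flat, ev_elt, ev_up_succ, ev_up_zero, Data.snd_pair, Data.nth_list_succ,
    Data.nth_list_zero, Data.length_unary]
  refine Data.flat_eq_list fun j => ?_
  simp

theorem ev_lastMsg₁
    (w : Fin d → Equiv.Perm (Fin k) × (Fin b → ZMod 2) × (Fin k → ZMod (2 ^ L))) :
    lastMsg₁.ev O (.list [.unary k, .unary d, .list (List.ofFn fun j => encAns (w j))]) =
      .list (List.ofFn fun j =>
        [encVec fun e => (w j).2.2 ((w j).1 e), encPerm (w j).1]).flatten := by
  rw [lastMsg₁, ev_flat]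
  simp only [ev_var, Data.nth_list_succ, Data.nth_list_zero, Data.length_unary]
  refine Data.flat_eq_list fun j => ?_
  simp only [ev_lst, List.map_cons, List.map_nil, ev_tab, ev_elt, ev_up_succ, ev_up_zero,
    Data.snd_pair, Data.nth_list_succ, Data.nth_list_zero, Data.length_unary, ev_nth, ev_var,
    nth_pair_zero, nth_pair_succ, Data.toNat_nat, nth_list_ofFn', nth_encAns_zero]
  congr 2
  refine tab_eq_encVec fun e => ?_
  simp

/-! ### The output as part of a table -/

/-- Subtracts a matrix from a matrix. The input lists the numbers of rows and columns, the modulus,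
and the two matrices. -/
def subMat : Algo :=
  tab (var 0) (tab ((up 1).elt 1) (((((up 2).elt 4).nth (var 1)).nth (var 0) +
    ((up 2).elt 2 - 1) * (((up 2).elt 3).nth (var 1)).nth (var 0)) % (up 2).elt 2))

theorem ev_subMat (Y Z : Matrix (Fin k) (Fin d) (ZMod (2 ^ L))) :
    subMat.ev O (.list [.unary k, .unary d, .nat (2 ^ L), encMat Y, encMat Z]) =
      encMat (Z - Y) := by
  rw [subMat, ev_tab]
  simp only [ev_var, Data.nth_list_zero, Data.length_unary]
  refine tab_eq_encMat fun i => ?_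
  simp only [ev_tab, ev_elt, ev_up_succ, ev_up_zero, Data.snd_pair, Data.nth_list_succ,
    Data.nth_list_zero, Data.length_unary]
  refine tab_eq_encVec fun j => ?_
  simp only [ev_mod, ev_add, ev_mul, ev_sub, ev_elt, ev_up_succ, ev_up_zero, Data.snd_pair, ev_nth,
    ev_var, ev_ofNat, nth_pair_succ, nth_pair_zero, Data.nth_list_succ, Data.nth_list_zero,
    Data.toNat_nat, nth_encVec, nth_encMat]
  apply mod_eq_val
  simp only [Nat.cast_add, Nat.cast_mul, cast_two_pow_sub_one, ZMod.natCast_zmod_val,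
    Matrix.sub_apply]
  ring

end Algo

/-- Replaces the last components of the answers in the last step. -/
def Idx.setLast {p : Params} (c : Fin p.d → Data) (h : Idx p → Data) : Idx p → Data
  | .op8 j => .list [(h (.op8 j)).nth 0, (h (.op8 j)).nth 1, c j]
  | i => h i

namespace Algo

/-- Replaces the last components of the answers in the last step by the columns of a matrix. The
input lists the public parameters, the table, and the matrix. -/
def setLast : Algo :=
  lst [(var 1).elt 0, (var 1).elt 1, (var 1).elt 2, (var 1).elt 3, (var 1).elt 4, (var 1).elt 5,
    (var 1).elt 6, tab ((var 0).elt 2) (lst [((((up 1).elt 1).elt 7).nth (var 0)).elt 0,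
      ((((up 1).elt 1).elt 7).nth (var 0)).elt 1,
      tab (((up 1).elt 0).elt 0) ((((up 2).elt 2).nth (var 0)).nth (var 1))])]

/-- Reads the matrix whose columns are the last components of the answers in the last step. The
input lists the public parameters and the table. -/
def getLast : Algo :=
  tab ((var 0).elt 0) (tab (((up 1).elt 0).elt 2)
    ((((((up 2).elt 1).elt 7).nth (var 0)).elt 2).nth (var 1)))

variable (O : Data → Data) {p : Params}

theorem ev_setLast (h : Idx p → Data) (Y : Matrix (Fin p.m) (Fin p.d) p.R) :
    setLast.ev O (.list [p.enc, Idx.table h, encMat Y]) =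
      Idx.table (Idx.setLast (fun j => encVec fun e => Y e j) h) := by
  have h2 : p.enc.nth 2 = .unary p.d := rfl
  have h0 : p.enc.nth 0 = .unary p.m := rfl
  have h8 : (Idx.table h).nth 7 = .list (List.ofFn fun j => h (.op8 j)) := rfl
  have key : (tab ((var 0).elt 2) (lst [((((up 1).elt 1).elt 7).nth (var 0)).elt 0,
      ((((up 1).elt 1).elt 7).nth (var 0)).elt 1,
      tab (((up 1).elt 0).elt 0) ((((up 2).elt 2).nth (var 0)).nth (var 1))])).ev O
        (.list [p.enc, Idx.table h, encMat Y]) = .list (List.ofFn fun j =>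
          Idx.setLast (fun j => encVec fun e => Y e j) h (.op8 j)) := by
    simp only [ev_tab, ev_elt, ev_var, Data.nth_list_zero, h2, Data.length_unary]
    refine (Data.list_ofFn_eq_tab fun j => ?_).symm
    simp only [ev_lst, List.map_cons, List.map_nil, ev_tab, ev_elt, ev_up_succ, ev_up_zero,
      Data.snd_pair, Data.nth_list_succ, Data.nth_list_zero, Data.length_unary, ev_nth, ev_var,
      nth_pair_zero, nth_pair_succ, Data.toNat_nat, nth_list_ofFn', h8, h0, Idx.setLast]
    refine congrArg (fun z => Data.list [_, _, z]) (tab_eq_encVec fun e => ?_)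
    simp
  rw [setLast, ev_lst]
  simp only [List.map_cons, List.map_nil, key]
  rfl

theorem ev_getLast {h : Idx p → Data} {Y : Matrix (Fin p.m) (Fin p.d) p.R}
    (hY : ∀ j, (h (.op8 j)).nth 2 = encVec fun e => Y e j) :
    getLast.ev O (.list [p.enc, Idx.table h]) = encMat Y := by
  have h2 : p.enc.nth 2 = .unary p.d := rfl
  have h0 : p.enc.nth 0 = .unary p.m := rfl
  have h8 : (Idx.table h).nth 7 = .list (List.ofFn fun j => h (.op8 j)) := rfl
  rw [getLast, ev_tab]
  simp only [ev_elt, ev_var, Data.nth_list_zero, h0, Data.length_unary]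
  refine tab_eq_encMat fun i => ?_
  simp only [ev_tab, ev_elt, ev_up_succ, ev_up_zero, Data.snd_pair,
    Data.nth_list_zero, Data.length_unary, h2]
  refine tab_eq_encVec fun j => ?_
  simp only [ev_elt, ev_up_succ, ev_up_zero, Data.snd_pair, ev_nth, ev_var, nth_pair_succ,
    nth_pair_zero, Data.nth_list_succ, Data.nth_list_zero, Data.toNat_nat, h8, nth_list_ofFn', hY,
    nth_encVec]

end Algo

end

end SMM
namespace SMM

noncomputable section

/-! ### Correctness of the subprotocols -/

theorem perm_inv_apply_self {k : ℕ} (s : Equiv.Perm (Fin k)) (e : Fin k) : s⁻¹ (s e) = e :=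
  s.symm_apply_apply e

section Rows

variable {k l d L : ℕ}

/-- The permutation of the rows of a matrix. -/
def permRows (s : Equiv.Perm (Fin k)) (Y : Matrix (Fin k) (Fin d) (ZMod (2 ^ L))) :
    Matrix (Fin k) (Fin d) (ZMod (2 ^ L)) := Matrix.of fun i j => Y (s⁻¹ i) j

/-- The selection of the first `r` rows of a matrix. -/
def selRows (r : ℕ) (Y : Matrix (Fin k) (Fin d) (ZMod (2 ^ L))) :
    Matrix (Fin k) (Fin d) (ZMod (2 ^ L)) := Matrix.of fun i j => bitMul (selectors k r i) (Y i j)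

/-- The multiplication of the rows of a matrix by weights. -/
def scaleRows (c : Fin k → ZMod (2 ^ L)) (Y : Matrix (Fin k) (Fin d) (ZMod (2 ^ L))) :
    Matrix (Fin k) (Fin d) (ZMod (2 ^ L)) := Matrix.of fun i j => c i * Y i j

variable (Y Z : Matrix (Fin k) (Fin d) (ZMod (2 ^ L)))

theorem permMat_mul_eq (s : Equiv.Perm (Fin k)) : permMat (ZMod (2 ^ L)) s * Y = permRows s Y := by
  ext i j
  rw [permMat_mul_apply]
  rfl

theorem diagonal_mul_eq (c : Fin k → ZMod (2 ^ L)) : Matrix.diagonal c * Y = scaleRows c Y := by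
  ext i j
  rw [Matrix.diagonal_mul]
  rfl

theorem bitMul_selectors (r : ℕ) (i : Fin k) (x : ZMod (2 ^ L)) :
    bitMul (selectors k r i) x = if i.val < r then x else 0 := by
  by_cases h : i.val < r <;> simp [bitMul, selectors, h]

theorem gammaMat_mul_eq_resize_selRows (r : ℕ) :
    gammaMat (ZMod (2 ^ L)) l k r * Y = resize l (selRows r Y) := by
  ext i j
  simp only [Matrix.mul_apply, gammaMat, resize, selRows, Matrix.of_apply, bitMul_selectors,
    ite_mul, one_mul, zero_mul]
  split_ifs with h1 h2
  · rw [Finset.sum_eq_single ⟨i.val, h1⟩]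
    · simp [h2]
    · intro b _ hb
      rw [if_neg]
      exact fun h' => hb (Fin.ext h'.1.symm)
    · simp
  · exact Finset.sum_eq_zero fun b _ => if_neg fun h => h2 h.2
  · refine Finset.sum_eq_zero fun b _ => if_neg fun h => h1 ?_
    rw [h.1]
    exact b.2

theorem gammaMat_mul_eq_selRows_resize (r : ℕ) :
    gammaMat (ZMod (2 ^ L)) l k r * Y = selRows r (resize l Y) := by
  rw [gammaMat_mul_eq_resize_selRows]
  ext i j
  simp only [resize, selRows, Matrix.of_apply, bitMul_selectors]
  split_ifs <;> rfl

theorem resize_add : resize l (Y + Z) = resize l Y + resize l Z := by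
  ext i j
  simp only [resize, Matrix.of_apply, Matrix.add_apply]
  split_ifs <;> simp

end Rows

section Subprotocols

variable {k d L : ℕ} (G₀ G₁ : Rand) (ctr : ℕ)

/-- The share of `P₀` depends on the input shares and on the mask of `P₁` only through the
difference of the shared vector and of the mask. -/
theorem op_share₀ (s : Equiv.Perm (Fin k)) (x₀ : Option (Fin k → ZMod (2 ^ L)))
    (x₁ : Fin k → ZMod (2 ^ L)) : (op G₀ G₁ ctr s x₀ x₁).share₀ =
      opShare₀ s (G₀ ⟨ctr, k, 0, k, L⟩)
        fun e => (x₀.elim 0 id + x₁) e - (G₁ ⟨ctr, 0, 0, k, L⟩).2.2 e := by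
  funext i
  cases x₀ <;> simp [op, opShare₀, act]
  ring

theorem op_share_add (s : Equiv.Perm (Fin k)) (x₀ : Option (Fin k → ZMod (2 ^ L)))
    (x₁ : Fin k → ZMod (2 ^ L)) : (op G₀ G₁ ctr s x₀ x₁).share₀ + (op G₀ G₁ ctr s x₀ x₁).share₁ =
      act s (x₀.elim 0 id + x₁) := by
  funext i
  cases x₀ <;> simp [op, act]
  ring

theorem osm_share₀ (s : ZMod 2) (x₀ x₁ : ZMod (2 ^ L)) : (osm G₀ G₁ ctr s x₀ x₁).share₀ =
      osmShare₀ s (G₀ ⟨ctr, 0, 1, 2, L⟩) (x₀ + x₁ - (G₁ ⟨ctr, 0, 0, 1, L⟩).2.2 0) := by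
  have h : x₀ + x₁ - (G₁ ⟨ctr, 0, 0, 1, L⟩).2.2 0 - (G₀ ⟨ctr, 0, 1, 2, L⟩).2.2 0 =
    x₀ - (G₀ ⟨ctr, 0, 1, 2, L⟩).2.2 0 + (x₁ - (G₁ ⟨ctr, 0, 0, 1, L⟩).2.2 0) := by ring
  simp only [osm, osmShare₀, h]

theorem osm_share_add (s : ZMod 2) (x₀ x₁ : ZMod (2 ^ L)) :
    (osm G₀ G₁ ctr s x₀ x₁).share₀ + (osm G₀ G₁ ctr s x₀ x₁).share₁ = bitMul s (x₀ + x₁) := by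
  simp only [osm]
  generalize (G₀ ⟨ctr, 0, 1, 2, L⟩).2.1 0 = b
  have h10 : (1 : ZMod 2) - 0 = 1 := rfl
  have h01 : (0 : ZMod 2) - 1 = 1 := rfl
  rcases zmod_two_cases s with rfl | rfl <;> rcases zmod_two_cases b with rfl | rfl <;>
    simp only [h10, h01, sub_self, bitMul, bitSign, if_true, zero_ne_one, if_false] <;> ring

theorem beaver_share₀ (x₀ y₀ x₁ y₁ : ZMod (2 ^ L)) : (beaver G₀ G₁ ctr x₀ y₀ x₁ y₁).share₀ =
      mulShare₀ (G₀ ⟨ctr, 0, 0, 3, L⟩) ![x₀ + x₁ - (G₁ ⟨ctr, 0, 0, 2, L⟩).2.2 0,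
        y₀ + y₁ - (G₁ ⟨ctr, 0, 0, 2, L⟩).2.2 1] := by
  simp only [beaver, mulShare₀, Matrix.cons_val_zero, Matrix.cons_val_one]
  ring

theorem beaver_share_add (x₀ y₀ x₁ y₁ : ZMod (2 ^ L)) :
    (beaver G₀ G₁ ctr x₀ y₀ x₁ y₁).share₀ + (beaver G₀ G₁ ctr x₀ y₀ x₁ y₁).share₁ =
      (x₀ + x₁) * (y₀ + y₁) := by
  simp only [beaver]
  ring

theorem opMat_share_add (s : Equiv.Perm (Fin k))
    (Y₀ : Option (Matrix (Fin k) (Fin d) (ZMod (2 ^ L))))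
    (Y₁ : Matrix (Fin k) (Fin d) (ZMod (2 ^ L))) :
    (opMat G₀ G₁ ctr s Y₀ Y₁).share₀ + (opMat G₀ G₁ ctr s Y₀ Y₁).share₁ =
      permRows s (Y₀.elim 0 id + Y₁) := by
  ext i j
  have := congrFun (op_share_add G₀ G₁ (ctr + j) s (Y₀.map fun Y i => Y i j) fun i => Y₁ i j) i
  cases Y₀ <;> exact this

theorem osmMat_share_add (r : ℕ) (Y₀ Y₁ : Matrix (Fin k) (Fin d) (ZMod (2 ^ L))) :
    (osmMat G₀ G₁ ctr (selectors k r) Y₀ Y₁).share₀ +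
      (osmMat G₀ G₁ ctr (selectors k r) Y₀ Y₁).share₁ = selRows r (Y₀ + Y₁) := by
  ext i j
  exact osm_share_add ..

theorem beaverMat_share_add (c : Fin k → ZMod (2 ^ L))
    (Y₀ Y₁ : Matrix (Fin k) (Fin d) (ZMod (2 ^ L))) :
    (beaverMat G₀ G₁ ctr c Y₀ Y₁).share₀ + (beaverMat G₀ G₁ ctr c Y₀ Y₁).share₁ =
      scaleRows c (Y₀ + Y₁) := by
  ext i j
  refine (beaver_share_add ..).trans ?_
  rw [add_zero]
  rfl

theorem opMat_share₀ (s : Equiv.Perm (Fin k))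
    {Y₀ : Option (Matrix (Fin k) (Fin d) (ZMod (2 ^ L)))}
    {Y₁ V : Matrix (Fin k) (Fin d) (ZMod (2 ^ L))} (hV : Y₀.elim 0 id + Y₁ = V) :
    (opMat G₀ G₁ ctr s Y₀ Y₁).share₀ = Matrix.of fun (i : Fin k) (j : Fin d) =>
      opShare₀ s (G₀ ⟨ctr + j, k, 0, k, L⟩)
        (fun e => V e j - (G₁ ⟨ctr + j, 0, 0, k, L⟩).2.2 e) i := by
  subst hV
  ext i j
  have := congrFun (op_share₀ G₀ G₁ (ctr + j) s (Y₀.map fun Y i => Y i j) fun i => Y₁ i j) i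
  cases Y₀ <;> exact this

theorem opMat_recv₀ (s : Equiv.Perm (Fin k))
    {Y₀ : Option (Matrix (Fin k) (Fin d) (ZMod (2 ^ L)))}
    {Y₁ V : Matrix (Fin k) (Fin d) (ZMod (2 ^ L))} (hV : Y₀.elim 0 id + Y₁ = V) :
    (opMat G₀ G₁ ctr s Y₀ Y₁).recv₀ = List.ofFn fun j : Fin d => encVec fun e =>
      V e j - (G₁ ⟨ctr + j, 0, 0, k, L⟩).2.2 e - (Y₀.elim 0 id : Matrix _ _ _) e j := by
  subst hV
  rw [← flatten_ofFn_singleton]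
  refine congrArg List.flatten (congrArg List.ofFn (funext fun j => ?_))
  refine congrArg (fun x => [encVec x]) (funext fun e => ?_)
  simp only [Pi.sub_apply, Matrix.add_apply]
  ring

theorem osmMat_share₀ (r : ℕ) {Y₀ Y₁ V : Matrix (Fin k) (Fin d) (ZMod (2 ^ L))}
    (hV : Y₀ + Y₁ = V) :
    (osmMat G₀ G₁ ctr (selectors k r) Y₀ Y₁).share₀ = Matrix.of fun (i : Fin k) (j : Fin d) =>
      osmShare₀ (selectors k r i) (G₀ ⟨ctr + (i * d + j), 0, 1, 2, L⟩)
        (V i j - (G₁ ⟨ctr + (i * d + j), 0, 0, 1, L⟩).2.2 0) := by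
  subst hV
  ext i j
  exact osm_share₀ ..

theorem osmMat_recv₀ (r : ℕ) {Y₀ Y₁ V : Matrix (Fin k) (Fin d) (ZMod (2 ^ L))}
    (hV : Y₀ + Y₁ = V) :
    (osmMat G₀ G₁ ctr (selectors k r) Y₀ Y₁).recv₀ = (List.ofFn fun i : Fin k => (List.ofFn fun j :
        Fin d =>
      [Data.nat (V i j - (G₁ ⟨ctr + (i * d + j), 0, 0, 1, L⟩).2.2 0 - Y₀ i j).val]).flatten).flatten
    := by
  subst hV
  refine congrArg List.flatten (congrArg List.ofFn (funext fun i => ?_))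
  refine congrArg List.flatten (congrArg List.ofFn (funext fun j => ?_))
  refine congrArg (fun x : ZMod (2 ^ L) => [Data.nat x.val]) ?_
  simp only [Matrix.add_apply]
  ring

theorem beaverMat_share₀ (c : Fin k → ZMod (2 ^ L))
    {Y₀ Y₁ V : Matrix (Fin k) (Fin d) (ZMod (2 ^ L))} (hV : Y₀ + Y₁ = V) :
    (beaverMat G₀ G₁ ctr c Y₀ Y₁).share₀ = Matrix.of fun (i : Fin k) (j : Fin d) =>
      mulShare₀ (G₀ ⟨ctr + (i * d + j), 0, 0, 3, L⟩)
        ![c i - (G₁ ⟨ctr + (i * d + j), 0, 0, 2, L⟩).2.2 0,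
          V i j - (G₁ ⟨ctr + (i * d + j), 0, 0, 2, L⟩).2.2 1] := by
  subst hV
  ext i j
  refine (beaver_share₀ ..).trans ?_
  rw [add_zero]
  rfl

theorem beaverMat_recv₀ (c : Fin k → ZMod (2 ^ L))
    {Y₀ Y₁ V : Matrix (Fin k) (Fin d) (ZMod (2 ^ L))} (hV : Y₀ + Y₁ = V) :
    (beaverMat G₀ G₁ ctr c Y₀ Y₁).recv₀ = (List.ofFn fun i : Fin k => (List.ofFn fun j : Fin d =>
      [Data.nat (c i - (G₁ ⟨ctr + (i * d + j), 0, 0, 2, L⟩).2.2 0 - c i).val,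
        .nat (V i j - (G₁ ⟨ctr + (i * d + j), 0, 0, 2, L⟩).2.2 1 - Y₀ i j).val]).flatten).flatten
    := by
  subst hV
  refine congrArg List.flatten (congrArg List.ofFn (funext fun i => ?_))
  refine congrArg List.flatten (congrArg List.ofFn (funext fun j => ?_))
  refine congrArg₂ (fun x y : ZMod (2 ^ L) => [Data.nat x.val, .nat y.val]) ?_ ?_
  · simp only
    ring
  · simp only [Matrix.add_apply]
    ring

end Subprotocols

/-! ### The protocol as a function of masked values -/

variable {p : Params}

namespace Decomp

variable (D : Decomp p) (X : Matrix (Fin p.n) (Fin p.d) p.R)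

/-! The matrices that the parties share before the steps that need communication. -/

def val2 : Matrix (Fin p.n) (Fin p.d) p.R := diffMat p.R p.n * permRows D.s1 X
def val3 : Matrix (Fin p.t) (Fin p.d) p.R := resize p.t (selRows D.ncol (D.val2 X))
def val4 : Matrix (Fin p.t) (Fin p.d) p.R := sumMat p.R p.t * permRows D.s2 (D.val3 X)
def val5 : Matrix (Fin p.t) (Fin p.d) p.R := permRows D.s3 (D.val4 X)
def val6 : Matrix (Fin p.t) (Fin p.d) p.R := (sumMat p.R p.t)ᵀ * scaleRows D.weights (D.val5 X)
def val7 : Matrix (Fin p.m) (Fin p.d) p.R := resize p.m (permRows D.s4 (D.val6 X))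
def val8 : Matrix (Fin p.m) (Fin p.d) p.R := (diffMat p.R p.m)ᵀ * selRows D.nrow (D.val7 X)

theorem product_mul : D.product * X = permRows D.s5 (D.val8 X) := by
  simp only [val8, val7, val6, val5, val4, val3, val2, ← gammaMat_mul_eq_resize_selRows,
    ← gammaMat_mul_eq_selRows_resize, ← permMat_mul_eq, ← diagonal_mul_eq, product,
    Matrix.mul_assoc]

end Decomp

/-- The answers of the pseudorandom function in a given format. -/
abbrev Answer (k b l L : ℕ) : Type :=
  Equiv.Perm (Fin k) × (Fin b → ZMod 2) × (Fin l → ZMod (2 ^ L))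

/-- The answers to the queries of one run under the key of `P₀`. -/
abbrev Values₀ (p : Params) : Type := queries₀.Values p

/-- The answers to the queries of one run under the key of `P₁`. -/
abbrev Values₁ (p : Params) : Type := queries₁.Values p

section Party₀

/-- Subtracts the mask in an answer from a vector. -/
def maskVec {k b l L : ℕ} (x : Fin l → ZMod (2 ^ L)) (v : Answer k b l L) : Answer k b l L :=
  (v.1, v.2.1, fun e => x e - v.2.2 e)

variable (D : Decomp p) (X : Matrix (Fin p.n) (Fin p.d) p.R) (g : Values₀ p) (w : Values₁ p)

/-- The masked values: in each instance the mask of `P₁` is subtracted from the shared value. In the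
last step they are replaced by the output of `P₀`, which they determine. -/
def masked₀ (v : Values₁ p) : Values₁ p
  | .op1 j => maskVec (fun e => X e j) (v (.op1 j))
  | .osm2 i j => maskVec (fun _ : Fin 1 => D.val2 X i j) (v (.osm2 i j))
  | .op3 j => maskVec (fun e => D.val3 X e j) (v (.op3 j))
  | .op4 j => maskVec (fun e => D.val4 X e j) (v (.op4 j))
  | .mul5 i j => maskVec ![D.weights i, D.val5 X i j] (v (.mul5 i j))
  | .op6 j => maskVec (fun e => D.val6 X e j) (v (.op6 j))
  | .osm7 i j => maskVec (fun _ : Fin 1 => D.val7 X i j) (v (.osm7 i j))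
  | .op8 j => ((v (.op8 j)).1, (v (.op8 j)).2.1, opShare₀ D.s5 (g (.op8 j))
      (maskVec (fun e => D.val8 X e j) (v (.op8 j))).2.2)

theorem opShare₀_apply {k b L : ℕ} (s : Equiv.Perm (Fin k)) (g : Answer k b k L)
    (x : Fin k → ZMod (2 ^ L)) (e : Fin k) :
    opShare₀ s g x (s e) - g.2.2 (g.1 e) = x e := by
  simp only [opShare₀, perm_inv_apply_self, add_sub_cancel_right]

/-! The shares of `P₀` as functions of its random values and of the masked values. -/

def share1 : Matrix (Fin p.n) (Fin p.d) p.R :=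
  Matrix.of fun i j => opShare₀ D.s1 (g (.op1 j)) (w (.op1 j)).2.2 i
def share2 : Matrix (Fin p.n) (Fin p.d) p.R :=
  Matrix.of fun i j => osmShare₀ (selectors p.n D.ncol i) (g (.osm2 i j)) ((w (.osm2 i j)).2.2 (0 :
      Fin 1))
def share3 : Matrix (Fin p.t) (Fin p.d) p.R :=
  Matrix.of fun i j => opShare₀ D.s2 (g (.op3 j)) (w (.op3 j)).2.2 i
def share4 : Matrix (Fin p.t) (Fin p.d) p.R :=
  Matrix.of fun i j => opShare₀ D.s3 (g (.op4 j)) (w (.op4 j)).2.2 i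
def share5 : Matrix (Fin p.t) (Fin p.d) p.R :=
  Matrix.of fun i j => mulShare₀ (g (.mul5 i j)) (w (.mul5 i j)).2.2
def share6 : Matrix (Fin p.t) (Fin p.d) p.R :=
  Matrix.of fun i j => opShare₀ D.s4 (g (.op6 j)) (w (.op6 j)).2.2 i
def share7 : Matrix (Fin p.m) (Fin p.d) p.R :=
  Matrix.of fun i j => osmShare₀ (selectors p.m D.nrow i) (g (.osm7 i j)) ((w (.osm7 i j)).2.2 (0 :
      Fin 1))

/-- The messages of `P₁` in the permutation of the columns of a matrix. -/
def opRecv₀ {k d b l L : ℕ}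
    (w : Fin d → Answer b l k L)
    (Y : Matrix (Fin k) (Fin d) (ZMod (2 ^ L))) : List Data :=
  List.ofFn fun j => encVec fun e => (w j).2.2 e - Y e j

/-- The messages of `P₁` in the selection of the rows of a matrix. -/
def osmRecv₀ {k d b l L : ℕ}
    (w : Fin k → Fin d → Answer b l 1 L)
    (Y : Matrix (Fin k) (Fin d) (ZMod (2 ^ L))) : List Data :=
  (List.ofFn fun i => (List.ofFn fun j =>
    [Data.nat ((w i j).2.2 0 - Y i j).val]).flatten).flatten

/-- The messages of `P₁` in the multiplication of the rows of a matrix by weights. -/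
def mulRecv₀ {k d b l L : ℕ} (w : Fin k → Fin d → Answer b l 2 L) (c : Fin k → ZMod (2 ^ L))
    (Y : Matrix (Fin k) (Fin d) (ZMod (2 ^ L))) : List Data :=
  (List.ofFn fun i => (List.ofFn fun j =>
    [Data.nat ((w i j).2.2 0 - c i).val, .nat ((w i j).2.2 1 - Y i j).val]).flatten).flatten

/-- The messages of `P₁` in the last step, as a function of the output of `P₀`. -/
def lastRecv₀ {k d b l b' L : ℕ} (s : Equiv.Perm (Fin k)) (g : Fin d → Answer k b k L)
    (w : Fin d → Answer b' l k L) (Y : Matrix (Fin k) (Fin d) (ZMod (2 ^ L))) : List Data :=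
  List.ofFn fun j => encVec fun e =>
    (w j).2.2 (s e) - (g j).2.2 ((g j).1 e) - Y e j

/-- The messages to `P₀` as a function of its random values and of the masked values. -/
def messages₀ : List Data :=
  opRecv₀ (fun j => w (.op1 j)) (0 : Matrix (Fin p.n) (Fin p.d) p.R) ++
  osmRecv₀ (fun i j => w (.osm2 i j)) (diffMat p.R p.n * share1 D g w) ++
  opRecv₀ (fun j => w (.op3 j)) (resize p.t (share2 D g w)) ++
  opRecv₀ (fun j => w (.op4 j)) (sumMat p.R p.t * share3 D g w) ++
  mulRecv₀ (fun i j => w (.mul5 i j)) D.weights (share4 D g w) ++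
  opRecv₀ (fun j => w (.op6 j)) ((sumMat p.R p.t)ᵀ * share5 g w) ++
  osmRecv₀ (fun i j => w (.osm7 i j)) (resize p.m (share6 D g w)) ++
  lastRecv₀ D.s5 (fun j => g (.op8 j)) (fun j => w (.op8 j)) ((diffMat p.R p.m)ᵀ * share7 D g w)

end Party₀

section Party₁

variable (D : Decomp p) (X : Matrix (Fin p.n) (Fin p.d) p.R) (v : Values₁ p) (w : Values₀ p)

/-- The share of `P₁` after an oblivious permutation, as a function of the values that it receives.
-/
def shareOf {k b L : ℕ} (w : Answer k b k L) : Fin k → ZMod (2 ^ L) := act w.1 w.2.2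

theorem shareOf_apply {k b L : ℕ} (w : Answer k b k L) (e : Fin k) :
    shareOf w (w.1 e) = w.2.2 e := by
  simp only [shareOf, act, perm_inv_apply_self]

/-- The values that `P₁` receives in an oblivious permutation. -/
def opReceived {k b L : ℕ} (s : Equiv.Perm (Fin k))
    (g : Answer k b k L)
    (u : Fin k → ZMod (2 ^ L)) :
    Answer k b k L :=
  (s * g.1⁻¹, g.2.1, act g.1 u - g.2.2)

/-- The values that `P₁` receives in an oblivious selection, together with the first random number
of `P₀`. -/
def osmReceived {k L : ℕ} (s : ZMod 2)
    (g : Answer k 1 2 L) (u : ZMod (2 ^ L)) :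
    Answer k 1 2 L :=
  (g.1, fun _ => s - g.2.1 0, ![g.2.2 0, bitMul (g.2.1 0) (g.2.2 0 + u) - g.2.2 1])

/-- The values that `P₁` receives in a multiplication of `c` and `x + y`, where `P₀` holds `c` and
`x`. -/
def mulReceived {k b L : ℕ} (c x : ZMod (2 ^ L))
    (g : Answer k b 3 L)
    (u : Fin 2 → ZMod (2 ^ L)) :
    Answer k b 3 L :=
  (g.1, g.2.1, ![c - g.2.2 0, x - g.2.2 1,
    (g.2.2 0 + u 0) * (g.2.2 1 + u 1) - g.2.2 2])

/-- The values that `P₁` receives, as a function of its random values `v` and of those of `P₀`. In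
the last step the value from the dealer is replaced by the output of `P₁`, which it determines. -/
def received₁ (g : Values₀ p) : Values₀ p
  | .op1 j => opReceived D.s1 (g (.op1 j)) (v (.op1 j)).2.2
  | .osm2 i j => osmReceived (selectors p.n D.ncol i) (g (.osm2 i j)) ((v (.osm2 i j)).2.2 (0 : Fin
      1))
  | .op3 j => opReceived D.s2 (g (.op3 j)) (v (.op3 j)).2.2
  | .op4 j => opReceived D.s3 (g (.op4 j)) (v (.op4 j)).2.2
  | .mul5 i j => mulReceived (D.weights i) (D.val5 X i j -
      shareOf (opReceived (L := p.L) D.s3 (g (.op4 j)) (v (.op4 j)).2.2) i)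
      (g (.mul5 i j)) (v (.mul5 i j)).2.2
  | .op6 j => opReceived D.s4 (g (.op6 j)) (v (.op6 j)).2.2
  | .osm7 i j => osmReceived (selectors p.m D.nrow i) (g (.osm7 i j)) ((v (.osm7 i j)).2.2 (0 : Fin
      1))
  | .op8 j => ((opReceived D.s5 (g (.op8 j)) (v (.op8 j)).2.2).1, (g (.op8 j)).2.1,
      shareOf (opReceived D.s5 (g (.op8 j)) (v (.op8 j)).2.2))

/-- The messages to `P₁` in the permutation of the columns of a matrix. -/
def opRecv₁ {k d b l L : ℕ}
    (w : Fin d → Answer k b l L) : List Data :=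
  (List.ofFn fun j => [encVec (w j).2.2, encPerm (w j).1]).flatten

/-- The messages to `P₁` in the selection of the rows of a matrix. -/
def osmRecv₁ {k k' d L : ℕ}
    (w : Fin k → Fin d → Answer k' 1 2 L) :
    List Data :=
  (List.ofFn fun i => (List.ofFn fun j =>
    [Data.nat ((w i j).2.2 1).val, .nat ((w i j).2.1 0).val]).flatten).flatten

/-- The messages to `P₁` in the multiplication of the rows of a matrix by weights. -/
def mulRecv₁ {k k' b d L : ℕ} (w : Fin k → Fin d → Answer k' b 3 L) : List Data :=
  (List.ofFn fun i => (List.ofFn fun j => [Data.nat ((w i j).2.2 2).val,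
    .nat ((w i j).2.2 0).val, .nat ((w i j).2.2 1).val]).flatten).flatten

/-- The messages to `P₁` in the last step, as a function of the output of `P₁`. -/
def lastRecv₁ {k d b L : ℕ} (w : Fin d → Answer k b k L) : List Data :=
  (List.ofFn fun j => [encVec fun e => (w j).2.2 ((w j).1 e), encPerm (w j).1]).flatten

/-- The messages to `P₁` as a function of the values that it receives. -/
def messages₁ : List Data :=
  opRecv₁ (fun j => w (.op1 j)) ++ osmRecv₁ (fun i j => w (.osm2 i j)) ++
  opRecv₁ (fun j => w (.op3 j)) ++ opRecv₁ (fun j => w (.op4 j)) ++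
  mulRecv₁ (fun i j => w (.mul5 i j)) ++
  opRecv₁ (fun j => w (.op6 j)) ++ osmRecv₁ (fun i j => w (.osm7 i j)) ++
  lastRecv₁ fun j => w (.op8 j)

end Party₁

section Matching

variable (G₀ G₁ : Rand) (D : Decomp p) (X : Matrix (Fin p.n) (Fin p.d) p.R)

/-! The runs of the eight steps that need communication. -/

def run1 : Run (Matrix (Fin p.n) (Fin p.d) p.R) := opMat G₀ G₁ 0 D.s1 none X
def run2 : Run (Matrix (Fin p.n) (Fin p.d) p.R) :=
  osmMat G₀ G₁ p.ctr2 (selectors p.n D.ncol)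
    (diffMat p.R p.n * (run1 G₀ G₁ D X).share₀) (diffMat p.R p.n * (run1 G₀ G₁ D X).share₁)
def run3 : Run (Matrix (Fin p.t) (Fin p.d) p.R) :=
  opMat G₀ G₁ p.ctr3 D.s2 (some (resize p.t (run2 G₀ G₁ D X).share₀))
    (resize p.t (run2 G₀ G₁ D X).share₁)
def run4 : Run (Matrix (Fin p.t) (Fin p.d) p.R) :=
  opMat G₀ G₁ p.ctr4 D.s3 (some (sumMat p.R p.t * (run3 G₀ G₁ D X).share₀))
    (sumMat p.R p.t * (run3 G₀ G₁ D X).share₁)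
def run5 : Run (Matrix (Fin p.t) (Fin p.d) p.R) :=
  beaverMat G₀ G₁ p.ctr5 D.weights (run4 G₀ G₁ D X).share₀ (run4 G₀ G₁ D X).share₁
def run6 : Run (Matrix (Fin p.t) (Fin p.d) p.R) :=
  opMat G₀ G₁ p.ctr6 D.s4 (some ((sumMat p.R p.t)ᵀ * (run5 G₀ G₁ D X).share₀))
    ((sumMat p.R p.t)ᵀ * (run5 G₀ G₁ D X).share₁)
def run7 : Run (Matrix (Fin p.m) (Fin p.d) p.R) :=
  osmMat G₀ G₁ p.ctr7 (selectors p.m D.nrow)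
    (resize p.m (run6 G₀ G₁ D X).share₀) (resize p.m (run6 G₀ G₁ D X).share₁)
def run8 : Run (Matrix (Fin p.m) (Fin p.d) p.R) :=
  opMat G₀ G₁ p.ctr8 D.s5 (some ((diffMat p.R p.m)ᵀ * (run7 G₀ G₁ D X).share₀))
    ((diffMat p.R p.m)ᵀ * (run7 G₀ G₁ D X).share₁)

theorem smmRun_share₀ : (smmRun G₀ G₁ D X).share₀ = (run8 G₀ G₁ D X).share₀ := rfl
theorem smmRun_share₁ : (smmRun G₀ G₁ D X).share₁ = (run8 G₀ G₁ D X).share₁ := rfl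
theorem smmRun_recv₀ : (smmRun G₀ G₁ D X).recv₀ = (run1 G₀ G₁ D X).recv₀ ++
    (run2 G₀ G₁ D X).recv₀ ++ (run3 G₀ G₁ D X).recv₀ ++ (run4 G₀ G₁ D X).recv₀ ++
    (run5 G₀ G₁ D X).recv₀ ++ (run6 G₀ G₁ D X).recv₀ ++ (run7 G₀ G₁ D X).recv₀ ++
    (run8 G₀ G₁ D X).recv₀ := rfl
theorem smmRun_recv₁ : (smmRun G₀ G₁ D X).recv₁ = (run1 G₀ G₁ D X).recv₁ ++
    (run2 G₀ G₁ D X).recv₁ ++ (run3 G₀ G₁ D X).recv₁ ++ (run4 G₀ G₁ D X).recv₁ ++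
    (run5 G₀ G₁ D X).recv₁ ++ (run6 G₀ G₁ D X).recv₁ ++ (run7 G₀ G₁ D X).recv₁ ++
    (run8 G₀ G₁ D X).recv₁ := rfl

/-! In each step the two input shares add up to the shared value. -/

theorem shared2 : diffMat p.R p.n * (run1 G₀ G₁ D X).share₀ +
    diffMat p.R p.n * (run1 G₀ G₁ D X).share₁ = D.val2 X := by
  rw [← Matrix.mul_add, run1, opMat_share_add, Decomp.val2]
  simp

theorem shared3 : resize p.t (run2 G₀ G₁ D X).share₀ + resize p.t (run2 G₀ G₁ D X).share₁ =
    D.val3 X := by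
  rw [← resize_add, run2, osmMat_share_add, shared2, Decomp.val3]

theorem shared4 : sumMat p.R p.t * (run3 G₀ G₁ D X).share₀ +
    sumMat p.R p.t * (run3 G₀ G₁ D X).share₁ = D.val4 X := by
  rw [← Matrix.mul_add, run3, opMat_share_add, Option.elim_some, id, shared3, Decomp.val4]

theorem shared5 : (run4 G₀ G₁ D X).share₀ + (run4 G₀ G₁ D X).share₁ = D.val5 X := by
  rw [run4, opMat_share_add, Option.elim_some, id, shared4, Decomp.val5]

theorem shared6 : (sumMat p.R p.t)ᵀ * (run5 G₀ G₁ D X).share₀ +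
    (sumMat p.R p.t)ᵀ * (run5 G₀ G₁ D X).share₁ = D.val6 X := by
  rw [← Matrix.mul_add, run5, beaverMat_share_add, shared5, Decomp.val6]

theorem shared7 : resize p.m (run6 G₀ G₁ D X).share₀ + resize p.m (run6 G₀ G₁ D X).share₁ =
    D.val7 X := by
  rw [← resize_add, run6, opMat_share_add, Option.elim_some, id, shared6, Decomp.val7]

theorem shared8 : (diffMat p.R p.m)ᵀ * (run7 G₀ G₁ D X).share₀ +
    (diffMat p.R p.m)ᵀ * (run7 G₀ G₁ D X).share₁ = D.val8 X := by
  rw [← Matrix.mul_add, run7, osmMat_share_add, shared7, Decomp.val8]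

/-- The outputs of the parties are additive shares of the product. -/
theorem smmRun_share_add :
    (smmRun G₀ G₁ D X).share₀ + (smmRun G₀ G₁ D X).share₁ = D.product * X := by
  rw [smmRun_share₀, smmRun_share₁, run8, opMat_share_add, Option.elim_some, id, shared8,
    Decomp.product_mul]

/-- The values of a function at the queries of one run under the key of `P₀`. -/
def onQueries₀ : Values₀ p := fun i => G₀ i.query₀

/-- The values of a function at the queries of one run under the key of `P₁`. -/
def onQueries₁ : Values₁ p := fun i => G₁ i.query₁

theorem run1_share₀ : (run1 G₀ G₁ D X).share₀ =
    share1 D (onQueries₀ G₀) (masked₀ D X (onQueries₀ G₀) (onQueries₁ G₁)) :=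
  opMat_share₀ _ _ _ _ (zero_add X)

theorem run2_share₀ : (run2 G₀ G₁ D X).share₀ =
    share2 D (onQueries₀ G₀) (masked₀ D X (onQueries₀ G₀) (onQueries₁ G₁)) :=
  osmMat_share₀ _ _ _ _ (shared2 ..)

theorem run3_share₀ : (run3 G₀ G₁ D X).share₀ =
    share3 D (onQueries₀ G₀) (masked₀ D X (onQueries₀ G₀) (onQueries₁ G₁)) :=
  opMat_share₀ _ _ _ _ (shared3 ..)

theorem run4_share₀ : (run4 G₀ G₁ D X).share₀ =
    share4 D (onQueries₀ G₀) (masked₀ D X (onQueries₀ G₀) (onQueries₁ G₁)) :=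
  opMat_share₀ _ _ _ _ (shared4 ..)

theorem run5_share₀ : (run5 G₀ G₁ D X).share₀ =
    share5 (onQueries₀ G₀) (masked₀ D X (onQueries₀ G₀) (onQueries₁ G₁)) :=
  beaverMat_share₀ _ _ _ _ (shared5 ..)

theorem run6_share₀ : (run6 G₀ G₁ D X).share₀ =
    share6 D (onQueries₀ G₀) (masked₀ D X (onQueries₀ G₀) (onQueries₁ G₁)) :=
  opMat_share₀ _ _ _ _ (shared6 ..)

theorem run7_share₀ : (run7 G₀ G₁ D X).share₀ =
    share7 D (onQueries₀ G₀) (masked₀ D X (onQueries₀ G₀) (onQueries₁ G₁)) :=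
  osmMat_share₀ _ _ _ _ (shared7 ..)

theorem share₀_eq : (smmRun G₀ G₁ D X).share₀ = Matrix.of fun i j =>
    (masked₀ D X (onQueries₀ G₀) (onQueries₁ G₁) (.op8 j)).2.2 i :=
  opMat_share₀ _ _ _ _ (shared8 ..)

/-- The messages to `P₀` depend on the masks of `P₁` and on `X` only through the masked values. -/
theorem recv₀_eq : (smmRun G₀ G₁ D X).recv₀ = messages₀ D (onQueries₀ G₀)
    (masked₀ D X (onQueries₀ G₀) (onQueries₁ G₁)) := by
  have h1 := opMat_recv₀ G₀ G₁ 0 D.s1 (Y₀ := none) (zero_add X)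
  have h2 := osmMat_recv₀ G₀ G₁ p.ctr2 D.ncol (shared2 G₀ G₁ D X)
  have h3 := opMat_recv₀ G₀ G₁ p.ctr3 D.s2 (Y₀ := some _) (shared3 G₀ G₁ D X)
  have h4 := opMat_recv₀ G₀ G₁ p.ctr4 D.s3 (Y₀ := some _) (shared4 G₀ G₁ D X)
  have h5 := beaverMat_recv₀ G₀ G₁ p.ctr5 D.weights (shared5 G₀ G₁ D X)
  have h6 := opMat_recv₀ G₀ G₁ p.ctr6 D.s4 (Y₀ := some _) (shared6 G₀ G₁ D X)
  have h7 := osmMat_recv₀ G₀ G₁ p.ctr7 D.nrow (shared7 G₀ G₁ D X)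
  have h8 := opMat_recv₀ G₀ G₁ p.ctr8 D.s5 (Y₀ := some _) (shared8 G₀ G₁ D X)
  have h8' : (List.ofFn fun j : Fin p.d => encVec fun e => D.val8 X e j -
      (G₁ ⟨p.ctr8 + j, 0, 0, p.m, p.L⟩).2.2 e -
        ((diffMat p.R p.m)ᵀ * (run7 G₀ G₁ D X).share₀) e j) =
      lastRecv₀ D.s5 (fun j => onQueries₀ G₀ (.op8 j))
        (fun j => masked₀ D X (onQueries₀ G₀) (onQueries₁ G₁) (.op8 j))
        ((diffMat p.R p.m)ᵀ * (run7 G₀ G₁ D X).share₀) := by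
    refine congrArg List.ofFn (funext fun j => congrArg encVec (funext fun e => ?_))
    exact congrArg (· - ((diffMat p.R p.m)ᵀ * (run7 G₀ G₁ D X).share₀) e j)
      (opShare₀_apply D.s5 (onQueries₀ G₀ (.op8 j))
        (maskVec (fun e => D.val8 X e j) (onQueries₁ G₁ (.op8 j))).2.2 e).symm
  rw [smmRun_recv₀, messages₀, ← run1_share₀, ← run2_share₀, ← run3_share₀, ← run4_share₀,
    ← run5_share₀, ← run6_share₀, ← run7_share₀]
  refine congrArg₂ (· ++ ·) (congrArg₂ (· ++ ·) (congrArg₂ (· ++ ·) (congrArg₂ (· ++ ·)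
    (congrArg₂ (· ++ ·) (congrArg₂ (· ++ ·) (congrArg₂ (· ++ ·) ?_ ?_) ?_) ?_) ?_) ?_) ?_) ?_
  exacts [h1, h2, h3, h4, h5, h6, h7, h8.trans h8']

theorem share₁_eq : (smmRun G₀ G₁ D X).share₁ = Matrix.of fun i j =>
    (received₁ D X (onQueries₁ G₁) (onQueries₀ G₀) (.op8 j)).2.2 i := rfl

/-- The messages to `P₁` are determined by the values that it receives: the remaining share of `P₀`
in the multiplication is the shared value minus the share of `P₁`. -/
theorem recv₁_eq : (smmRun G₀ G₁ D X).recv₁ =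
    messages₁ (received₁ D X (onQueries₁ G₁) (onQueries₀ G₀)) := by
  have h5 : (run5 G₀ G₁ D X).recv₁ =
      mulRecv₁ fun i j => received₁ D X (onQueries₁ G₁) (onQueries₀ G₀) (.mul5 i j) := by
    refine congrArg List.flatten (congrArg List.ofFn (funext fun i => ?_))
    refine congrArg List.flatten (congrArg List.ofFn (funext fun j => ?_))
    have h : (run4 G₀ G₁ D X).share₀ i j = D.val5 X i j - (run4 G₀ G₁ D X).share₁ i j := by
      rw [← shared5 G₀ G₁]
      simp
    refine congrArg (fun x : ZMod (2 ^ p.L) => [_, _, Data.nat x.val]) ?_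
    change (run4 G₀ G₁ D X).share₀ i j - _ = _
    rw [h]
    rfl
  have h8 : (run8 G₀ G₁ D X).recv₁ =
      lastRecv₁ fun j => received₁ D X (onQueries₁ G₁) (onQueries₀ G₀) (.op8 j) := by
    refine congrArg List.flatten (congrArg List.ofFn (funext fun j => ?_))
    refine congrArg (fun x => [encVec x, _]) (funext fun e => ?_)
    exact (shareOf_apply (opReceived D.s5 (onQueries₀ G₀ (.op8 j))
      (onQueries₁ G₁ (.op8 j)).2.2) e).symm
  rw [smmRun_recv₁, h5, h8]
  rfl

end Matching

end

end SMM
namespace SMM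

noncomputable section

/-! ### The masked values as bijective functions of the random values -/

theorem maskVec_injective {k b l L : ℕ} (x : Fin l → ZMod (2 ^ L)) :
    Function.Injective (maskVec (k := k) (b := b) x) := by
  rintro ⟨a, c, v⟩ ⟨a', c', v'⟩ h
  simp only [maskVec, Prod.mk.injEq] at h
  obtain ⟨rfl, rfl, h⟩ := h
  have : v = v' := funext fun e => sub_right_injective (congrFun h e)
  rw [this]

theorem opShare₀_injective {k b L : ℕ} (s : Equiv.Perm (Fin k)) (g : Answer k b k L) :
    Function.Injective (opShare₀ s g) := fun x x' h => funext fun e => by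
  rw [← opShare₀_apply s g x, ← opShare₀_apply s g x', h]

theorem opReceived_injective {k b L : ℕ} (s : Equiv.Perm (Fin k)) (u : Fin k → ZMod (2 ^ L)) :
    Function.Injective fun g : Answer k b k L => opReceived s g u := by
  rintro ⟨a, c, v⟩ ⟨a', c', v'⟩ h
  simp only [opReceived, Prod.mk.injEq, mul_right_inj, inv_inj] at h
  obtain ⟨rfl, rfl, h⟩ := h
  rw [sub_right_injective h]

theorem shareOf_injective {k b L : ℕ} {w w' : Answer k b k L} (h1 : w.1 = w'.1)
    (h2 : w.2.1 = w'.2.1) (h : shareOf w = shareOf w') : w = w' := by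
  refine Prod.ext h1 (Prod.ext h2 (funext fun e => ?_))
  rw [← shareOf_apply w, ← shareOf_apply w', h, h1]

theorem osmReceived_injective {k L : ℕ} (s : ZMod 2) (u : ZMod (2 ^ L)) :
    Function.Injective fun g : Answer k 1 2 L => osmReceived s g u := by
  rintro ⟨a, c, v⟩ ⟨a', c', v'⟩ h
  simp only [osmReceived, Prod.mk.injEq] at h
  obtain ⟨rfl, h1, h2⟩ := h
  have hc : c 0 = c' 0 := sub_right_injective (congrFun h1 0)
  have h3 : v 0 = v' 0 := congrFun h2 0
  have h4 : bitMul (c 0) (v 0 + u) - v 1 = bitMul (c' 0) (v' 0 + u) - v' 1 := congrFun h2 1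
  rw [hc, h3] at h4
  have h5 : v 1 = v' 1 := sub_right_injective h4
  have hc' : c = c' := funext fun e => by rwa [Subsingleton.elim e 0]
  have hv : v = v' := funext fun e => by fin_cases e <;> assumption
  rw [hc', hv]

theorem mulReceived_injective {k b L : ℕ} (c x : ZMod (2 ^ L)) (u : Fin 2 → ZMod (2 ^ L)) :
    Function.Injective fun g : Answer k b 3 L => mulReceived c x g u := by
  rintro ⟨a, d, v⟩ ⟨a', d', v'⟩ h
  simp only [mulReceived, Prod.mk.injEq] at h
  obtain ⟨rfl, rfl, h⟩ := h
  have h0 : v 0 = v' 0 := sub_right_injective (b := c) (congrFun h 0)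
  have h1 : v 1 = v' 1 := sub_right_injective (b := x) (congrFun h 1)
  have h2 : (v 0 + u 0) * (v 1 + u 1) - v 2 = (v' 0 + u 0) * (v' 1 + u 1) - v' 2 := congrFun h 2
  rw [h0, h1] at h2
  have h3 : v 2 = v' 2 := sub_right_injective h2
  have hv : v = v' := funext fun e => by fin_cases e <;> assumption
  rw [hv]

variable {p : Params}

/-- The masked values for uniformly random masks are uniformly random. -/
theorem masked₀_bijective (D : Decomp p) (X : Matrix (Fin p.n) (Fin p.d) p.R) (g : Values₀ p) :
    Function.Bijective (masked₀ D X g) := by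
  refine Finite.injective_iff_bijective.1 fun v v' h => funext fun i => ?_
  have hi := congrFun h i
  cases i with
  | op8 j =>
    have h1 := congrArg Prod.fst hi
    have h2 := congrArg (fun x => x.2.1) hi
    have h3 := opShare₀_injective D.s5 (g (.op8 j)) (congrArg (fun x => x.2.2) hi)
    exact maskVec_injective (fun e => D.val8 X e j) (Prod.ext h1 (Prod.ext h2 h3))
  | _ => exact maskVec_injective _ hi

/-- The values that `P₁` receives are uniformly random if those of `P₀` are. The values for the
multiplication depend on the share of `P₁` from the preceding permutation. -/
theorem received₁_bijective (D : Decomp p) (X : Matrix (Fin p.n) (Fin p.d) p.R)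
    (v : Values₁ p) : Function.Bijective (received₁ D X v) := by
  refine Finite.injective_iff_bijective.1 fun g g' h => ?_
  have h4 (j : Fin p.d) : g (.op4 j) = g' (.op4 j) :=
    opReceived_injective D.s3 (v (.op4 j)).2.2 (congrFun h (.op4 j))
  funext i
  have hi := congrFun h i
  cases i with
  | op8 j =>
    have h1 := congrArg Prod.fst hi
    have h2 := congrArg (fun x => x.2.1) hi
    have h3 := congrArg (fun x => x.2.2) hi
    exact opReceived_injective D.s5 (v (.op8 j)).2.2 (shareOf_injective h1 h2 h3)
  | osm2 i j => exact osmReceived_injective _ _ hi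
  | osm7 i j => exact osmReceived_injective _ _ hi
  | mul5 i j =>
    simp only [received₁, h4] at hi
    exact mulReceived_injective _ _ _ hi
  | _ => exact opReceived_injective _ _ hi

/-- The output of `P₀` as a part of the masked values. -/
def outLens₁ (p : Params) : Lens (Values₁ p) (Fin p.m → Fin p.d → p.R) where
  get v := fun e j => (v (.op8 j)).2.2 e
  put Y v
    | .op8 j => ((v (.op8 j)).1, (v (.op8 j)).2.1, fun e => Y e j)
    | .op1 j => v (.op1 j)
    | .osm2 i j => v (.osm2 i j)
    | .op3 j => v (.op3 j)
    | .op4 j => v (.op4 j)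
    | .mul5 i j => v (.mul5 i j)
    | .op6 j => v (.op6 j)
    | .osm7 i j => v (.osm7 i j)
  get_put _ _ := rfl
  put_get v := by funext i; cases i <;> rfl
  put_put Y Y' v := by funext i; cases i <;> rfl

/-- The output of `P₁` as a part of the values that it receives. -/
def outLens₀ (p : Params) : Lens (Values₀ p) (Fin p.m → Fin p.d → p.R) where
  get v := fun e j => (v (.op8 j)).2.2 e
  put Y v
    | .op8 j => ((v (.op8 j)).1, (v (.op8 j)).2.1, fun e => Y e j)
    | .op1 j => v (.op1 j)
    | .osm2 i j => v (.osm2 i j)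
    | .op3 j => v (.op3 j)
    | .op4 j => v (.op4 j)
    | .mul5 i j => v (.mul5 i j)
    | .op6 j => v (.op6 j)
    | .osm7 i j => v (.osm7 i j)
  get_put _ _ := rfl
  put_get v := by funext i; cases i <;> rfl
  put_put Y Y' v := by funext i; cases i <;> rfl

/-! ### Computation of the masked values and of the messages -/

namespace Algo

/-! The public parameters, as the first element of the input. -/

def dimM : Algo := (var 0).elt 0
def dimN : Algo := (var 0).elt 1
def dimD : Algo := (var 0).elt 2
def dimT : Algo := (var 0).elt 3
def modulus : Algo := pow2 ((var 0).elt 4)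

/-- Runs an algorithm whose input lists the number of rows, the number of columns, the modulus and
further arguments. -/
def onStep (a rows : Algo) (args : List Algo) : Algo :=
  (lst (rows :: dimD :: modulus :: args)).andThen a

variable (O : Data → Data)

section Dims

variable (l : List Data)

@[simp] theorem ev_dimM : dimM.ev O (.list (p.enc :: l)) = .unary p.m := rfl
@[simp] theorem ev_dimN : dimN.ev O (.list (p.enc :: l)) = .unary p.n := rfl
@[simp] theorem ev_dimD : dimD.ev O (.list (p.enc :: l)) = .unary p.d := rfl
@[simp] theorem ev_dimT : dimT.ev O (.list (p.enc :: l)) = .unary p.t := rfl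

@[simp] theorem ev_modulus : modulus.ev O (.list (p.enc :: l)) = .nat (2 ^ p.L) := by
  have h : p.enc.nth 4 = .unary p.L := rfl
  simp [modulus, h]

theorem ev_onStep (a rows : Algo) (args : List Algo) : (onStep a rows args).ev O
    (.list (p.enc :: l)) = a.ev O (.list (rows.ev O (.list (p.enc :: l)) :: .unary p.d ::
      .nat (2 ^ p.L) :: args.map fun b => b.ev O (.list (p.enc :: l)))) := by
  simp [onStep]

end Dims

/-! In the following algorithms the input lists the public parameters, the masked values or the
answers of the other party, the decomposition, and the own answers. -/

def shareAlgo1 : Algo := onStep opShare dimN [(var 2).elt 0, (var 3).elt 0, (var 1).elt 0]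
def shareAlgo2 : Algo := onStep osmShare dimN [(var 2).elt 7, (var 3).elt 1, (var 1).elt 1]
def shareAlgo3 : Algo := onStep opShare dimT [(var 2).elt 1, (var 3).elt 2, (var 1).elt 2]
def shareAlgo4 : Algo := onStep opShare dimT [(var 2).elt 2, (var 3).elt 3, (var 1).elt 3]
def shareAlgo5 : Algo := onStep mulShare dimT [(var 2).elt 5, (var 3).elt 4, (var 1).elt 4]
def shareAlgo6 : Algo := onStep opShare dimT [(var 2).elt 3, (var 3).elt 5, (var 1).elt 5]
def shareAlgo7 : Algo := onStep osmShare dimM [(var 2).elt 6, (var 3).elt 6, (var 1).elt 6]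

/-- The messages of `P₁` in the first step, in which `P₀` has no share of the input. -/
def plainMsg : Algo := tab id (((up 1).nth (var 0)).elt 2)

theorem ev_plainMsg {k b l d L : ℕ} (w : Fin d → Answer b l k L) :
    plainMsg.ev O (.list (List.ofFn fun j => encAns (w j))) =
      .list (opRecv₀ w (0 : Matrix (Fin k) (Fin d) (ZMod (2 ^ L)))) := by
  rw [plainMsg, ev_tab, ev_id, Data.length_list, List.length_ofFn]
  refine (Data.list_ofFn_eq_tab fun j => ?_).symm
  simp

/-- Computes the messages to `P₀` from the masked values. -/
def messagesAlgo₀ : Algo :=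
  app (app (app (app (app (app (app
    (((var 1).elt 0).andThen plainMsg)
    (onStep osmMsg dimN [(var 1).elt 1, onStep (linear diffCoef) dimN [shareAlgo1, dimN]]))
    (onStep opMsg dimT [(var 1).elt 2, onStep (linear resizeCoef) dimT [shareAlgo2, dimN]]))
    (onStep opMsg dimT [(var 1).elt 3, onStep (linear sumCoef) dimT [shareAlgo3, dimT]]))
    (onStep mulMsg dimT [(var 1).elt 4, shareAlgo4, (var 2).elt 5]))
    (onStep opMsg dimT [(var 1).elt 5, onStep (linear sumTCoef) dimT [shareAlgo5, dimT]]))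
    (onStep osmMsg dimM [(var 1).elt 6, onStep (linear resizeCoef) dimM [shareAlgo6, dimT]]))
    (onStep lastMsg₀ dimM [(var 2).elt 4, (var 3).elt 7, (var 1).elt 7,
      onStep (linear diffTCoef) dimM [shareAlgo7, dimM]])

section Party₀

variable (D : Decomp p) (X : Matrix (Fin p.n) (Fin p.d) p.R) (g : Values₀ p) (w : Values₁ p)

theorem ev_shareAlgo1 : shareAlgo1.ev O (.list [p.enc, queries₁.enc w, D.enc, queries₀.enc g]) =
    encMat (share1 D g w) :=
  (ev_onStep ..).trans (ev_opShare O D.s1 (fun j => g (.op1 j)) fun j => w (.op1 j))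

theorem ev_shareAlgo2 : shareAlgo2.ev O (.list [p.enc, queries₁.enc w, D.enc, queries₀.enc g]) =
    encMat (share2 D g w) :=
  (ev_onStep ..).trans (ev_osmShare O (r := D.ncol) (fun i j => g (.osm2 i j))
    fun i j => w (.osm2 i j))

theorem ev_shareAlgo3 : shareAlgo3.ev O (.list [p.enc, queries₁.enc w, D.enc, queries₀.enc g]) =
    encMat (share3 D g w) :=
  (ev_onStep ..).trans (ev_opShare O D.s2 (fun j => g (.op3 j)) fun j => w (.op3 j))

theorem ev_shareAlgo4 : shareAlgo4.ev O (.list [p.enc, queries₁.enc w, D.enc, queries₀.enc g]) =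
    encMat (share4 D g w) :=
  (ev_onStep ..).trans (ev_opShare O D.s3 (fun j => g (.op4 j)) fun j => w (.op4 j))

theorem ev_shareAlgo5 : shareAlgo5.ev O (.list [p.enc, queries₁.enc w, D.enc, queries₀.enc g]) =
    encMat (share5 g w) :=
  (ev_onStep ..).trans (ev_mulShare O (encVec D.weights) (fun i j => g (.mul5 i j))
    fun i j => w (.mul5 i j))

theorem ev_shareAlgo6 : shareAlgo6.ev O (.list [p.enc, queries₁.enc w, D.enc, queries₀.enc g]) =
    encMat (share6 D g w) :=
  (ev_onStep ..).trans (ev_opShare O D.s4 (fun j => g (.op6 j)) fun j => w (.op6 j))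

theorem ev_shareAlgo7 : shareAlgo7.ev O (.list [p.enc, queries₁.enc w, D.enc, queries₀.enc g]) =
    encMat (share7 D g w) :=
  (ev_onStep ..).trans (ev_osmShare O (r := D.nrow) (fun i j => g (.osm7 i j))
    fun i j => w (.osm7 i j))

theorem ev_messagesAlgo₀ : messagesAlgo₀.ev O
    (.list [p.enc, queries₁.enc w, D.enc, queries₀.enc g]) = .list (messages₀ D g w) := by
  set x := Data.list [p.enc, queries₁.enc w, D.enc, queries₀.enc g] with hx
  have h1 : (((var 1).elt 0).andThen plainMsg).ev O x =
      .list (opRecv₀ (fun j => w (.op1 j)) (0 : Matrix (Fin p.n) (Fin p.d) p.R)) := by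
    exact ev_plainMsg O fun j => w (.op1 j)
  have l1 : (onStep (linear diffCoef) dimN [shareAlgo1, dimN]).ev O x =
      encMat (diffMat p.R p.n * share1 D g w) := by
    rw [hx, ev_onStep, List.map_cons, ev_shareAlgo1]
    exact ev_linear_diff O _
  have l2 : (onStep (linear resizeCoef) dimT [shareAlgo2, dimN]).ev O x =
      encMat (resize p.t (share2 D g w)) := by
    rw [hx, ev_onStep, List.map_cons, ev_shareAlgo2]
    exact ev_linear_resize O _
  have l3 : (onStep (linear sumCoef) dimT [shareAlgo3, dimT]).ev O x =
      encMat (sumMat p.R p.t * share3 D g w) := by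
    rw [hx, ev_onStep, List.map_cons, ev_shareAlgo3]
    exact ev_linear_sum O _
  have l5 : (onStep (linear sumTCoef) dimT [shareAlgo5, dimT]).ev O x =
      encMat ((sumMat p.R p.t)ᵀ * share5 g w) := by
    rw [hx, ev_onStep, List.map_cons, ev_shareAlgo5]
    exact ev_linear_sumT O _
  have l6 : (onStep (linear resizeCoef) dimM [shareAlgo6, dimT]).ev O x =
      encMat (resize p.m (share6 D g w)) := by
    rw [hx, ev_onStep, List.map_cons, ev_shareAlgo6]
    exact ev_linear_resize O _
  have l7 : (onStep (linear diffTCoef) dimM [shareAlgo7, dimM]).ev O x =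
      encMat ((diffMat p.R p.m)ᵀ * share7 D g w) := by
    rw [hx, ev_onStep, List.map_cons, ev_shareAlgo7]
    exact ev_linear_diffT O _
  have h2 : (onStep osmMsg dimN [(var 1).elt 1,
      onStep (linear diffCoef) dimN [shareAlgo1, dimN]]).ev O x =
      .list (osmRecv₀ (fun i j => w (.osm2 i j)) (diffMat p.R p.n * share1 D g w)) := by
    rw [hx, ev_onStep, List.map_cons, List.map_cons, ← hx, l1]
    exact ev_osmMsg O (fun i j => w (.osm2 i j)) _
  have h3 : (onStep opMsg dimT [(var 1).elt 2,
      onStep (linear resizeCoef) dimT [shareAlgo2, dimN]]).ev O x =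
      .list (opRecv₀ (fun j => w (.op3 j)) (resize p.t (share2 D g w))) := by
    rw [hx, ev_onStep, List.map_cons, List.map_cons, ← hx, l2]
    exact ev_opMsg O (fun j => w (.op3 j)) _
  have h4 : (onStep opMsg dimT [(var 1).elt 3,
      onStep (linear sumCoef) dimT [shareAlgo3, dimT]]).ev O x =
      .list (opRecv₀ (fun j => w (.op4 j)) (sumMat p.R p.t * share3 D g w)) := by
    rw [hx, ev_onStep, List.map_cons, List.map_cons, ← hx, l3]
    exact ev_opMsg O (fun j => w (.op4 j)) _
  have h5 : (onStep mulMsg dimT [(var 1).elt 4, shareAlgo4, (var 2).elt 5]).ev O x =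
      .list (mulRecv₀ (fun i j => w (.mul5 i j)) D.weights (share4 D g w)) := by
    rw [hx, ev_onStep, List.map_cons, List.map_cons, ev_shareAlgo4]
    exact ev_mulMsg O (fun i j => w (.mul5 i j)) _ D.weights
  have h6 : (onStep opMsg dimT [(var 1).elt 5,
      onStep (linear sumTCoef) dimT [shareAlgo5, dimT]]).ev O x =
      .list (opRecv₀ (fun j => w (.op6 j)) ((sumMat p.R p.t)ᵀ * share5 g w)) := by
    rw [hx, ev_onStep, List.map_cons, List.map_cons, ← hx, l5]
    exact ev_opMsg O (fun j => w (.op6 j)) _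
  have h7 : (onStep osmMsg dimM [(var 1).elt 6,
      onStep (linear resizeCoef) dimM [shareAlgo6, dimT]]).ev O x =
      .list (osmRecv₀ (fun i j => w (.osm7 i j)) (resize p.m (share6 D g w))) := by
    rw [hx, ev_onStep, List.map_cons, List.map_cons, ← hx, l6]
    exact ev_osmMsg O (fun i j => w (.osm7 i j)) _
  have h8 : (onStep lastMsg₀ dimM [(var 2).elt 4, (var 3).elt 7, (var 1).elt 7,
      onStep (linear diffTCoef) dimM [shareAlgo7, dimM]]).ev O x =
      .list (lastRecv₀ D.s5 (fun j => g (.op8 j)) (fun j => w (.op8 j))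
        ((diffMat p.R p.m)ᵀ * share7 D g w)) := by
    rw [hx, ev_onStep, List.map_cons, List.map_cons, List.map_cons, List.map_cons, ← hx, l7]
    exact ev_lastMsg₀ O D.s5 (fun j => g (.op8 j)) (fun j => w (.op8 j)) _
  rw [messagesAlgo₀]
  simp only [ev_app, h1, h2, h3, h4, h5, h6, h7, h8, Data.app_list]
  rfl

/-- Computes the masked values; the input has the list of the shared values as a fifth element. -/
def maskedAlgo₀ : Algo :=
  (lst [var 0, var 2, var 3, onStep opMask₀ dimM [(var 4).elt 7, (var 1).elt 7],
    lst [onStep opMask₀ dimN [(var 4).elt 0, (var 1).elt 0],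
      onStep osmMask₀ dimN [(var 4).elt 1, (var 1).elt 1],
      onStep opMask₀ dimT [(var 4).elt 2, (var 1).elt 2],
      onStep opMask₀ dimT [(var 4).elt 3, (var 1).elt 3],
      onStep mulMask₀ dimT [(var 4).elt 4, (var 1).elt 4, (var 2).elt 5],
      onStep opMask₀ dimT [(var 4).elt 5, (var 1).elt 5],
      onStep osmMask₀ dimM [(var 4).elt 6, (var 1).elt 6],
      onStep opMask₀ dimM [(var 4).elt 7, (var 1).elt 7]]]).andThen
    ((lst [var 0, var 4, onStep opShare dimM [(var 1).elt 4, (var 2).elt 7, var 3]]).andThen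
        setLast)

theorem ev_maskedAlgo₀ (v : Values₁ p) : maskedAlgo₀.ev O
    (.list [p.enc, queries₁.enc v, D.enc, queries₀.enc g, .list [encMat X, encMat (D.val2 X),
      encMat (D.val3 X), encMat (D.val4 X), encMat (D.val5 X), encMat (D.val6 X),
      encMat (D.val7 X), encMat (D.val8 X)]]) = queries₁.enc (masked₀ D X g v) := by
  have h1 := ev_opMask₀ O X fun j => v (.op1 j)
  have h2 := ev_osmMask₀ O (D.val2 X) fun i j => v (.osm2 i j)
  have h3 := ev_opMask₀ O (D.val3 X) fun j => v (.op3 j)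
  have h4 := ev_opMask₀ O (D.val4 X) fun j => v (.op4 j)
  have h5 := ev_mulMask₀ O (D.val5 X) (fun i j => v (.mul5 i j)) D.weights
  have h6 := ev_opMask₀ O (D.val6 X) fun j => v (.op6 j)
  have h7 := ev_osmMask₀ O (D.val7 X) fun i j => v (.osm7 i j)
  have h8 := ev_opMask₀ O (D.val8 X) fun j => v (.op8 j)
  have hs := ev_opShare O D.s5 (fun j => g (.op8 j))
    fun j => maskVec (fun e => D.val8 X e j) (v (.op8 j))
  let h : Idx p → Data
    | .op8 j => encAns (maskVec (fun e => D.val8 X e j) (v (.op8 j)))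
    | i => Query.encValue (masked₀ D X g v i)
  have hl := ev_setLast O h (Matrix.of fun i j => opShare₀ D.s5 (g (.op8 j))
    (maskVec (fun e => D.val8 X e j) (v (.op8 j))).2.2 i)
  set x := Data.list [p.enc, queries₁.enc v, D.enc, queries₀.enc g, .list [encMat X,
    encMat (D.val2 X), encMat (D.val3 X), encMat (D.val4 X), encMat (D.val5 X),
    encMat (D.val6 X), encMat (D.val7 X), encMat (D.val8 X)]]
  have e1 : (onStep opMask₀ dimN [(var 4).elt 0, (var 1).elt 0]).ev O x = _ :=
    (ev_onStep ..).trans h1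
  have e2 : (onStep osmMask₀ dimN [(var 4).elt 1, (var 1).elt 1]).ev O x = _ :=
    (ev_onStep ..).trans h2
  have e3 : (onStep opMask₀ dimT [(var 4).elt 2, (var 1).elt 2]).ev O x = _ :=
    (ev_onStep ..).trans h3
  have e4 : (onStep opMask₀ dimT [(var 4).elt 3, (var 1).elt 3]).ev O x = _ :=
    (ev_onStep ..).trans h4
  have e5 : (onStep mulMask₀ dimT [(var 4).elt 4, (var 1).elt 4, (var 2).elt 5]).ev O x = _ :=
    (ev_onStep ..).trans h5
  have e6 : (onStep opMask₀ dimT [(var 4).elt 5, (var 1).elt 5]).ev O x = _ :=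
    (ev_onStep ..).trans h6
  have e7 : (onStep osmMask₀ dimM [(var 4).elt 6, (var 1).elt 6]).ev O x = _ :=
    (ev_onStep ..).trans h7
  have e8 : (onStep opMask₀ dimM [(var 4).elt 7, (var 1).elt 7]).ev O x = _ :=
    (ev_onStep ..).trans h8
  rw [maskedAlgo₀, ev_andThen, ev_lst]
  simp only [List.map_cons, List.map_nil, ev_lst, e1, e2, e3, e4, e5, e6, e7, e8]
  rw [ev_andThen]
  change setLast.ev O ((lst [var 0, var 4, onStep opShare dimM [(var 1).elt 4, (var 2).elt 7,
    var 3]]).ev O (.list [p.enc, D.enc, queries₀.enc g, .list (List.ofFn fun j =>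
      encAns (maskVec (fun e => D.val8 X e j) (v (.op8 j)))), Idx.table h])) = _
  rw [ev_lst]
  simp only [List.map_cons, List.map_nil]
  rw [ev_onStep]
  refine Eq.trans (congrArg (fun z => setLast.ev O (.list [p.enc, Idx.table h, z])) hs)
    (hl.trans (congrArg Idx.table (funext fun i => ?_)))
  cases i <;> rfl

end Party₀

/-- Computes the messages to `P₁` from the values that it receives. The input lists the public
parameters and these values. -/
def messagesAlgo₁ : Algo :=
  app (app (app (app (app (app (app
    ((lst [dimN, dimD, (var 1).elt 0]).andThen opMsg₁)
    ((lst [dimN, dimD, (var 1).elt 1]).andThen osmMsg₁))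
    ((lst [dimT, dimD, (var 1).elt 2]).andThen opMsg₁))
    ((lst [dimT, dimD, (var 1).elt 3]).andThen opMsg₁))
    ((lst [dimT, dimD, (var 1).elt 4]).andThen mulMsg₁))
    ((lst [dimT, dimD, (var 1).elt 5]).andThen opMsg₁))
    ((lst [dimM, dimD, (var 1).elt 6]).andThen osmMsg₁))
    ((lst [dimM, dimD, (var 1).elt 7]).andThen lastMsg₁)

theorem ev_messagesAlgo₁ (w : Values₀ p) :
    messagesAlgo₁.ev O (.list [p.enc, queries₀.enc w]) = .list (messages₁ w) := by
  set x := Data.list [p.enc, queries₀.enc w]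
  have h1 : ((lst [dimN, dimD, (var 1).elt 0]).andThen opMsg₁).ev O x = _ :=
    ev_opMsg₁ O (.unary p.n) fun j => w (.op1 j)
  have h2 : ((lst [dimN, dimD, (var 1).elt 1]).andThen osmMsg₁).ev O x = _ :=
    ev_osmMsg₁ O fun i j => w (.osm2 i j)
  have h3 : ((lst [dimT, dimD, (var 1).elt 2]).andThen opMsg₁).ev O x = _ :=
    ev_opMsg₁ O (.unary p.t) fun j => w (.op3 j)
  have h4 : ((lst [dimT, dimD, (var 1).elt 3]).andThen opMsg₁).ev O x = _ :=
    ev_opMsg₁ O (.unary p.t) fun j => w (.op4 j)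
  have h5 : ((lst [dimT, dimD, (var 1).elt 4]).andThen mulMsg₁).ev O x = _ :=
    ev_mulMsg₁ O fun i j => w (.mul5 i j)
  have h6 : ((lst [dimT, dimD, (var 1).elt 5]).andThen opMsg₁).ev O x = _ :=
    ev_opMsg₁ O (.unary p.t) fun j => w (.op6 j)
  have h7 : ((lst [dimM, dimD, (var 1).elt 6]).andThen osmMsg₁).ev O x = _ :=
    ev_osmMsg₁ O fun i j => w (.osm7 i j)
  have h8 : ((lst [dimM, dimD, (var 1).elt 7]).andThen lastMsg₁).ev O x = _ :=
    ev_lastMsg₁ O fun j => w (.op8 j)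
  rw [messagesAlgo₁]
  simp only [ev_app, h1, h2, h3, h4, h5, h6, h7, h8, Data.app_list]
  rfl

/-- Computes the values that `P₁` receives; the input has the shared value before the multiplication
by the weights as a fifth element. -/
def receivedAlgo₁ : Algo :=
  (lst [var 0, onStep opMask₁ dimM [(var 2).elt 4, (var 1).elt 7, (var 3).elt 7],
    lst [onStep opMask₁ dimN [(var 2).elt 0, (var 1).elt 0, (var 3).elt 0],
      onStep osmMask₁ dimN [(var 2).elt 7, (var 1).elt 1, (var 3).elt 1],
      onStep opMask₁ dimT [(var 2).elt 1, (var 1).elt 2, (var 3).elt 2],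
      onStep opMask₁ dimT [(var 2).elt 2, (var 1).elt 3, (var 3).elt 3],
      onStep mulMask₁ dimT [(var 2).elt 5, (var 1).elt 4, (var 3).elt 4, var 4,
        (lst [dimT, dimD, onStep opMask₁ dimT [(var 2).elt 2, (var 1).elt 3,
          (var 3).elt 3]]).andThen opShare₁],
      onStep opMask₁ dimT [(var 2).elt 3, (var 1).elt 5, (var 3).elt 5],
      onStep osmMask₁ dimM [(var 2).elt 6, (var 1).elt 6, (var 3).elt 6],
      onStep opMask₁ dimM [(var 2).elt 4, (var 1).elt 7, (var 3).elt 7]]]).andThen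
    ((lst [var 0, var 2, (lst [dimM, dimD, var 1]).andThen opShare₁]).andThen setLast)

theorem ev_receivedAlgo₁ (D : Decomp p) (X : Matrix (Fin p.n) (Fin p.d) p.R) (g : Values₀ p)
    (v : Values₁ p) : receivedAlgo₁.ev O
      (.list [p.enc, queries₀.enc g, D.enc, queries₁.enc v, encMat (D.val5 X)]) =
      queries₀.enc (received₁ D X v g) := by
  have h1 := ev_opMask₁ O D.s1 (fun j => g (.op1 j)) fun j => v (.op1 j)
  have h2 := ev_osmMask₁ O (r := D.ncol) (fun i j => g (.osm2 i j)) fun i j => v (.osm2 i j)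
  have h3 := ev_opMask₁ O D.s2 (fun j => g (.op3 j)) fun j => v (.op3 j)
  have h4 := ev_opMask₁ O D.s3 (fun j => g (.op4 j)) fun j => v (.op4 j)
  have h4' := ev_opShare₁ O fun j => opReceived (L := p.L) D.s3 (g (.op4 j)) (v (.op4 j)).2.2
  have h5 := ev_mulMask₁ O D.weights (fun i j => g (.mul5 i j)) (fun i j => v (.mul5 i j))
    (D.val5 X) (Matrix.of fun i j =>
      shareOf (opReceived (L := p.L) D.s3 (g (.op4 j)) (v (.op4 j)).2.2) i)
  have h6 := ev_opMask₁ O D.s4 (fun j => g (.op6 j)) fun j => v (.op6 j)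
  have h7 := ev_osmMask₁ O (r := D.nrow) (fun i j => g (.osm7 i j)) fun i j => v (.osm7 i j)
  have h8 := ev_opMask₁ O D.s5 (fun j => g (.op8 j)) fun j => v (.op8 j)
  have h8' := ev_opShare₁ O fun j => opReceived (L := p.L) D.s5 (g (.op8 j)) (v (.op8 j)).2.2
  let h : Idx p → Data
    | .op8 j => encAns (opReceived (L := p.L) D.s5 (g (.op8 j)) (v (.op8 j)).2.2)
    | i => Query.encValue (received₁ D X v g i)
  have hl := ev_setLast O h (Matrix.of fun i j =>
    shareOf (opReceived (L := p.L) D.s5 (g (.op8 j)) (v (.op8 j)).2.2) i)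
  set x := Data.list [p.enc, queries₀.enc g, D.enc, queries₁.enc v, encMat (D.val5 X)] with hx
  have e1 : (onStep opMask₁ dimN [(var 2).elt 0, (var 1).elt 0, (var 3).elt 0]).ev O x = _ :=
    (ev_onStep ..).trans h1
  have e2 : (onStep osmMask₁ dimN [(var 2).elt 7, (var 1).elt 1, (var 3).elt 1]).ev O x = _ :=
    (ev_onStep ..).trans h2
  have e3 : (onStep opMask₁ dimT [(var 2).elt 1, (var 1).elt 2, (var 3).elt 2]).ev O x = _ :=
    (ev_onStep ..).trans h3
  have e4 : (onStep opMask₁ dimT [(var 2).elt 2, (var 1).elt 3, (var 3).elt 3]).ev O x = _ :=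
    (ev_onStep ..).trans h4
  have e4' : ((lst [dimT, dimD, onStep opMask₁ dimT [(var 2).elt 2, (var 1).elt 3,
      (var 3).elt 3]]).andThen opShare₁).ev O x = encMat (Matrix.of fun i j =>
        shareOf (opReceived (L := p.L) D.s3 (g (.op4 j)) (v (.op4 j)).2.2) i) := by
    rw [ev_andThen, ev_lst, List.map_cons, List.map_cons, List.map_cons, List.map_nil, e4]
    exact h4'
  have e5 : (onStep mulMask₁ dimT [(var 2).elt 5, (var 1).elt 4, (var 3).elt 4, var 4,
      (lst [dimT, dimD, onStep opMask₁ dimT [(var 2).elt 2, (var 1).elt 3,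
        (var 3).elt 3]]).andThen opShare₁]).ev O x = .list (List.ofFn fun i =>
          .list (List.ofFn fun j => Query.encValue (received₁ D X v g (.mul5 i j)))) := by
    rw [hx, ev_onStep, List.map_cons, List.map_cons, List.map_cons, List.map_cons, List.map_cons,
      List.map_nil, ← hx, e4']
    exact h5
  have e6 : (onStep opMask₁ dimT [(var 2).elt 3, (var 1).elt 5, (var 3).elt 5]).ev O x = _ :=
    (ev_onStep ..).trans h6
  have e7 : (onStep osmMask₁ dimM [(var 2).elt 6, (var 1).elt 6, (var 3).elt 6]).ev O x = _ :=
    (ev_onStep ..).trans h7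
  have e8 : (onStep opMask₁ dimM [(var 2).elt 4, (var 1).elt 7, (var 3).elt 7]).ev O x = _ :=
    (ev_onStep ..).trans h8
  rw [receivedAlgo₁, ev_andThen, ev_lst]
  simp only [List.map_cons, List.map_nil, ev_lst, e1, e2, e3, e4, e5, e6, e7, e8]
  rw [ev_andThen]
  change setLast.ev O ((lst [var 0, var 2, (lst [dimM, dimD, var 1]).andThen opShare₁]).ev O
    (.list [p.enc, .list (List.ofFn fun j =>
      encAns (opReceived (L := p.L) D.s5 (g (.op8 j)) (v (.op8 j)).2.2)), Idx.table h])) = _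
  rw [ev_lst]
  simp only [List.map_cons, List.map_nil]
  refine Eq.trans (congrArg (fun z => setLast.ev O (.list [p.enc, Idx.table h, z])) h8')
    (hl.trans (congrArg Idx.table (funext fun i => ?_)))
  cases i <;> rfl

end Algo

end

end SMM
namespace SMM

noncomputable section

/-! ### From pseudorandomness to simulation -/

/-- The two halves of the beginning of a long random tape are independent and uniform. -/
theorem map_coins_halves {α : Type} {lam l : ℕ} (h : lam + lam ≤ l)
    (f : (Fin lam → Bool) → (Fin lam → Bool) → α) :
    (coins l).map (fun r => f (fun i => r ⟨i, by omega⟩) fun i => r ⟨i + lam, by omega⟩) =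
      (coins lam).bind fun k => (coins lam).map (f k) := by
  let e : Fin lam ⊕ Fin lam → Fin l :=
    Sum.elim (fun i => ⟨i, by omega⟩) fun i => ⟨i + lam, by omega⟩
  have he : Function.Injective e := by
    rintro (i | i) (j | j) hij <;> simp only [e, Sum.elim_inl, Sum.elim_inr, Fin.mk.injEq] at hij
    · rw [Fin.ext hij]
    · omega
    · omega
    · rw [Fin.ext (Nat.add_right_cancel hij)]
  have h1 := (restrictLens (fun _ : Fin l => Bool) e he).map_get
  have h2 := map_uniform_of_bijective (Equiv.sumArrowEquivProdArrow (Fin lam) (Fin lam)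
      Bool).bijective
  rw [← h1, PMF.map_comp, ← uniform_prod] at h2
  have h3 := congrArg (PMF.map fun x : (Fin lam → Bool) × (Fin lam → Bool) => f x.1 x.2) h2
  rw [PMF.map_comp, PMF.map_bind] at h3
  simp only [PMF.map_comp] at h3
  exact h3

/-- A bound on the size of a matrix whose dimensions and bit length are bounded. -/
def matPoly : Polynomial ℕ := Polynomial.X * (Polynomial.X * (Polynomial.X + 2) + 2) + 1

theorem encMat_size_le_matPoly {k d L N : ℕ} (hk : k ≤ N) (hd : d ≤ N) (hL : L ≤ N)
    (M : Matrix (Fin k) (Fin d) (ZMod (2 ^ L))) : (encMat M).size ≤ matPoly.eval N := by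
  refine (encMat_size_le M).trans ?_
  simp only [matPoly, Polynomial.eval_add, Polynomial.eval_mul, Polynomial.eval_X,
    Polynomial.eval_ofNat, Polynomial.eval_one]
  gcongr

theorem Params.le_enc_size (p : Params) : p.m ≤ p.enc.size ∧ p.n ≤ p.enc.size ∧
    p.d ≤ p.enc.size ∧ p.t ≤ p.enc.size ∧ p.L ≤ p.enc.size := by
  rw [Params.enc_size_eq]
  omega

namespace QueryFamily

/-- Computes the values of the keyed function at all queries of one run. The input is a list whose
first, third and fourth elements are the public parameters, the security parameter and the key. -/
def keyAnswers (Q : QueryFamily) (F : KeyedFunction) : Algo :=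
  Q.answers ((Algo.lst [(Algo.up 1).elt 2, (Algo.up 1).elt 3, .var 0]).andThen
    (.ofProg F.prog F.poly))

theorem ev_keyAnswers (Q : QueryFamily) (F : KeyedFunction) (O) {p : Params} {lam : ℕ}
    (key : Fin lam → Bool) {x : Data} (h0 : x.nth 0 = p.enc) (h2 : x.nth 2 = .unary lam)
    (h3 : x.nth 3 = .bits key) : (Q.keyAnswers F).ev O x = Q.enc (Q.ofKey F p lam key) := by
  rw [keyAnswers, Q.ev_answers _ O h0]
  refine congrArg Idx.table (funext fun i => ?_)
  rw [Algo.ev_andThen, Algo.ev_ofProg, Algo.ev_lst]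
  simp only [List.map_cons, List.map_nil, Algo.ev_elt, Algo.ev_up_succ, Algo.ev_up_zero,
    Data.snd_pair, Algo.ev_var, Algo.nth_pair_zero, h2, h3]
  exact F.computes lam key (Q.query i)

end QueryFamily

/-- The joint sample of the view of a party, of its output and of the output of the other party, in
the order in which the outputs of `P₀` and `P₁` are listed. -/
def sample (first : Bool) (v y y' : Data) : Data :=
  if first then .list [v, y, y'] else .list [v, y', y]

/-- What the security proof uses about the corruption of a party: its view and its output are
computable from a family of values `w` that correspond to the queries of the other party, and in an
execution these values are the image under a computable bijection `mask` of the answers to these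
queries. -/
structure Corruption (F : KeyedFunction) (Q : QueryFamily) where
  /-- Whether the party is `P₀`. -/
  first : Bool
  /-- The encoded input of the party. -/
  input : ∀ {p : Params}, SparseMat p → Matrix (Fin p.n) (Fin p.d) p.R → Data
  /-- Further data that the computation of `mask` needs. -/
  extra : ∀ {p : Params}, SparseMat p → Matrix (Fin p.n) (Fin p.d) p.R → Data
  size : ∃ P : Polynomial ℕ, ∀ {p : Params} (A : SparseMat p) X,
    (input A X).size + (extra A X).size ≤ P.eval p.enc.size
  /-- The output of the party as a part of the values `w`. -/
  lens : ∀ p : Params, Lens (Q.Values p) (Fin p.m → Fin p.d → p.R)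
  ev_setLast : ∀ (O) {p : Params} (w : Q.Values p) Y, Algo.setLast.ev O
    (.list [p.enc, Q.enc w, encMat (Matrix.of Y)]) = Q.enc ((lens p).put Y w)
  ev_getLast : ∀ (O) {p : Params} (w : Q.Values p), Algo.getLast.ev O (.list [p.enc, Q.enc w]) =
    encMat (Matrix.of ((lens p).get w))
  /-- Computes the view from the public parameters, the input, the security parameter, the key and
  the values `w`. -/
  view : Algo
  /-- The values `w` in an execution, as a function of the answers of the other party. -/
  mask : ∀ {p : Params} (_ : SparseMat p) (_ : Matrix (Fin p.n) (Fin p.d) p.R) {lam : ℕ}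
    (_ : Fin lam → Bool), Q.Values p → Q.Values p
  bijective : ∀ {p : Params} (A : SparseMat p) X {lam : ℕ} (key : Fin lam → Bool),
    Function.Bijective (mask A X key)
  /-- Computes `mask`. -/
  maskAlgo : Algo
  ev_maskAlgo : ∀ (O) {p : Params} (A : SparseMat p) X {lam : ℕ} (key : Fin lam → Bool)
    (v : Q.Values p), maskAlgo.ev O (.list [p.enc, input A X, .unary lam, .bits key, Q.enc v,
      extra A X]) = Q.enc (mask A X key v)

namespace Corruption

variable {F : KeyedFunction} {Q : QueryFamily} (M : Corruption F Q)

/-- The view and the outputs, as functions of the values `w`. -/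
def result {p : Params} (A : SparseMat p) (X : Matrix (Fin p.n) (Fin p.d) p.R) {lam : ℕ}
    (key : Fin lam → Bool) (w : Q.Values p) : Data :=
  sample M.first
    (M.view.ev Prog.noOracle (.list [p.enc, M.input A X, .unary lam, .bits key, Q.enc w]))
    (encMat (Matrix.of ((M.lens p).get w))) (encMat (A.1 * X - Matrix.of ((M.lens p).get w)))

/-- Computes the output of a distinguisher on the view and the outputs. The input lists a list `z`
of what does not depend on the key of the other party, and the values `w`. -/
def judge (D : Distinguisher) : Algo :=
  (Algo.lst [(Algo.var 0).elt 2, (Algo.var 0).elt 6, (Algo.var 0).elt 7,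
    (Algo.lst [
      (Algo.lst [(Algo.var 0).elt 0, (Algo.var 0).elt 1, (Algo.var 0).elt 2, (Algo.var 0).elt 3,
        Algo.var 1]).andThen M.view,
      (Algo.lst [(Algo.var 0).elt 0, Algo.var 1]).andThen Algo.getLast,
      (Algo.lst [(Algo.var 0).elt 0, (Algo.lst [(Algo.var 0).elt 0, Algo.var 1]).andThen
          Algo.getLast,
        (Algo.var 0).elt 5]).andThen (Algo.onStep Algo.subMat Algo.dimM [Algo.var 1, Algo.var 2])
      ]).andThen (if M.first then .id else Algo.lst [Algo.var 0, Algo.var 2, Algo.var 1])]).andThen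
    (.ofProg D.prog D.poly)

/-- The part of the input of `judge` that does not depend on the key of the other party. -/
def context (D : Distinguisher) {p : Params} (A : SparseMat p)
    (X : Matrix (Fin p.n) (Fin p.d) p.R) {lam : ℕ} (key : Fin lam → Bool)
    (r : Fin (D.tape.eval lam) → Bool) (Y : Fin p.m → Fin p.d → p.R) : Data :=
  .list [p.enc, M.input A X, .unary lam, .bits key, M.extra A X, encMat (A.1 * X), D.advice lam,
    .bits r, encMat (Matrix.of Y)]

variable (D : Distinguisher) {p : Params} (A : SparseMat p) (X : Matrix (Fin p.n) (Fin p.d) p.R)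
  {lam : ℕ} (key : Fin lam → Bool) (r : Fin (D.tape.eval lam) → Bool)

/-- The output of the distinguisher as a function of the values `w`. -/
def verdict (w : Q.Values p) : Data :=
  D.prog.run (.list [.unary lam, D.advice lam, .bits r, M.result A X key w])

theorem ev_judge (Y : Fin p.m → Fin p.d → p.R) (w : Q.Values p) :
    (M.judge D).ev Prog.noOracle (.list [M.context D A X key r Y, Q.enc w]) =
      M.verdict D A X key r w := by
  have hg := M.ev_getLast Prog.noOracle w
  have hs := Algo.ev_subMat Prog.noOracle (Matrix.of ((M.lens p).get w)) (A.1 * X)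
  rw [judge, Algo.ev_andThen, Algo.ev_ofProg, verdict]
  congr 1
  rw [Algo.ev_lst]
  have h4 : ((Algo.lst [
      (Algo.lst [(Algo.var 0).elt 0, (Algo.var 0).elt 1, (Algo.var 0).elt 2, (Algo.var 0).elt 3,
        Algo.var 1]).andThen M.view,
      (Algo.lst [(Algo.var 0).elt 0, Algo.var 1]).andThen Algo.getLast,
      (Algo.lst [(Algo.var 0).elt 0, (Algo.lst [(Algo.var 0).elt 0, Algo.var 1]).andThen
          Algo.getLast,
        (Algo.var 0).elt 5]).andThen (Algo.onStep Algo.subMat Algo.dimM [Algo.var 1, Algo.var 2])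
      ]).andThen (if M.first then .id else Algo.lst [Algo.var 0, Algo.var 2, Algo.var 1])).ev
        Prog.noOracle (.list [M.context D A X key r Y, Q.enc w]) = M.result A X key w := by
    rw [Algo.ev_andThen, Algo.ev_lst]
    simp only [List.map_cons, List.map_nil, Algo.ev_andThen, Algo.ev_lst, Algo.ev_elt, Algo.ev_var,
      Data.nth_list_zero, Data.nth_list_succ, context, hg, Algo.ev_onStep, Algo.ev_dimM, hs]
    rw [result, sample]
    cases M.first <;> simp
  simp only [List.map_cons, List.map_nil, h4]
  rfl

/-- The test that compares executions. -/
def realTest : Algo :=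
  (Algo.lst [Algo.var 0, (Algo.lst [(Algo.var 0).elt 0, (Algo.var 0).elt 1, (Algo.var 0).elt 2,
    (Algo.var 0).elt 3, .snd, (Algo.var 0).elt 4]).andThen M.maskAlgo]).andThen (M.judge D)

/-- The test that compares simulated executions. -/
def idealTest : Algo :=
  (Algo.lst [Algo.var 0, (Algo.lst [(Algo.var 0).elt 0, .snd, (Algo.var 0).elt 8]).andThen
    Algo.setLast]).andThen (M.judge D)

theorem ev_realTest (Y : Fin p.m → Fin p.d → p.R) (v : Q.Values p) :
    (M.realTest D).ev Prog.noOracle (.pair (M.context D A X key r Y) (Q.enc v)) =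
      M.verdict D A X key r (M.mask A X key v) := by
  rw [realTest, Algo.ev_andThen, Algo.ev_lst, ← ev_judge M D A X key r Y]
  simp only [List.map_cons, List.map_nil, Algo.ev_andThen]
  exact congrArg (fun z => (M.judge D).ev Prog.noOracle (.list [M.context D A X key r Y, z]))
    (M.ev_maskAlgo Prog.noOracle A X key v)

theorem ev_idealTest (Y : Fin p.m → Fin p.d → p.R) (v : Q.Values p) :
    (M.idealTest D).ev Prog.noOracle (.pair (M.context D A X key r Y) (Q.enc v)) =
      M.verdict D A X key r ((M.lens p).put Y v) := by
  rw [idealTest, Algo.ev_andThen, Algo.ev_lst, ← ev_judge M D A X key r Y]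
  simp only [List.map_cons, List.map_nil, Algo.ev_andThen]
  exact congrArg (fun z => (M.judge D).ev Prog.noOracle (.list [M.context D A X key r Y, z]))
    (M.ev_setLast Prog.noOracle v Y)

/-- The contexts have polynomial size. -/
theorem exists_context_bound (q : Polynomial ℕ) : ∃ P : Polynomial ℕ,
    (∀ n, q.eval n ≤ P.eval n) ∧
    ∀ {p : Params} (A : SparseMat p) X {lam : ℕ} (key : Fin lam → Bool)
      (r : Fin (D.tape.eval lam) → Bool) Y, p.enc.size ≤ q.eval lam →
      (M.context D A X key r Y).size ≤ P.eval lam := by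
  obtain ⟨P, hP⟩ := M.size
  obtain ⟨Pa, hPa⟩ := D.advice_poly
  refine ⟨q + P.comp q + matPoly.comp q + matPoly.comp q + 5 * Polynomial.X + Pa + 3 * D.tape + 40,
    fun n => ?_, fun {p} A X {lam} key r Y hp => ?_⟩
  · simp only [Polynomial.eval_add]
    omega
  · obtain ⟨hm, -, hd, -, hL⟩ := p.le_enc_size
    have h1 := (hP A X).trans (natPoly_eval_mono P hp)
    have h2 := encMat_size_le_matPoly (hm.trans hp) (hd.trans hp) (hL.trans hp) (A.1 * X)
    have h3 := encMat_size_le_matPoly (hm.trans hp) (hd.trans hp) (hL.trans hp) (Matrix.of Y)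
    have h4 := hPa lam
    have h5 := bits_size_le r
    have h6 := bits_size_le key
    have h7 := Data.unary_size lam
    simp only [context, Data.list, Data.size, Nat.size_zero, Polynomial.eval_add,
      Polynomial.eval_mul, Polynomial.eval_comp, Polynomial.eval_X, Polynomial.eval_ofNat]
    omega

/-! The simulator -/

/-- Computes a simulated view. The input is a pair of a list of the security parameter, the public
parameters, the input of the party and its output, and of a random tape, whose beginning serves as
the key of the party and as a key for the simulation of the other party. -/
def simulatorAlgo : Algo :=
  (Algo.lst [(Algo.var 0).elt 1, (Algo.var 0).elt 2, (Algo.var 0).elt 0,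
    Algo.tab ((Algo.var 0).elt 0) ((Algo.up 2).nth (.var 0)),
    (Algo.lst [(Algo.var 0).elt 1,
      (Algo.lst [(Algo.var 0).elt 1, 0, (Algo.var 0).elt 0, Algo.tab ((Algo.var 0).elt 0)
        ((Algo.up 2).nth (.var 0 + ((Algo.var 1).elt 0).andThen .len))]).andThen (Q.keyAnswers F),
      (Algo.var 0).elt 3]).andThen Algo.setLast]).andThen M.view

/-- The simulator. A fresh key for the other party replaces its key, and the values of the last step
are overwritten by the given output of the party. Its tape is as long as its input, which contains
the security parameter in unary, and so is long enough for two keys. -/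
def simulator : PPT where
  prog := M.simulatorAlgo.prog
  poly := M.simulatorAlgo.polyTime
  tape := Polynomial.X

theorem nth_bits {l : ℕ} (r : Fin l → Bool) {i : ℕ} (h : i < l) :
    (Data.bits r).nth i = .nat (if r ⟨i, h⟩ then 1 else 0) :=
  Data.nth_list_ofFn (fun i => .nat (if r i then 1 else 0)) ⟨i, h⟩

theorem run_simulatorAlgo {l : ℕ} (h : lam + lam ≤ l) (Y : Fin p.m → Fin p.d → p.R)
    (t : Fin l → Bool) : M.simulatorAlgo.ev Prog.noOracle (.pair (.list [.unary lam, p.enc,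
      M.input A X, encMat (Matrix.of Y)]) (.bits t)) =
      M.view.ev Prog.noOracle (.list [p.enc, M.input A X, .unary lam,
        .bits fun i : Fin lam => t ⟨i, by omega⟩, Q.enc ((M.lens p).put Y
          (Q.ofKey F p lam fun i => t ⟨i + lam, by omega⟩))]) := by
  set x : Data := .pair (.list [.unary lam, p.enc, M.input A X, encMat (Matrix.of Y)]) (.bits t)
  have h1 : (Algo.tab ((Algo.var 0).elt 0) ((Algo.up 2).nth (.var 0))).ev Prog.noOracle x =
      .bits fun i : Fin lam => t ⟨i, by omega⟩ := by
    rw [Algo.ev_tab]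
    simp only [Algo.ev_elt, Algo.ev_var, x, Algo.nth_pair_zero, Data.nth_list_zero,
      Data.length_unary]
    refine (Data.list_ofFn_eq_tab fun i => ?_).symm
    simp only [Algo.ev_nth, Algo.ev_var, Algo.nth_pair_zero, Data.toNat_nat, Algo.ev_up_succ,
      Algo.ev_up_zero, Data.snd_pair]
    exact nth_bits t _
  have h2 : (Algo.tab ((Algo.var 0).elt 0)
      ((Algo.up 2).nth (.var 0 + ((Algo.var 1).elt 0).andThen .len))).ev Prog.noOracle x =
      .bits fun i : Fin lam => t ⟨i + lam, by omega⟩ := by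
    rw [Algo.ev_tab]
    simp only [Algo.ev_elt, Algo.ev_var, x, Algo.nth_pair_zero, Data.nth_list_zero,
      Data.length_unary]
    refine (Data.list_ofFn_eq_tab fun i => ?_).symm
    simp only [Algo.ev_nth, Algo.ev_add, Algo.ev_andThen, Algo.ev_elt, Algo.ev_len, Algo.ev_var,
      Algo.nth_pair_zero, Algo.nth_pair_succ, Data.nth_list_zero, Data.length_unary, Data.toNat_nat,
      Algo.ev_up_succ, Algo.ev_up_zero, Data.snd_pair]
    exact nth_bits t _
  have h3 : (Q.keyAnswers F).ev Prog.noOracle (.list [p.enc, .nat 0, .unary lam,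
      .bits fun i : Fin lam => t ⟨i + lam, by omega⟩]) =
      Q.enc (Q.ofKey F p lam fun i => t ⟨i + lam, by omega⟩) :=
    Q.ev_keyAnswers F Prog.noOracle _ rfl rfl rfl
  rw [simulatorAlgo, Algo.ev_andThen]
  congr 1
  rw [Algo.ev_lst]
  simp only [List.map_cons, List.map_nil, Algo.ev_andThen, Algo.ev_lst, h1, h2]
  simp only [Algo.ev_elt, Algo.ev_var, Algo.ev_ofNat, x, Algo.nth_pair_zero, Data.nth_list_zero,
    Data.nth_list_succ, h3, M.ev_setLast]

theorem run_simulator (Y : Fin p.m → Fin p.d → p.R) :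
    M.simulator.run (.list [.unary lam, p.enc, M.input A X, encMat (Matrix.of Y)]) =
      (coins lam).bind fun key => (coins lam).map fun key' =>
        M.view.ev Prog.noOracle (.list [p.enc, M.input A X, .unary lam, .bits key,
          Q.enc ((M.lens p).put Y (Q.ofKey F p lam key'))]) := by
  have h : lam + lam ≤ M.simulator.tape.eval
      (Data.list [.unary lam, p.enc, M.input A X, encMat (Matrix.of Y)]).size := by
    have := Data.unary_size lam
    simp only [simulator, Polynomial.eval_X, Data.list, Data.size]
    omega
  rw [← map_coins_halves h, PPT.run]
  refine congrArg (PMF.map · _) (funext fun t => ?_)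
  exact M.run_simulatorAlgo A X h Y t

/-! Indistinguishability -/

/-- The joint distribution of the view and the outputs in an execution. -/
def realLaw {p : Params} (A : SparseMat p) (X : Matrix (Fin p.n) (Fin p.d) p.R) (lam : ℕ) :
    PMF Data :=
  (coins lam).bind fun key => (coins lam).map fun key' =>
    M.result A X key (M.mask A X key (Q.ofKey F p lam key'))

/-- The joint distribution of the simulated view and the outputs of the ideal functionality. -/
def idealLaw {p : Params} (A : SparseMat p) (X : Matrix (Fin p.n) (Fin p.d) p.R) (lam : ℕ) :
    PMF Data :=
  (PMF.uniformOfFintype (Fin p.m → Fin p.d → p.R)).bind fun Y =>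
    (M.simulator.run (.list [.unary lam, p.enc, M.input A X, encMat (Matrix.of Y)])).map fun v =>
      sample M.first v (encMat (Matrix.of Y)) (encMat (A.1 * X - Matrix.of Y))

theorem realLaw_bind : (M.realLaw A X lam).bind (D.run lam) =
    (coins lam).bind fun key => (coins (D.tape.eval lam)).bind fun r =>
      (coins lam).map fun key' =>
        M.verdict D A X key r (M.mask A X key (Q.ofKey F p lam key')) := by
  rw [realLaw, PMF.bind_bind]
  refine congrArg (PMF.bind _) (funext fun key => ?_)
  rw [PMF.bind_map]
  exact PMF.bind_comm _ _ fun key' r => PMF.pure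
    (M.verdict D A X key r (M.mask A X key (Q.ofKey F p lam key')))

theorem idealLaw_bind : (M.idealLaw A X lam).bind (D.run lam) =
    (coins lam).bind fun key => (coins (D.tape.eval lam)).bind fun r =>
      (PMF.uniformOfFintype (Fin p.m → Fin p.d → p.R)).bind fun Y => (coins lam).map fun key' =>
        M.verdict D A X key r ((M.lens p).put Y (Q.ofKey F p lam key')) := by
  have h (Y : Fin p.m → Fin p.d → p.R) :
      ((M.simulator.run (.list [.unary lam, p.enc, M.input A X, encMat (Matrix.of Y)])).map fun v =>
        sample M.first v (encMat (Matrix.of Y)) (encMat (A.1 * X - Matrix.of Y))) =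
      (coins lam).bind fun key => (coins lam).map fun key' =>
        M.result A X key ((M.lens p).put Y (Q.ofKey F p lam key')) := by
    rw [run_simulator, PMF.map_bind]
    simp only [PMF.map_comp]
    refine congrArg (PMF.bind _) (funext fun key => congrArg (PMF.map · _) (funext fun key' => ?_))
    simp only [Function.comp_def, result, (M.lens p).get_put]
  rw [idealLaw]
  simp only [h]
  rw [PMF.bind_bind]
  simp only [PMF.bind_bind]
  rw [PMF.bind_comm]
  refine congrArg (PMF.bind _) (funext fun key => ?_)
  rw [PMF.bind_comm (coins (D.tape.eval lam))]
  refine congrArg (PMF.bind _) (funext fun Y => ?_)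
  rw [PMF.bind_map]
  exact PMF.bind_comm _ _ fun key' r => PMF.pure
    (M.verdict D A X key r ((M.lens p).put Y (Q.ofKey F p lam key')))

/-- The view and the outputs in an execution are indistinguishable from the simulated view and the
outputs of the ideal functionality: when the other party's values are truly random, both equal the
result for uniformly random values `w`. -/
theorem exists_negligible (hF : F.IsSecurePRF) (q : Polynomial ℕ) :
    ∃ μ : ℕ → ℝ, Negligible μ ∧ ∀ (lam : ℕ) {p : Params} (A : SparseMat p) X,
      p.enc.size ≤ q.eval lam → |accept ((M.idealLaw A X lam).bind (D.run lam)) -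
        accept ((M.realLaw A X lam).bind (D.run lam))| ≤ μ lam := by
  obtain ⟨P, hqP, hP⟩ := M.exists_context_bound D q
  obtain ⟨μ₁, hμ₁, h₁⟩ := Q.negligible_advantage hF (M.realTest D) P
  obtain ⟨μ₂, hμ₂, h₂⟩ := Q.negligible_advantage hF (M.idealTest D) P
  refine ⟨fun lam => μ₂ lam + μ₁ lam, hμ₂.add hμ₁, fun lam p A X hp => ?_⟩
  -- The verdict when the values `w` are truly random.
  set H : PMF Data := (coins lam).bind fun key => (coins (D.tape.eval lam)).bind fun r =>
    (PMF.uniformOfFintype (Q.Values p)).map (M.verdict D A X key r) with hH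
  have hreal : |accept ((M.realLaw A X lam).bind (D.run lam)) - accept H| ≤ μ₁ lam := by
    rw [realLaw_bind, hH]
    refine abs_accept_bind_sub_le _ _ _ fun key => abs_accept_bind_sub_le _ _ _ fun r => ?_
    have h := h₁ lam p (M.context D A X key r 0) (hp.trans (hqP lam)) (hP A X key r 0 hp)
    simp only [QueryFamily.advantage, ev_realTest] at h
    -- A bijection does not change the uniform distribution.
    have hu : (PMF.uniformOfFintype (Q.Values p)).map
        (fun v => M.verdict D A X key r (M.mask A X key v)) =
        (PMF.uniformOfFintype (Q.Values p)).map (M.verdict D A X key r) := by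
      conv_rhs => rw [← map_uniform_of_bijective (M.bijective A X key), PMF.map_comp]
      rfl
    rwa [hu] at h
  have hideal : |accept ((M.idealLaw A X lam).bind (D.run lam)) - accept H| ≤ μ₂ lam := by
    rw [idealLaw_bind, hH]
    refine abs_accept_bind_sub_le _ _ _ fun key => abs_accept_bind_sub_le _ _ _ fun r => ?_
    -- Overwriting a part of uniformly random values by a uniformly random part does not change their
    -- distribution.
    have hu : (PMF.uniformOfFintype (Q.Values p)).map (M.verdict D A X key r) =
        (PMF.uniformOfFintype (Fin p.m → Fin p.d → p.R)).bind fun Y =>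
          (PMF.uniformOfFintype (Q.Values p)).map fun v =>
            M.verdict D A X key r ((M.lens p).put Y v) := by
      conv_lhs => rw [← (M.lens p).bind_put, PMF.map_bind]
      simp only [PMF.map_comp]
      rfl
    rw [hu]
    refine abs_accept_bind_sub_le _ _ _ fun Y => ?_
    have h := h₂ lam p (M.context D A X key r Y) (hp.trans (hqP lam)) (hP A X key r Y hp)
    simpa only [QueryFamily.advantage, ev_idealTest] using h
  calc _ ≤ _ + |accept H - accept ((M.realLaw A X lam).bind (D.run lam))| :=
        abs_sub_le _ (accept H) _
    _ ≤ _ := add_le_add hideal (by rwa [abs_sub_comm])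

end Corruption

end

end SMM
namespace SMM

noncomputable section

/-! ### Security of sparse matrix multiplication -/

/-- Computes the decomposition of the matrix in the second place of the input. -/
def DecompAlg.algo (alg : DecompAlg) : Algo := .ofProg alg.prog alg.poly

theorem DecompAlg.ev_algo (alg : DecompAlg) (O) {p : Params} (A : SparseMat p) :
    alg.algo.ev O (.list [p.enc, encMat A.1]) = (alg.dec p A).enc := by
  rw [algo, Algo.ev_ofProg, alg.computes]

section Corruptions

variable (F : KeyedFunction) (alg : DecompAlg)

open Algo

/-- The corruption of `P₀`. The values `w` are the masked values, and the computation of `mask` needs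
the shared values of all steps. -/
def corruption₀ : Corruption F queries₁ where
  first := true
  input A _ := encMat A.1
  extra {p} A X := .list [encMat X, encMat ((alg.dec p A).val2 X), encMat ((alg.dec p A).val3 X),
    encMat ((alg.dec p A).val4 X), encMat ((alg.dec p A).val5 X), encMat ((alg.dec p A).val6 X),
    encMat ((alg.dec p A).val7 X), encMat ((alg.dec p A).val8 X)]
  size := by
    refine ⟨9 * matPoly + 100, fun {p} A X => ?_⟩
    obtain ⟨hm, hn, hd, ht, hL⟩ := p.le_enc_size
    have h0 := encMat_size_le_matPoly hm hn hL A.1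
    have h1 := encMat_size_le_matPoly hn hd hL X
    have h2 := encMat_size_le_matPoly hn hd hL ((alg.dec p A).val2 X)
    have h3 := encMat_size_le_matPoly ht hd hL ((alg.dec p A).val3 X)
    have h4 := encMat_size_le_matPoly ht hd hL ((alg.dec p A).val4 X)
    have h5 := encMat_size_le_matPoly ht hd hL ((alg.dec p A).val5 X)
    have h6 := encMat_size_le_matPoly ht hd hL ((alg.dec p A).val6 X)
    have h7 := encMat_size_le_matPoly hm hd hL ((alg.dec p A).val7 X)
    have h8 := encMat_size_le_matPoly hm hd hL ((alg.dec p A).val8 X)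
    simp only [Data.list, Data.size, Nat.size_zero, Polynomial.eval_add, Polynomial.eval_mul,
      Polynomial.eval_ofNat]
    omega
  lens := outLens₁
  ev_setLast O p w Y := (ev_setLast O _ (Matrix.of Y)).trans
    (congrArg Idx.table (funext fun i => by cases i <;> rfl))
  ev_getLast O p w := ev_getLast O fun _ => rfl
  view := lst [var 0, var 1, var 3, (lst [var 0, var 4, (lst [var 0, var 1]).andThen alg.algo,
    queries₀.keyAnswers F]).andThen messagesAlgo₀]
  mask {p} A X {lam} key := masked₀ (alg.dec p A) X (queries₀.ofKey F p lam key)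
  bijective A X _ key := masked₀_bijective _ X _
  maskAlgo := (lst [var 0, var 4, (lst [var 0, var 1]).andThen alg.algo, queries₀.keyAnswers F,
    var 5]).andThen maskedAlgo₀
  ev_maskAlgo O p A X lam key v := by
    have hk := fun W E => queries₀.ev_keyAnswers F O (p := p) key
      (x := .list [p.enc, encMat A.1, .unary lam, .bits key, W, E]) rfl rfl rfl
    rw [ev_andThen, ev_lst]
    simp only [List.map_cons, List.map_nil, hk, ev_andThen, ev_lst, ev_var, Data.nth_list_zero,
      Data.nth_list_succ, alg.ev_algo]
    exact ev_maskedAlgo₀ ..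

theorem ev_corruption₀_view (O) {p : Params} (A : SparseMat p) {lam : ℕ} (key : Fin lam → Bool)
    (w : Values₁ p) : (corruption₀ F alg).view.ev O
      (.list [p.enc, encMat A.1, .unary lam, .bits key, queries₁.enc w]) =
      .list [p.enc, encMat A.1, .bits key,
        .list (messages₀ (alg.dec p A) (queries₀.ofKey F p lam key) w)] := by
  have hk := queries₀.ev_keyAnswers F O (p := p) key
    (x := .list [p.enc, encMat A.1, .unary lam, .bits key, queries₁.enc w]) rfl rfl rfl
  simp only [corruption₀, List.map_cons, List.map_nil, hk, ev_andThen, ev_lst, ev_var,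
    Data.nth_list_zero, Data.nth_list_succ, alg.ev_algo, ev_messagesAlgo₀]

/-- The corruption of `P₁`. The values `w` are those that `P₁` receives, and the computation of `mask`
needs the sparse matrix and the shared value before the multiplication by the weights. -/
def corruption₁ : Corruption F queries₀ where
  first := false
  input _ X := encMat X
  extra {p} A X := .list [encMat A.1, encMat ((alg.dec p A).val5 X)]
  size := by
    refine ⟨3 * matPoly + 100, fun {p} A X => ?_⟩
    obtain ⟨hm, hn, hd, ht, hL⟩ := p.le_enc_size
    have h0 := encMat_size_le_matPoly hm hn hL A.1
    have h1 := encMat_size_le_matPoly hn hd hL X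
    have h5 := encMat_size_le_matPoly ht hd hL ((alg.dec p A).val5 X)
    simp only [Data.list, Data.size, Nat.size_zero, Polynomial.eval_add, Polynomial.eval_mul,
      Polynomial.eval_ofNat]
    omega
  lens := outLens₀
  ev_setLast O p w Y := (ev_setLast O _ (Matrix.of Y)).trans
    (congrArg Idx.table (funext fun i => by cases i <;> rfl))
  ev_getLast O p w := ev_getLast O fun _ => rfl
  view := lst [var 0, var 1, var 3, (lst [var 0, var 4]).andThen messagesAlgo₁]
  mask {p} A X {lam} key := received₁ (alg.dec p A) X (queries₁.ofKey F p lam key)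
  bijective A X _ key := received₁_bijective _ X _
  maskAlgo := (lst [var 0, var 4, (lst [var 0, (var 5).elt 0]).andThen alg.algo,
    queries₁.keyAnswers F, (var 5).elt 1]).andThen receivedAlgo₁
  ev_maskAlgo O p A X lam key g := by
    have hk := fun W E => queries₁.ev_keyAnswers F O (p := p) key
      (x := .list [p.enc, encMat X, .unary lam, .bits key, W, E]) rfl rfl rfl
    rw [ev_andThen, ev_lst]
    simp only [List.map_cons, List.map_nil, hk, ev_andThen, ev_lst, ev_var, ev_elt,
      Data.nth_list_zero, Data.nth_list_succ, alg.ev_algo]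
    exact ev_receivedAlgo₁ ..

theorem ev_corruption₁_view (O) {p : Params} (X : Matrix (Fin p.n) (Fin p.d) p.R) {lam : ℕ}
    (key : Fin lam → Bool) (w : Values₀ p) : (corruption₁ F alg).view.ev O
      (.list [p.enc, encMat X, .unary lam, .bits key, queries₀.enc w]) =
      .list [p.enc, encMat X, .bits key, .list (messages₁ w)] := by
  simp only [corruption₁, List.map_cons, List.map_nil, ev_andThen, ev_lst, ev_var,
    Data.nth_list_zero, Data.nth_list_succ, ev_messagesAlgo₁]

end Corruptions

section Laws

variable (F : KeyedFunction) (alg : DecompAlg) {p : Params} (A : SparseMat p)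
  (X : Matrix (Fin p.n) (Fin p.d) p.R) (lam : ℕ)

theorem smmRun_share_add_eq (G₀ G₁ : Rand) : (smmRun G₀ G₁ (alg.dec p A) X).share₀ +
    (smmRun G₀ G₁ (alg.dec p A) X).share₁ = A.1 * X := by
  rw [smmRun_share_add, ← (alg.isFor p A).eq]

theorem real₀_eq : Task.real₀ (smmProtocol F alg) lam ⟨p, A, X⟩ =
    (corruption₀ F alg).realLaw A X lam := by
  simp only [Task.real₀, smmProtocol, Corruption.realLaw, PMF.map_bind, PMF.map_comp]
  refine congrArg (PMF.bind _) (funext fun key₀ => congrArg (PMF.map · _) (funext fun key₁ => ?_))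
  have h := smmRun_share_add_eq alg A X (F.fn lam key₀) (F.fn lam key₁)
  simp only [Function.comp_apply, Corruption.result]
  rw [eq_sub_of_add_eq' h, recv₀_eq, share₀_eq]
  exact congrArg (fun v => Data.list [v, _, _]) (ev_corruption₀_view ..).symm

theorem real₁_eq : Task.real₁ (smmProtocol F alg) lam ⟨p, A, X⟩ =
    (corruption₁ F alg).realLaw A X lam := by
  simp only [Task.real₁, smmProtocol, Corruption.realLaw, PMF.map_bind, PMF.map_comp]
  -- The own key, here that of `P₁`, comes first in `realLaw`.
  refine (PMF.bind_comm _ _ fun key₀ key₁ => PMF.pure _).trans ?_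
  refine congrArg (PMF.bind _) (funext fun key₁ => congrArg (PMF.map · _) (funext fun key₀ => ?_))
  have h := smmRun_share_add_eq alg A X (F.fn lam key₀) (F.fn lam key₁)
  simp only [Function.comp_apply, Corruption.result]
  rw [eq_sub_of_add_eq h, recv₁_eq, share₁_eq]
  exact congrArg (fun v => Data.list [v, _, _]) (ev_corruption₁_view ..).symm

theorem ideal₀_eq : Task.ideal₀ smmFunctionality (corruption₀ F alg).simulator lam ⟨p, A, X⟩ =
    (corruption₀ F alg).idealLaw A X lam := by
  simp only [Task.ideal₀, smmFunctionality, PMF.bind_map]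
  rfl

theorem ideal₁_eq : Task.ideal₁ smmFunctionality (corruption₁ F alg).simulator lam ⟨p, A, X⟩ =
    (corruption₁ F alg).idealLaw A X lam := by
  -- The functionality samples the output of `P₀`, but `idealLaw` that of the corrupted party.
  have hb : Function.Bijective fun Y : Fin p.m → Fin p.d → p.R => (fun i j => (A.1 * X) i j) - Y :=
    Function.Involutive.bijective fun Y => sub_sub_cancel _ _
  simp only [Task.ideal₁, smmFunctionality, Corruption.idealLaw]
  conv_rhs => rw [← map_uniform_of_bijective hb]
  rw [PMF.bind_map, PMF.bind_map]
  refine congrArg (PMF.bind _) (funext fun Y => ?_)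
  have h : A.1 * X - (A.1 * X - Matrix.of Y) = Matrix.of Y := sub_sub_cancel _ _
  exact congrArg (fun Z => PMF.map (fun v => Data.list [v, encMat Z, encMat (A.1 * X - Matrix.of
      Y)])
    ((corruption₁ F alg).simulator.run (.list [.unary lam, p.enc, encMat X,
      encMat (A.1 * X - Matrix.of Y)]))) h.symm

theorem enc_size_le_len : p.enc.size ≤ Task.Input.len (T := smmTask) ⟨p, A, X⟩ :=
  (Nat.le_add_right _ _).trans (Nat.le_add_right _ _)

end Laws

/-- The protocol is secure for every decomposition algorithm. -/
theorem smm_secure {F : KeyedFunction} (hF : F.IsSecurePRF) (alg : DecompAlg) :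
    Task.SecurelyRealizes (smmProtocol F alg) smmFunctionality := by
  refine ⟨(corruption₀ F alg).simulator, (corruption₁ F alg).simulator, fun D q => ?_,
    fun D q => ?_⟩
  · obtain ⟨μ, hμ, h⟩ := (corruption₀ F alg).exists_negligible D hF q
    refine ⟨μ, hμ, fun lam ⟨p, A, X⟩ ha => ?_⟩
    exact (congrArg₂ (fun x y => |accept (x.bind (D.run lam)) - accept (y.bind (D.run lam))| ≤ μ
        lam)
      (ideal₀_eq F alg A X lam) (real₀_eq F alg A X lam)).mpr
      (h lam A X ((enc_size_le_len A X).trans ha))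
  · obtain ⟨μ, hμ, h⟩ := (corruption₁ F alg).exists_negligible D hF q
    refine ⟨μ, hμ, fun lam ⟨p, A, X⟩ ha => ?_⟩
    exact (congrArg₂ (fun x y => |accept (x.bind (D.run lam)) - accept (y.bind (D.run lam))| ≤ μ
        lam)
      (ideal₁_eq F alg A X lam) (real₁_eq F alg A X lam)).mpr
      (h lam A X ((enc_size_le_len A X).trans ha))

end

end SMM

theorem mainTheorem7 (F : SMM.KeyedFunction) (hF : F.IsSecurePRF) :
    Nonempty SMM.DecompAlg ∧
      ∀ alg : SMM.DecompAlg,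
        SMM.Task.SecurelyRealizes (SMM.smmProtocol F alg) SMM.smmFunctionality :=
  ⟨⟨SMM.decompAlg⟩, fun alg => SMM.smm_secure hF alg⟩
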